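/- **Model.** $N$ nodes lie at distinct points of the Euclidean plane, any two of them at distance at most $R_0=(P/(\beta\theta))^{1/\alpha}$, where $P>0$ is the transmit power, $\alpha\in(2,6]$ the path-loss exponent, $\beta>1$ the SINR threshold and $\theta>0$ the noise threshold (so for $N\ge 2$ every node has a neighbour in $N_{R_0}(v)$). If in a round the set $W$ of nodes transmits and the noise at $v$ is $n_v\ge 0$, a listening node $v\notin W$ senses an *idle* channel if $\sum_{w\in W}P\,d(w,v)^{-\alpha}+n_v<\theta$; it *receives* the message of $u\in W$ if this sum exceeds $\theta$ and $P\,d(u,v)^{-\alpha}\ge \beta\bigl(\sum_{w\in W\setminus\{u\}}P\,d(w,v)^{-\alpha}+n_v\bigr)$; otherwise the channel is busy. A round has a *successful transmission* if exactly one node transmits and its message is received by some node. **Protocol** (leader-election phase of BLOWN, constants $\hat p\in(0,1)$ and $\gamma>0$). Node $v$ starts with $p_v=\hat p$, $T_v=1$, $c_v=0$ and a leader counter $l_v=l_v^0\in\mathbb N$; at least one $l_v^0$ is positive. Nodes with $l_v=0$ only listen. In each round each node with $l_v>0$ transmits, independently, with probability $p_v$. If it does not transmit: on an idle channel it sets $p_v:=\min\{(1+\gamma)p_v,\hat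 p\}$ and $T_v:=\max\{1,T_v-1\}$; on receiving a message it sets $p_v:=p_v/(1+\gamma)$ and $l_v:=l_v-1$. Then (whether it transmitted or not) it sets $c_v:=c_v+1$; if now $c_v\ge T_v$, it sets $c_v:=1$, and if moreover it sensed no idle channel in the past $T_v$ rounds, it sets $p_v:=p_v/(1+\gamma)$ and $T_v:=T_v+2$. The phase is run for $F$ rounds, without stopping when a leader is recognized. **Jammer.** The jammer knows the whole history and chooses the noise $n_v$ at every node before each round, independently of the nodes' random choices in that round. A round is jammed if $n_v\ge\theta$ for some $v$. The jammer is $((1-\epsilon),T)$-bounded if among any $T$ consecutive rounds at most $(1-\epsilon)T$ are jammed. **Theorem.** Let $\hat p\in(0,1)$ and $\beta'>0$. There are constants $\rho=\rho(\epsilon)>0$ (depending only on $\epsilon,\hat p,\beta'$) such that for every $c\ge 1$ there are constants $K,C>0$ (depending only on $\hat p,\beta',c$) with the following property. For every $\epsilon\in(0,1]$, all sufficiently large $N$ (in terms of $\epsilon,\hat p,\beta',c$), all node positions and parameters as above, all initial leader counters as above, all integers $T\ge1$, all $0<\gamma\le C/(\log T+\log\log N)$, every $((1-\epsilon),T)$-bounded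 jammer and every integer $$F\ \ge\ K\left(\frac{T\log N}{\epsilon}+\frac{(\log N)^4}{(\gamma\epsilon)^2}\right),$$ running the protocol for $F$ rounds yields, with probability at least $1-N^{-c}$, at least $$(1-\epsilon\beta')\,\rho\, e^{-\rho/(1-\hat p)}\,F$$ rounds with a successful transmission. -/

import Mathlib

open scoped NNReal ENNReal

namespace Blown

/-! ### The wireless channel (SINR model) -/

/-- The plane in which the nodes are deployed. -/
abbrev Plane : Type := EuclideanSpace ℝ (Fin 2)

/-- Radio parameters: uniform transmit power `P`, path-loss exponent `α`, SINR threshold `β`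
and noise threshold `θ`. -/
structure Radio where
  P : ℝ
  α : ℝ
  β : ℝ
  θ : ℝ
  P_pos : 0 < P
  two_lt_α : 2 < α
  α_le_six : α ≤ 6
  one_lt_β : 1 < β
  θ_pos : 0 < θ

namespace Radio

/-- The transmission range `R₀ = (P / (β θ)) ^ (1 / α)`. -/
noncomputable def range (R : Radio) : ℝ := (R.P / (R.β * R.θ)) ^ (1 / R.α)

/-- Power `P · d(x, y) ^ (-α)` received at `y` from a transmitter at `x`. -/
noncomputable def power (R : Radio) (x y : Plane) : ℝ := R.P * dist x y ^ (-R.α)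

variable {V : Type*} [DecidableEq V]

/-- Total received signal strength at `v` when the nodes in `W` transmit and the composite noise
(environment and adversary) is `noise`. -/
noncomputable def rss (R : Radio) (pos : V → Plane) (noise : V → ℝ≥0) (W : Finset V) (v : V) : ℝ :=
  ∑ w ∈ W, R.power (pos w) (pos v) + noise v

/-- Interference plus noise at `v` with respect to the transmitter `u`. -/
noncomputable def interferenceNoise (R : Radio) (pos : V → Plane) (noise : V → ℝ≥0)
    (W : Finset V) (u v : V) : ℝ :=
  ∑ w ∈ W.erase u, R.power (pos w) (pos v) + noise v

/-- `v` correctly receives the message of `u`: `u` transmits, `v` listens (half-duplex), the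
measured power exceeds `θ`, and `SINR ≥ β`.  The last condition is written without a division,
so that it also reads correctly when interference plus noise vanishes. -/
def Receives (R : Radio) (pos : V → Plane) (noise : V → ℝ≥0) (W : Finset V) (u v : V) : Prop :=
  u ∈ W ∧ v ∉ W ∧ R.θ < R.rss pos noise W v ∧
    R.β * R.interferenceNoise pos noise W u v ≤ R.power (pos u) (pos v)

/-- A round with a successful transmission: exactly one node transmits, and its message is
correctly received. -/
def Successful (R : Radio) (pos : V → Plane) (noise : V → ℝ≥0) (W : Finset V) : Prop :=
  ∃ u v, W = {u} ∧ R.Receives pos noise W u v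

end Radio

/-- What a node experiences in (slot one of) a round. -/
inductive Observation where
  | transmit
  | idle
  | receive
  | busy

open scoped Classical in
/-- The observation of node `v` when the nodes in `W` transmit. -/
noncomputable def observe {V : Type*} (R : Radio) (pos : V → Plane) (noise : V → ℝ≥0)
    (W : Finset V) (v : V) : Observation :=
  if v ∈ W then .transmit
  else if R.rss pos noise W v < R.θ then .idle
  else if ∃ u, R.Receives pos noise W u v then .receive
  else .busy

/-! ### The protocol (phase one) -/

/-- Protocol constants: the maximum transmission probability `p̂` and the step parameter `γ`. -/
structure Protocol where
  pHat : ℝ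
  γ : ℝ
  pHat_pos : 0 < pHat
  pHat_lt_one : pHat < 1
  γ_pos : 0 < γ

/-- Local variables of a node: transmission probability `p_v`, estimate `T_v` of the time window
of the adversary, round counter `c_v`, leader counter `l_v`, and the number of rounds that have
passed since the node last sensed an idle channel (or since the start). -/
structure NodeState where
  p : ℝ
  T : ℕ
  c : ℕ
  l : ℕ
  sinceIdle : ℕ

/-- Initialization: `p_v = p̂`, `T_v = 1`, `c_v = 0`, `l_v = l_v⁰`. -/
def NodeState.init (B : Protocol) (l₀ : ℕ) : NodeState :=
  { p := B.pHat, T := 1, c := 0, l := l₀, sinceIdle := 0 }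

/-- First part of the PoC subroutine: reaction to the sensed channel. -/
noncomputable def NodeState.react (B : Protocol) (s : NodeState) : Observation → NodeState
  | .transmit => { s with sinceIdle := s.sinceIdle + 1 }
  | .idle => { s with p := min ((1 + B.γ) * s.p) B.pHat, T := max 1 (s.T - 1), sinceIdle := 0 }
  | .receive =>
      { s with p := (1 + B.γ)⁻¹ * s.p, l := s.l - 1, sinceIdle := s.sinceIdle + 1 }
  | .busy => { s with sinceIdle := s.sinceIdle + 1 }

/-- Second part of the PoC subroutine: increase `c_v`; if `c_v ≥ T_v`, reset `c_v` to `1`, and if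
moreover none of the past `T_v` rounds was sensed idle, decrease `p_v` and increase `T_v`. -/
noncomputable def NodeState.tick (B : Protocol) (s : NodeState) : NodeState :=
  if s.T ≤ s.c + 1 then
    if s.T ≤ s.sinceIdle then { s with c := 1, p := (1 + B.γ)⁻¹ * s.p, T := s.T + 2 }
    else { s with c := 1 }
  else { s with c := s.c + 1 }

/-- One round of one node: potential leaders (`l_v > 0`) run the PoC subroutine, followers
(`l_v = 0`) only listen. -/
noncomputable def NodeState.step (B : Protocol) (s : NodeState) (o : Observation) : NodeState :=
  if 0 < s.l then (s.react B o).tick B else s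

/-- The probability with which a node transmits in the next round. -/
def NodeState.transmitProb (s : NodeState) : ℝ := if 0 < s.l then s.p else 0

/-! ### Jammers and executions

The history of an execution is the list of the sets of nodes that transmitted in the rounds
played so far, the latest round first; together with the initial leader counters it determines
the local states of all nodes. -/

/-- A jammer: it chooses the noise at every node in the next round, knowing the protocol and the
whole history, but not the random choices of the nodes in that round. -/
abbrev Jammer (V : Type*) : Type _ := List (Finset V) → V → ℝ≥0

/-- The round that follows the history `h` is jammed if the noise reaches the threshold `θ` at
some node. -/
def Jammer.Jams {V : Type*} (R : Radio) (J : Jammer V) (h : List (Finset V)) : Prop :=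
  ∃ v, R.θ ≤ J h v

open scoped Classical in
/-- The jammer is `((1 - ε), T)`-bounded: among any `T` consecutive rounds, at most `(1 - ε) T`
are jammed.  The window consists of the rounds that follow `h` without its `k` latest entries,
`k < T`. -/
def Jammer.IsBounded {V : Type*} (R : Radio) (J : Jammer V) (ε : ℝ) (T : ℕ) : Prop :=
  ∀ h : List (Finset V), T ≤ h.length + 1 →
    (((Finset.range T).filter fun k => J.Jams R (h.drop k)).card : ℝ) ≤ (1 - ε) * T

/-- The local states of all nodes after the history `h`. -/
noncomputable def stateAfter {V : Type*} (R : Radio) (B : Protocol) (pos : V → Plane)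
    (l₀ : V → ℕ) (J : Jammer V) : List (Finset V) → V → NodeState
  | [], v => NodeState.init B (l₀ v)
  | W :: h, v => (stateAfter R B pos l₀ J h v).step B (observe R pos (J h) W v)

open scoped Classical in
/-- The number of rounds of the history with a successful transmission. -/
noncomputable def successes {V : Type*} (R : Radio) (pos : V → Plane) (J : Jammer V) :
    List (Finset V) → ℕ
  | [] => 0
  | W :: h => successes R pos J h + if R.Successful pos (J h) W then 1 else 0

/-- Random set that contains every `v` independently with probability `q v`.  (Values of `q`
outside `[0, 1]` are truncated; they do not occur below.) -/
noncomputable def randomSet {V : Type*} [Fintype V] [DecidableEq V] (q : V → ℝ) :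
    PMF (Finset V) :=
  PMF.ofFintype
    (fun W => (∏ v ∈ W, min (ENNReal.ofReal (q v)) 1) *
      ∏ v ∈ Finset.univ \ W, (1 - min (ENNReal.ofReal (q v)) 1))
    (by
      rw [← Finset.powerset_univ, ← Finset.prod_add]
      exact Finset.prod_eq_one fun v _ => add_tsub_cancel_of_le (min_le_right _ _))

/-- The distribution of the history after `n` rounds. -/
noncomputable def execution {V : Type*} [Fintype V] [DecidableEq V] (R : Radio) (B : Protocol)
    (pos : V → Plane) (l₀ : V → ℕ) (J : Jammer V) : ℕ → PMF (List (Finset V))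
  | 0 => PMF.pure []
  | n + 1 => (execution R B pos l₀ J n).bind fun h =>
      (randomSet fun v => (stateAfter R B pos l₀ J h v).transmitProb).map fun W => W :: h

theorem NodeState.step_p_mem {B : Protocol} {s : NodeState} (hs : 0 < s.p ∧ s.p ≤ B.pHat)
    (o : Observation) : 0 < (s.step B o).p ∧ (s.step B o).p ≤ B.pHat := by
  have hγ := B.γ_pos
  have hp := B.pHat_pos
  have hdec : ∀ x : ℝ, 0 < x ∧ x ≤ B.pHat →
      0 < (1 + B.γ)⁻¹ * x ∧ (1 + B.γ)⁻¹ * x ≤ B.pHat := fun x hx =>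
    ⟨mul_pos (inv_pos.2 (by linarith)) hx.1,
      (mul_le_of_le_one_left hx.1.le (inv_le_one_of_one_le₀ (by linarith))).trans hx.2⟩
  have hreact : 0 < (s.react B o).p ∧ (s.react B o).p ≤ B.pHat := by
    cases o with
    | transmit => exact hs
    | idle => exact ⟨lt_min (mul_pos (by linarith) hs.1) hp, min_le_right _ _⟩
    | receive => exact hdec _ hs
    | busy => exact hs
  unfold NodeState.step
  split_ifs
  · unfold NodeState.tick
    split_ifs
    · exact hdec _ hreact
    · exact hreact
    · exact hreact
  · exact hs

/-- The transmission probabilities stay in `(0, p̂]`; no truncation occurs in `execution`. -/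
theorem stateAfter_p_mem {V : Type*} (R : Radio) (B : Protocol) (pos : V → Plane)
    (l₀ : V → ℕ) (J : Jammer V) (h : List (Finset V)) (v : V) :
    0 < (stateAfter R B pos l₀ J h v).p ∧ (stateAfter R B pos l₀ J h v).p ≤ B.pHat := by
  induction h with
  | nil => exact ⟨B.pHat_pos, le_rfl⟩
  | cons W h ih => exact NodeState.step_p_mem ih _

end Blown

/-!
Two exponential supermartingales along the random history carry the proof.

*The load is rarely high.* The load of a history is the sum of the (slightly smoothed) transmission
probabilities of all potential leaders; a round is high when the load is at least an absolute
constant. In a high round silence is rare, so idle channels cannot raise the load as fast as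
receptions, caused by every lone transmitter, lower it. Nodes at which the noise hides both are
lowered by the timeout rule, at the price of a longer time window. `Scenario.pot` therefore adds up
the largest window, a multiple of the function `bend` (exponential below zero, linear above) of the
logarithmic excess of the load, and a small term that involves the backlog, the amount by which
clear rounds have recently fallen behind the fraction `ε` that a bounded jammer must leave. While
the load is low, a jammed round may raise it a little, and the growing backlog pays for this; a
clear round, which reduces the backlog, is silent with constant probability, and silence shrinks the
windows. The backlog is at most `ε T` and its weight `Scenario.penalty` is of order `exp (-1 / γ)`,
which the condition `γ (log T + log log N) ≤ 1 / 2` makes sufficiently small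
(`Scenario.tuned_of_large`). The square of the potential grows by `O(1)` per round on average and
loses a multiple of `G` in high rounds (`Scenario.Tuned.mean_exp_pot_le`). As it is nonnegative, at
most a small fraction of the `F` rounds is high, up to an error probability `exp (-√F / O(G))`
(`Scenario.Tuned.measure_highCount_le`); here `F` has to exceed a multiple of `(log N) ^ 4 / γ ^ 2`.

*Some node survives, and a survivor goes with many successes.* A transmitter keeps its leader
counter and a silent round changes no counter, so some node `v` has a positive counter at the end of
the run (`Scenario.exists_leader`). `NodeState.slack` is essentially the depth of `p_v` below `p̂`,
counted in factors `1 + γ`, minus half of the capped time window of `v`; timeouts leave it almost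
unchanged. An idle channel lowers the slack of a deep node, and a reception raises it. But a message
of `u` that is captured among others would also be received if `u` transmitted alone; so, whatever
the jammer does, the probability of a reception at `v` is at most that of a success divided by that
of silence (`Scenario.mean_receive_le`). A clear round that is not high is idle with constant
probability if `v` is deep, and a success with constant probability if `v` is not. Hence the slack
minus the weighted number of successes has negative drift in these rounds, `Scenario.survivorMart`
is a supermartingale, and a fixed node survives a run with `Ω(ε F)` clear rounds, few high rounds
and few successes with probability at most `exp (-Ω(ε F))` (`Scenario.measure_survivor_le`).

The jammer leaves at least `ε (F - T)` rounds clear, and a union bound over the `N` possible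
survivors finishes the proof. The success rate `ρ` is a multiple of `ε` that depends on `p̂`; the
factors `1 - ε β'` and `exp (-ρ / (1 - p̂))` of the required rate are at most `1` and are not needed.
-/

namespace Blown

/-! ### Random transmission sets and supermartingales along the execution -/

section RandomSet

variable {V : Type*} [Fintype V]

/-- The probability that nobody transmits. -/
def silence (q : V → ℝ) : ℝ := ∏ v, (1 - q v)

theorem silence_nonneg {q : V → ℝ} (hq : ∀ v, 0 ≤ q v ∧ q v ≤ 1) : 0 ≤ silence q :=
  Finset.prod_nonneg fun v _ => sub_nonneg.2 (hq v).2

/-- Silence is likely when the expected number of transmitters is small; this uses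
`1 / (1 - q) ≤ exp (q / (1 - r))` for `q ≤ r`. -/
theorem exp_neg_le_silence {q : V → ℝ} {r : ℝ} (hr : r < 1) (hq : ∀ v, 0 ≤ q v ∧ q v ≤ r) :
    Real.exp (-(∑ v, q v) / (1 - r)) ≤ silence q := by
  have hr' : 0 < 1 - r := by linarith
  rw [silence, neg_div, Finset.sum_div, ← Finset.sum_neg_distrib, Real.exp_sum]
  refine Finset.prod_le_prod (fun v _ => (Real.exp_pos _).le) fun v _ => ?_
  have h1 : 0 < 1 - q v := by linarith [(hq v).2]
  have h2 : 1 / (1 - q v) ≤ Real.exp (q v / (1 - r)) := by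
    refine le_trans ?_ (Real.add_one_le_exp _)
    rw [div_le_iff₀ h1]
    have h3 : q v ≤ q v / (1 - r) * (1 - q v) := by
      rw [div_mul_eq_mul_div, le_div_iff₀ hr']
      exact mul_le_mul_of_nonneg_left (by linarith [(hq v).2]) (hq v).1
    linarith
  rw [Real.exp_neg, inv_le_comm₀ (Real.exp_pos _) h1, ← one_div]
  exact h2

variable [DecidableEq V]

/-- The probability of the set `W` when every `v` is chosen independently with probability
`q v`. -/
def setWeight (q : V → ℝ) (W : Finset V) : ℝ :=
  (∏ v ∈ W, q v) * ∏ v ∈ Finset.univ \ W, (1 - q v)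

/-- The mean of `f` over a random set that contains every `v` independently with probability
`q v`. -/
def mean (q : V → ℝ) (f : Finset V → ℝ) : ℝ := ∑ W, setWeight q W * f W

theorem setWeight_nonneg {q : V → ℝ} (hq : ∀ v, 0 ≤ q v ∧ q v ≤ 1) (W : Finset V) :
    0 ≤ setWeight q W :=
  mul_nonneg (Finset.prod_nonneg fun v _ => (hq v).1)
    (Finset.prod_nonneg fun v _ => sub_nonneg.2 (hq v).2)

theorem sum_setWeight (q : V → ℝ) : ∑ W, setWeight q W = 1 := by
  unfold setWeight
  rw [← Finset.powerset_univ, ← Finset.prod_add]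
  exact Finset.prod_eq_one fun v _ => by ring

theorem mean_const (q : V → ℝ) (a : ℝ) : mean q (fun _ => a) = a := by
  rw [mean, ← Finset.sum_mul, sum_setWeight, one_mul]

theorem mean_add (q : V → ℝ) (f g : Finset V → ℝ) :
    mean q (fun W => f W + g W) = mean q f + mean q g := by
  simp only [mean, mul_add, Finset.sum_add_distrib]

theorem mean_sub (q : V → ℝ) (f g : Finset V → ℝ) :
    mean q (fun W => f W - g W) = mean q f - mean q g := by
  simp only [mean, mul_sub, Finset.sum_sub_distrib]

theorem mean_const_mul (q : V → ℝ) (a : ℝ) (f : Finset V → ℝ) :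
    mean q (fun W => a * f W) = a * mean q f := by
  simp only [mean, Finset.mul_sum]
  exact Finset.sum_congr rfl fun W _ => by ring

theorem mean_mono {q : V → ℝ} (hq : ∀ v, 0 ≤ q v ∧ q v ≤ 1) {f g : Finset V → ℝ}
    (h : ∀ W, f W ≤ g W) : mean q f ≤ mean q g :=
  Finset.sum_le_sum fun W _ => mul_le_mul_of_nonneg_left (h W) (setWeight_nonneg hq W)

theorem mean_nonneg {q : V → ℝ} (hq : ∀ v, 0 ≤ q v ∧ q v ≤ 1) {f : Finset V → ℝ}
    (h : ∀ W, 0 ≤ f W) : 0 ≤ mean q f :=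
  Finset.sum_nonneg fun W _ => mul_nonneg (setWeight_nonneg hq W) (h W)

theorem setWeight_empty (q : V → ℝ) : setWeight q ∅ = silence q := by
  simp [setWeight, silence]

theorem le_setWeight_singleton {q : V → ℝ} (hq : ∀ v, 0 ≤ q v ∧ q v ≤ 1) (u : V) :
    q u * silence q ≤ setWeight q {u} := by
  have h0 : 0 ≤ ∏ v ∈ Finset.univ \ {u}, (1 - q v) :=
    Finset.prod_nonneg fun v _ => sub_nonneg.2 (hq v).2
  rw [setWeight, Finset.prod_singleton, silence,
    ← Finset.mul_prod_erase _ _ (Finset.mem_univ u), Finset.erase_eq]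
  refine mul_le_mul_of_nonneg_left ?_ (hq u).1
  exact mul_le_of_le_one_left h0 (by linarith [(hq u).1])

theorem mean_ite_empty (q : V → ℝ) (a : ℝ) :
    mean q (fun W => if W = ∅ then a else 0) = a * silence q := by
  simp [mean, setWeight_empty, mul_comm]

theorem mean_ite_mem (q : V → ℝ) (u : V) :
    mean q (fun W => if u ∈ W then 1 else 0) = q u := by
  have h := Finset.prod_add q (fun v => if v = u then 0 else 1 - q v) Finset.univ
  rw [Finset.powerset_univ] at h
  have h1 : ∏ v, (q v + if v = u then 0 else 1 - q v) = q u := by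
    rw [← Finset.mul_prod_erase _ _ (Finset.mem_univ u), Finset.prod_eq_one]
    · simp
    · intro v hv
      simp [Finset.ne_of_mem_erase hv]
  rw [← h1, h, mean]
  refine Finset.sum_congr rfl fun W _ => ?_
  unfold setWeight
  by_cases hu : u ∈ W
  · rw [if_pos hu, mul_one]
    congr 1
    refine Finset.prod_congr rfl fun v hv => ?_
    rw [if_neg]
    rintro rfl
    exact (Finset.mem_sdiff.1 hv).2 hu
  · rw [if_neg hu, Finset.prod_eq_zero (i := u) (s := Finset.univ \ W)
      (f := fun v => if v = u then (0 : ℝ) else 1 - q v) (by simp [hu]) (by simp)]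
    ring

/-- A function that is at least `g u` on every singleton `{u}` has mean at least
`silence q * ∑ u, q u * g u`. -/
theorem le_mean_of_singleton {q : V → ℝ} (hq : ∀ v, 0 ≤ q v ∧ q v ≤ 1) {f : Finset V → ℝ}
    (hf : ∀ W, 0 ≤ f W) {g : V → ℝ} (hg : ∀ u, 0 ≤ g u) (hfg : ∀ u, g u ≤ f {u}) :
    silence q * ∑ u, q u * g u ≤ mean q f := by
  have h1 : ∑ u, setWeight q {u} * f {u} ≤ mean q f := by
    have := Finset.sum_le_sum_of_subset_of_nonneg
      (Finset.subset_univ ((Finset.univ : Finset V).image fun u => ({u} : Finset V)))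
      (f := fun W => setWeight q W * f W)
      fun W _ _ => mul_nonneg (setWeight_nonneg hq W) (hf W)
    rwa [Finset.sum_image fun a _ b _ h => Finset.singleton_injective h] at this
  refine le_trans ?_ h1
  rw [Finset.mul_sum]
  refine Finset.sum_le_sum fun u _ => ?_
  calc silence q * (q u * g u) = (q u * silence q) * g u := by ring
    _ ≤ setWeight q {u} * f {u} :=
      mul_le_mul (le_setWeight_singleton hq u) (hfg u) (hg u) (setWeight_nonneg hq _)

/-- At most half of the time the channel is silent once the expected number of transmitters is at
least one. -/
theorem silence_le_half {q : V → ℝ} (hq : ∀ v, 0 ≤ q v ∧ q v ≤ 1) (h1 : 1 ≤ ∑ v, q v) :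
    silence q ≤ 1 / 2 := by
  have h := le_mean_of_singleton hq (f := fun W => 1 - if W = ∅ then 1 else 0)
    (fun W => by split_ifs <;> norm_num) (g := fun _ => 1) (fun _ => zero_le_one) (by simp)
  rw [mean_sub, mean_const, mean_ite_empty] at h
  simp only [mul_one, one_mul] at h
  nlinarith [silence_nonneg hq]

theorem randomSet_apply {q : V → ℝ} (hq : ∀ v, 0 ≤ q v ∧ q v ≤ 1) (W : Finset V) :
    randomSet q W = ENNReal.ofReal (setWeight q W) := by
  have h1 : ∀ v, min (ENNReal.ofReal (q v)) 1 = ENNReal.ofReal (q v) := fun v =>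
    min_eq_left (by simpa using (hq v).2)
  have h2 : ∀ v, 1 - ENNReal.ofReal (q v) = ENNReal.ofReal (1 - q v) := fun v => by
    rw [ENNReal.ofReal_sub _ (hq v).1, ENNReal.ofReal_one]
  rw [randomSet, PMF.ofFintype_apply, setWeight,
    ENNReal.ofReal_mul (Finset.prod_nonneg fun v _ => (hq v).1),
    ENNReal.ofReal_prod_of_nonneg fun v _ => (hq v).1,
    ENNReal.ofReal_prod_of_nonneg fun v _ => sub_nonneg.2 (hq v).2]
  simp only [h1, h2]

end RandomSet

section Execution

variable {V : Type*} (R : Radio) (B : Protocol) (pos : V → Plane) (l₀ : V → ℕ) (J : Jammer V)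

/-- The probability with which `v` transmits in the round after the history `h`. -/
noncomputable def sendProb (h : List (Finset V)) (v : V) : ℝ :=
  (stateAfter R B pos l₀ J h v).transmitProb

theorem sendProb_mem (h : List (Finset V)) (v : V) :
    0 ≤ sendProb R B pos l₀ J h v ∧ sendProb R B pos l₀ J h v ≤ B.pHat := by
  have := stateAfter_p_mem R B pos l₀ J h v
  unfold sendProb NodeState.transmitProb
  split_ifs
  · exact ⟨this.1.le, this.2⟩
  · exact ⟨le_rfl, B.pHat_pos.le⟩

theorem sendProb_mem_unit (h : List (Finset V)) (v : V) :
    0 ≤ sendProb R B pos l₀ J h v ∧ sendProb R B pos l₀ J h v ≤ 1 :=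
  ⟨(sendProb_mem R B pos l₀ J h v).1, (sendProb_mem R B pos l₀ J h v).2.trans B.pHat_lt_one.le⟩

variable [Fintype V] [DecidableEq V]

theorem mem_support_execution_succ {n : ℕ} {h' : List (Finset V)}
    (hh : h' ∈ (execution R B pos l₀ J (n + 1)).support) :
    ∃ h ∈ (execution R B pos l₀ J n).support, ∃ W, h' = W :: h ∧
      setWeight (sendProb R B pos l₀ J h) W ≠ 0 := by
  rw [execution, PMF.mem_support_bind_iff] at hh
  obtain ⟨h, hh, h2⟩ := hh
  rw [PMF.mem_support_map_iff] at h2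
  obtain ⟨W, hW, rfl⟩ := h2
  refine ⟨h, hh, W, rfl, fun h0 => ?_⟩
  rw [PMF.mem_support_iff] at hW
  apply hW
  have := randomSet_apply (sendProb_mem_unit R B pos l₀ J h) W
  rw [h0, ENNReal.ofReal_zero] at this
  exact this

theorem length_of_mem_support {n : ℕ} {h : List (Finset V)}
    (hh : h ∈ (execution R B pos l₀ J n).support) : h.length = n := by
  induction n generalizing h with
  | zero => simpa [execution] using hh
  | succ n ih =>
    obtain ⟨h, h1, W, rfl, -⟩ := mem_support_execution_succ R B pos l₀ J hh
    simp [ih h1]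

/-- A nonnegative function of the history whose conditional mean never increases has, after any
number of rounds, a mean of at most its initial value. -/
theorem tsum_execution_le {F : ℕ} {f : List (Finset V) → ℝ} (hf : ∀ h, 0 ≤ f h)
    (hstep : ∀ h : List (Finset V), h.length < F →
      mean (sendProb R B pos l₀ J h) (fun W => f (W :: h)) ≤ f h) (n : ℕ) (hn : n ≤ F) :
    ∑' h, execution R B pos l₀ J n h * ENNReal.ofReal (f h) ≤ ENNReal.ofReal (f []) := by
  induction n with
  | zero =>
    rw [tsum_eq_single []]
    · simp [execution]
    · intro h hh
      simp [execution, hh]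
  | succ n ih =>
    refine le_trans ?_ (ih (by omega))
    have key : ∀ h : List (Finset V),
        ∑' h', (PMF.map (fun W => W :: h) (randomSet (sendProb R B pos l₀ J h))) h' *
          ENNReal.ofReal (f h') =
        ENNReal.ofReal (mean (sendProb R B pos l₀ J h) (fun W => f (W :: h))) := by
      intro h
      have hq := sendProb_mem_unit R B pos l₀ J h
      simp only [PMF.map_apply]
      simp_rw [← ENNReal.tsum_mul_right]
      rw [ENNReal.tsum_comm]
      simp_rw [ite_mul, zero_mul]
      simp only [tsum_ite_eq]
      rw [tsum_fintype, mean, ENNReal.ofReal_sum_of_nonneg fun W _ =>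
        mul_nonneg (setWeight_nonneg hq W) (hf _)]
      refine Finset.sum_congr rfl fun W _ => ?_
      rw [randomSet_apply hq, ENNReal.ofReal_mul (setWeight_nonneg hq W)]
    calc ∑' h', execution R B pos l₀ J (n + 1) h' * ENNReal.ofReal (f h')
        = ∑' h, execution R B pos l₀ J n h *
            ∑' h', (PMF.map (fun W => W :: h) (randomSet (sendProb R B pos l₀ J h))) h' *
              ENNReal.ofReal (f h') := by
          simp only [execution, PMF.bind_apply, ← ENNReal.tsum_mul_right, ← ENNReal.tsum_mul_left]
          rw [ENNReal.tsum_comm]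
          simp only [mul_assoc]
          rfl
      _ ≤ _ := by
          refine ENNReal.tsum_le_tsum fun h => ?_
          by_cases hs : h ∈ (execution R B pos l₀ J n).support
          · rw [key]
            have := length_of_mem_support R B pos l₀ J hs
            exact mul_le_mul_right (ENNReal.ofReal_le_ofReal (hstep h (by omega))) _
          · rw [PMF.mem_support_iff, not_not] at hs
            rw [hs, zero_mul, zero_mul]

/-- Markov's inequality for a supermartingale of the execution. -/
theorem toOuterMeasure_execution_le {F : ℕ} {f : List (Finset V) → ℝ} (hf : ∀ h, 0 ≤ f h)
    (hstep : ∀ h : List (Finset V), h.length < F →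
      mean (sendProb R B pos l₀ J h) (fun W => f (W :: h)) ≤ f h) {a : ℝ} (ha : 0 < a)
    {s : Set (List (Finset V))}
    (hs : ∀ h ∈ s, h ∈ (execution R B pos l₀ J F).support → a ≤ f h) :
    (execution R B pos l₀ J F).toOuterMeasure s ≤ ENNReal.ofReal (f [] / a) := by
  rw [ENNReal.ofReal_div_of_pos ha]
  rw [ENNReal.le_div_iff_mul_le (Or.inl (by simpa using ha)) (Or.inl ENNReal.ofReal_ne_top)]
  refine le_trans ?_ (tsum_execution_le R B pos l₀ J hf hstep F le_rfl)
  rw [PMF.toOuterMeasure_apply, ← ENNReal.tsum_mul_right]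
  refine ENNReal.tsum_le_tsum fun h => ?_
  by_cases hh : h ∈ s
  · rw [Set.indicator_of_mem hh]
    by_cases hsup : h ∈ (execution R B pos l₀ J F).support
    · exact mul_le_mul_right (ENNReal.ofReal_le_ofReal (hs h hh hsup)) _
    · rw [PMF.mem_support_iff, not_not] at hsup
      rw [hsup, zero_mul, zero_mul]
  · rw [Set.indicator_of_notMem hh, zero_mul]
    exact zero_le

end Execution

/-! ### One round of one node -/

namespace NodeState

/-- The invariant of the round counter: between rounds `c_v ≤ T_v`, and `T_v ≥ 1`. -/
def Valid (s : NodeState) : Prop := 1 ≤ s.T ∧ s.c ≤ s.T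

/-- The number of rounds until the next decrease of `p_v` by the timeout rule if the node senses
no idle channel from now on.  The next check takes place after `max 1 (T_v - c_v)` rounds; if the
last idle round is then too recent, the check after it succeeds. -/
def timer (s : NodeState) : ℕ :=
  if s.T ≤ s.sinceIdle + max 1 (s.T - s.c) then max 1 (s.T - s.c)
  else max 1 (s.T - s.c) + max 1 (s.T - 1)

/-- The transmission probability of a potential leader, inflated by a factor between `1` and
`1 + γ / 4` that decreases steadily while no idle channel is sensed. -/
noncomputable def smoothed (B : Protocol) (s : NodeState) : ℝ :=
  if 0 < s.l then s.p * (1 + B.γ * s.timer / (8 * s.T)) else 0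

/-- The window estimate `T_v`, interpolated so that it grows by `O(1 / T_v)` per round. -/
noncomputable def window (s : NodeState) : ℝ :=
  if 0 < s.l then s.T + 2 * s.c / s.T else 0

theorem tick_cases (B : Protocol) (s : NodeState) :
    (s.c + 1 < s.T ∧ s.tick B = { s with c := s.c + 1 }) ∨
    (s.T ≤ s.c + 1 ∧ s.sinceIdle < s.T ∧ s.tick B = { s with c := 1 }) ∨
    (s.T ≤ s.c + 1 ∧ s.T ≤ s.sinceIdle ∧
      s.tick B = { s with c := 1, p := (1 + B.γ)⁻¹ * s.p, T := s.T + 2 }) := by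
  unfold tick
  by_cases h1 : s.T ≤ s.c + 1
  · by_cases h2 : s.T ≤ s.sinceIdle
    · exact Or.inr (Or.inr ⟨h1, h2, by rw [if_pos h1, if_pos h2]⟩)
    · exact Or.inr (Or.inl ⟨h1, by omega, by rw [if_pos h1, if_neg h2]⟩)
  · exact Or.inl ⟨by omega, by rw [if_neg h1]⟩

theorem step_of_pos {s : NodeState} (hl : 0 < s.l) (B : Protocol) (o : Observation) :
    s.step B o = (s.react B o).tick B := if_pos hl

theorem step_of_not_pos {s : NodeState} (hl : ¬ 0 < s.l) (B : Protocol) (o : Observation) :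
    s.step B o = s := if_neg hl

theorem step_idle {s : NodeState} (hl : 0 < s.l) (B : Protocol) :
    s.step B .idle = { s with
      p := min ((1 + B.γ) * s.p) B.pHat
      T := max 1 (s.T - 1)
      c := if max 1 (s.T - 1) ≤ s.c + 1 then 1 else s.c + 1
      sinceIdle := 0 } := by
  rw [step_of_pos hl]
  rcases tick_cases B (s.react B .idle) with ⟨h, h'⟩ | ⟨h, -, h'⟩ | ⟨h, h2, h'⟩ <;> rw [h']
  · simp only [react] at h ⊢
    rw [if_neg (by omega)]
  · simp only [react] at h ⊢
    rw [if_pos h]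
  · simp only [react] at h2
    omega

theorem valid_init (B : Protocol) (l : ℕ) : (init B l).Valid := by
  simp [Valid, init]

theorem Valid.step {s : NodeState} (hs : s.Valid) (B : Protocol) (o : Observation) :
    (s.step B o).Valid := by
  obtain ⟨h1, h2⟩ := hs
  by_cases hl : 0 < s.l
  · rw [step_of_pos hl]
    rcases tick_cases B (s.react B o) with h | h | h <;> rw [Valid] <;> revert h <;>
      cases o <;> simp only [react] <;> rintro h <;> (first | rw [h.2.2] | rw [h.2]) <;>
      simp only [] <;> omega
  · rw [step_of_not_pos hl]
    exact ⟨h1, h2⟩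

theorem Valid.timer_le {s : NodeState} (hs : s.Valid) : s.timer ≤ 2 * s.T := by
  obtain ⟨h1, h2⟩ := hs
  unfold timer
  split_ifs <;> omega

theorem step_l_le (s : NodeState) (B : Protocol) (o : Observation) : (s.step B o).l ≤ s.l := by
  by_cases hl : 0 < s.l
  · rw [step_of_pos hl]
    rcases tick_cases B (s.react B o) with h | h | h <;> revert h <;>
      cases o <;> simp only [react] <;> rintro h <;> (first | rw [h.2.2] | rw [h.2]) <;>
      simp
  · rw [step_of_not_pos hl]

/-- Without an idle channel, either the timer runs down by one, or the timeout rule fires. -/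
theorem step_of_ne_idle {s : NodeState} (hs : s.Valid) (hl : 0 < s.l) (B : Protocol)
    (hp : 0 < s.p) {o : Observation} (ho : o ≠ .idle) :
    ((s.step B o).T = s.T ∧ (s.step B o).timer + 1 = s.timer ∧ (s.step B o).p ≤ s.p ∧
      (o = .receive → (s.step B o).p ≤ (1 + B.γ)⁻¹ * s.p)) ∨
    (s.step B o).p ≤ (1 + B.γ)⁻¹ * s.p := by
  obtain ⟨h1, h2⟩ := hs
  have hγ := B.γ_pos
  have hi : (1 + B.γ)⁻¹ ≤ 1 := inv_le_one_of_one_le₀ (by linarith)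
  have hi0 : 0 < (1 + B.γ)⁻¹ := inv_pos.2 (by linarith)
  have hp1 : (1 + B.γ)⁻¹ * s.p ≤ s.p := mul_le_of_le_one_left hp.le hi
  have hp2 : (1 + B.γ)⁻¹ * ((1 + B.γ)⁻¹ * s.p) ≤ (1 + B.γ)⁻¹ * s.p :=
    mul_le_of_le_one_left (mul_pos hi0 hp).le hi
  rw [step_of_pos hl]
  rcases tick_cases B (s.react B o) with h | h | h
  · obtain ⟨h, h'⟩ := h
    revert h h'
    cases o <;> simp only [react] <;> intro h h' <;> rw [h']
    case idle => exact absurd rfl ho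
    case receive => exact Or.inr le_rfl
    all_goals
      left
      simp only [timer]
      refine ⟨trivial, ?_, le_rfl, by simp⟩
      split_ifs <;> omega
  · obtain ⟨h, h', h''⟩ := h
    revert h h' h''
    cases o <;> simp only [react] <;> intro h h' h'' <;> rw [h'']
    case idle => exact absurd rfl ho
    case receive => exact Or.inr le_rfl
    all_goals
      left
      simp only [timer]
      refine ⟨trivial, ?_, le_rfl, by simp⟩
      split_ifs <;> omega
  · obtain ⟨h, h', h''⟩ := h
    right
    revert h h' h''
    cases o <;> simp only [react] <;> intro h h' h'' <;> rw [h'']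
    case idle => exact absurd rfl ho
    case receive => exact hp2

theorem smoothed_nonneg (B : Protocol) {s : NodeState} (hp : 0 < s.p) : 0 ≤ s.smoothed B := by
  have hγ := B.γ_pos
  unfold smoothed
  split_ifs
  · positivity
  · exact le_rfl

theorem le_smoothed (B : Protocol) {s : NodeState} (hp : 0 < s.p) :
    s.transmitProb ≤ s.smoothed B := by
  have hγ := B.γ_pos
  unfold smoothed transmitProb
  split_ifs
  · exact le_mul_of_one_le_right hp.le (le_add_of_nonneg_right (by positivity))
  · exact le_rfl

theorem Valid.inflation_le {s : NodeState} (hs : s.Valid) (B : Protocol) :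
    1 + B.γ * s.timer / (8 * s.T) ≤ 1 + B.γ / 4 := by
  have hγ := B.γ_pos
  have h1 : (1 : ℝ) ≤ s.T := by exact_mod_cast hs.1
  have h2 : (s.timer : ℝ) ≤ 2 * s.T := by exact_mod_cast hs.timer_le
  have h3 : B.γ * s.timer / (8 * s.T) ≤ B.γ / 4 := by
    rw [div_le_div_iff₀ (by positivity) (by norm_num)]
    nlinarith
  linarith

theorem smoothed_le (B : Protocol) (hB : B.γ ≤ 1 / 4) {s : NodeState} (hs : s.Valid)
    (hp : 0 < s.p) : s.smoothed B ≤ 2 * s.transmitProb := by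
  have := hs.inflation_le B
  unfold smoothed transmitProb
  split_ifs
  · nlinarith
  · simp

theorem smoothed_le_of_p_le (B : Protocol) {s : NodeState} (hs : s.Valid) {x : ℝ} (h0 : 0 ≤ x)
    (hx : s.p ≤ x) : s.smoothed B ≤ (1 + B.γ / 4) * x := by
  have hγ := B.γ_pos
  have h1 := hs.inflation_le B
  have h2 : 0 ≤ 1 + B.γ * s.timer / (8 * s.T) := by positivity
  unfold smoothed
  split_ifs
  · nlinarith
  · positivity

theorem smoothed_of_l_eq_zero (B : Protocol) {s : NodeState} (hl : ¬ 0 < s.l) :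
    s.smoothed B = 0 := if_neg hl

theorem smoothed_step_le (B : Protocol) (hB : B.γ ≤ 1 / 4) {s : NodeState} (hs : s.Valid)
    (hp : 0 < s.p) (o : Observation) : (s.step B o).smoothed B ≤ (1 + 2 * B.γ) * s.smoothed B := by
  have hγ := B.γ_pos
  by_cases hl : 0 < s.l
  · have h1 : (s.step B o).p ≤ (1 + B.γ) * s.p := by
      have hi : (1 + B.γ)⁻¹ ≤ 1 := inv_le_one_of_one_le₀ (by linarith)
      have hi0 : 0 < (1 + B.γ)⁻¹ := inv_pos.2 (by linarith)
      have hp0 : s.p ≤ (1 + B.γ) * s.p := by nlinarith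
      by_cases ho : o = .idle
      · subst ho
        rw [step_idle hl]
        exact min_le_left _ _
      · have hp1 : (1 + B.γ)⁻¹ * s.p ≤ s.p := mul_le_of_le_one_left hp.le hi
        rcases step_of_ne_idle hs hl B hp ho with h | h
        · exact h.2.2.1.trans hp0
        · exact h.trans (hp1.trans hp0)
    have h2 := smoothed_le_of_p_le B (hs.step B o) (by positivity) h1
    have h3 : s.p ≤ s.smoothed B := by
      have := le_smoothed B hp
      rwa [transmitProb, if_pos hl] at this
    calc (s.step B o).smoothed B ≤ ((1 + B.γ / 4) * (1 + B.γ)) * s.p := by linarith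
      _ ≤ (1 + 2 * B.γ) * s.p := mul_le_mul_of_nonneg_right (by nlinarith) hp.le
      _ ≤ _ := mul_le_mul_of_nonneg_left h3 (by linarith)
  · have : s.step B o = s := if_neg hl
    rw [this, smoothed_of_l_eq_zero B hl, mul_zero]

theorem smoothed_step_le_of_decrease (B : Protocol) (hB : B.γ ≤ 1 / 4) {s s' : NodeState}
    (hs' : s'.Valid) (hp : 0 < s.p) (hl : 0 < s.l) (h : s'.p ≤ (1 + B.γ)⁻¹ * s.p) :
    s'.smoothed B ≤ (1 - B.γ / 2) * s.smoothed B := by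
  have hγ := B.γ_pos
  have h2 := smoothed_le_of_p_le B hs' (by positivity) h
  have h3 : s.p ≤ s.smoothed B := by
    have := le_smoothed B hp
    rwa [transmitProb, if_pos hl] at this
  have h4 : (1 + B.γ / 4) * (1 + B.γ)⁻¹ ≤ 1 - B.γ / 2 := by
    rw [← div_eq_mul_inv, div_le_iff₀ (by linarith)]
    nlinarith
  calc s'.smoothed B ≤ ((1 + B.γ / 4) * (1 + B.γ)⁻¹) * s.p := by linarith
    _ ≤ (1 - B.γ / 2) * s.p := mul_le_mul_of_nonneg_right h4 hp.le
    _ ≤ _ := mul_le_mul_of_nonneg_left h3 (by linarith)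

/-- A node that senses no idle channel loses at least a fraction `γ / (16 T_v)` of its smoothed
probability. -/
theorem smoothed_step_of_ne_idle (B : Protocol) (hB : B.γ ≤ 1 / 4) {s : NodeState}
    (hs : s.Valid) (hp : 0 < s.p) {o : Observation} (ho : o ≠ .idle) :
    (s.step B o).smoothed B ≤ (1 - B.γ / (16 * s.T)) * s.smoothed B := by
  have hγ := B.γ_pos
  have hT : (1 : ℝ) ≤ s.T := by exact_mod_cast hs.1
  by_cases hl : 0 < s.l
  · rcases step_of_ne_idle hs hl B hp ho with ⟨h1, h2, h3, -⟩ | h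
    · have h4 : (s.timer : ℝ) = (s.step B o).timer + 1 := by exact_mod_cast h2.symm
      have h5 := hs.inflation_le B
      have h6 : (s.step B o).smoothed B ≤ s.p * (1 + B.γ * (s.step B o).timer / (8 * s.T)) := by
        unfold smoothed
        split_ifs
        · rw [h1]
          exact mul_le_mul_of_nonneg_right h3 (by positivity)
        · positivity
      refine h6.trans ?_
      rw [smoothed, if_pos hl, mul_left_comm]
      refine mul_le_mul_of_nonneg_left ?_ hp.le
      have h7 : B.γ * s.timer / (8 * s.T) =
          B.γ * (s.step B o).timer / (8 * s.T) + 2 * (B.γ / (16 * s.T)) := by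
        rw [h4]
        field_simp
        ring
      have h8 : 0 ≤ B.γ / (16 * s.T) := by positivity
      rw [h7] at h5 ⊢
      nlinarith
    · refine (smoothed_step_le_of_decrease B hB (hs.step B o) hp hl h).trans ?_
      refine mul_le_mul_of_nonneg_right ?_ (smoothed_nonneg B hp)
      have : B.γ / (16 * s.T) ≤ B.γ / 2 :=
        div_le_div_of_nonneg_left hγ.le (by norm_num) (by linarith)
      linarith
  · have : s.step B o = s := if_neg hl
    rw [this, smoothed_of_l_eq_zero B hl, mul_zero]

theorem smoothed_step_receive (B : Protocol) (hB : B.γ ≤ 1 / 4) {s : NodeState}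
    (hs : s.Valid) (hp : 0 < s.p) :
    (s.step B .receive).smoothed B ≤ (1 - B.γ / 2) * s.smoothed B := by
  by_cases hl : 0 < s.l
  · refine smoothed_step_le_of_decrease B hB (hs.step B _) hp hl ?_
    rcases step_of_ne_idle hs hl B hp (o := .receive) (by simp) with h | h
    · exact h.2.2.2 rfl
    · exact h
  · have : s.step B .receive = s := if_neg hl
    rw [this, smoothed_of_l_eq_zero B hl, mul_zero]

theorem T_le_window {s : NodeState} (hl : 0 < s.l) : (s.T : ℝ) ≤ s.window := by
  rw [window, if_pos hl]
  exact le_add_of_nonneg_right (by positivity)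

theorem Valid.window_le {s : NodeState} (hs : s.Valid) : s.window ≤ s.T + 2 := by
  have hT : (1 : ℝ) ≤ s.T := by exact_mod_cast hs.1
  have hc : (s.c : ℝ) ≤ s.T := by exact_mod_cast hs.2
  unfold window
  split_ifs
  · have : 2 * (s.c : ℝ) / s.T ≤ 2 := by
      rw [div_le_iff₀ (by positivity)]
      linarith
    linarith
  · linarith

theorem window_of_l_eq_zero {s : NodeState} (hl : ¬ 0 < s.l) : s.window = 0 := if_neg hl

/-- The interpolated window grows slowly if the channel is not idle. -/
theorem window_step_of_ne_idle (B : Protocol) {s : NodeState} (hs : s.Valid)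
    {o : Observation} (ho : o ≠ .idle) : (s.step B o).window ≤ s.window + 4 / s.T := by
  have hT : (1 : ℝ) ≤ s.T := by exact_mod_cast hs.1
  by_cases hl : 0 < s.l
  · have key : ((s.step B o).T : ℝ) + 2 * (s.step B o).c / (s.step B o).T ≤
        s.T + 2 * s.c / s.T + 4 / s.T := by
      have h1 : (0 : ℝ) < s.T := by linarith
      have main : ((s.step B o).T = s.T ∧ (s.step B o).c ≤ s.c + 1) ∨
          ((s.step B o).T = s.T + 2 ∧ (s.step B o).c = 1 ∧ s.T ≤ s.c + 1) := by
        rw [step_of_pos hl]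
        rcases tick_cases B (s.react B o) with h | h | h <;> revert h <;>
          cases o <;> simp only [react] <;> rintro h <;> (first | rw [h.2.2] | rw [h.2]) <;>
          first | exact absurd rfl ho | (simp; try omega)
      rcases main with ⟨h2, h3⟩ | ⟨h2, h3, h4⟩
      · have h5 : ((s.step B o).c : ℝ) ≤ s.c + 1 := by exact_mod_cast h3
        rw [h2, add_assoc, ← add_div]
        gcongr
        linarith
      · have h5 : (s.T : ℝ) ≤ s.c + 1 := by exact_mod_cast h4
        rw [h2, h3]
        push_cast
        have h6 : 2 * 1 / ((s.T : ℝ) + 2) ≤ 2 / s.T := by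
          gcongr <;> linarith
        have h7 : 2 ≤ 2 * (s.c : ℝ) / s.T + 2 / s.T := by
          rw [← add_div, le_div_iff₀ h1]
          linarith
        have h8 : 4 / (s.T : ℝ) = 2 / s.T + 2 / s.T := by ring
        linarith
    rw [window, window, if_pos hl]
    split_ifs
    · exact key
    · positivity
  · have : s.step B o = s := if_neg hl
    rw [this]
    exact le_add_of_nonneg_right (by positivity)

/-- An idle channel lowers a large interpolated window by at least `1 / 2`. -/
theorem window_step_idle (B : Protocol) {s : NodeState} (hs : s.Valid) {m : ℝ} (hm : 20 ≤ m) :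
    (s.step B .idle).window ≤ max m (s.window - 1 / 2) := by
  have hT : (1 : ℝ) ≤ s.T := by exact_mod_cast hs.1
  by_cases hl : 0 < s.l
  · by_cases hT9 : s.T ≤ 15
    · refine le_max_of_le_left ((hs.step B .idle).window_le.trans ?_)
      have h1 : (s.step B .idle).T ≤ 15 := by
        rw [step_idle hl]
        simp only []
        omega
      have h2 : ((s.step B .idle).T : ℝ) ≤ 15 := by exact_mod_cast h1
      linarith
    · refine le_max_of_le_right ?_
      have main : (s.step B .idle).T + 1 = s.T ∧ (s.step B .idle).c ≤ s.c + 1 := by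
        rw [step_idle hl]
        simp only []
        split_ifs <;> omega
      have h1 : (16 : ℝ) ≤ s.T := by exact_mod_cast (by omega : 16 ≤ s.T)
      have h2 : ((s.step B .idle).T : ℝ) = s.T - 1 := by
        have : ((s.step B .idle).T : ℝ) + 1 = s.T := by exact_mod_cast main.1
        linarith
      have h3 : ((s.step B .idle).c : ℝ) ≤ s.c + 1 := by exact_mod_cast main.2
      have hc : (s.c : ℝ) ≤ s.T := by exact_mod_cast hs.2
      rw [window, window, if_pos hl]
      have key : (s.T - 1 : ℝ) + 2 * (s.step B .idle).c / (s.T - 1) ≤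
          s.T + 2 * s.c / s.T - 1 / 2 := by
        have h4 : 2 * ((s.step B .idle).c : ℝ) / (s.T - 1) ≤ 2 * (s.c + 1) / (s.T - 1) := by
          gcongr
        have h5 : 2 * ((s.c : ℝ) + 1) / (s.T - 1) ≤ 2 * s.c / s.T + 1 / 2 := by
          rw [div_add_div _ _ (by positivity) (by norm_num), div_le_div_iff₀ (by linarith)
            (by positivity)]
          nlinarith
        linarith
      split_ifs
      · rw [h2]
        exact key
      · have : 0 ≤ 2 * (s.c : ℝ) / s.T := by positivity
        linarith
  · have : s.step B .idle = s := if_neg hl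
    rw [this, window_of_l_eq_zero hl]
    exact le_max_of_le_left (by linarith)

/-- The number of decreases by the factor `1 + γ` that separate `p_v` from `p̂`. -/
noncomputable def depth (B : Protocol) (s : NodeState) : ℝ :=
  Real.log (B.pHat / s.p) / Real.log (1 + B.γ)

/-- The depth of a node in excess of what its window estimate (capped at `m`) accounts for, plus a
term that pays for the timeouts with a window of length at least `m - 1`. -/
noncomputable def slack (B : Protocol) (m : ℕ) (s : NodeState) : ℝ :=
  max (s.depth B - min (s.T : ℝ) m / 2) 0 + s.c / (m - 2)

theorem depth_nonneg (B : Protocol) {s : NodeState} (hp : 0 < s.p ∧ s.p ≤ B.pHat) :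
    0 ≤ s.depth B :=
  div_nonneg (Real.log_nonneg ((one_le_div hp.1).2 hp.2))
    (Real.log_nonneg (by linarith [B.γ_pos]))

theorem depth_of_p_eq (B : Protocol) {s s' : NodeState} (hp : 0 < s.p)
    (h : s'.p = (1 + B.γ)⁻¹ * s.p) : s'.depth B = s.depth B + 1 := by
  have hγ := B.γ_pos
  have hD : 0 < Real.log (1 + B.γ) := Real.log_pos (by linarith)
  have h1 : B.pHat / s'.p = B.pHat / s.p * (1 + B.γ) := by
    rw [h]
    field_simp
  rw [depth, depth, h1, Real.log_mul (div_pos B.pHat_pos hp).ne' (by positivity), add_div,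
    div_self hD.ne']

theorem depth_step_idle {s : NodeState} (hl : 0 < s.l) (B : Protocol)
    (hp : 0 < s.p) : (s.step B .idle).depth B = max (s.depth B - 1) 0 := by
  have hγ := B.γ_pos
  have hB := B.pHat_pos
  have hD : 0 < Real.log (1 + B.γ) := Real.log_pos (by linarith)
  have h1 : s.depth B - 1 = Real.log (B.pHat / ((1 + B.γ) * s.p)) / Real.log (1 + B.γ) := by
    rw [depth, mul_comm, ← div_div, Real.log_div (div_pos hB hp).ne' (by positivity), sub_div,
      div_self hD.ne']
  rw [step_idle hl, depth]
  simp only []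
  rcases le_total ((1 + B.γ) * s.p) B.pHat with h | h
  · rw [min_eq_left h, h1, max_eq_left]
    exact div_nonneg (Real.log_nonneg ((one_le_div (by positivity)).2 h)) hD.le
  · rw [min_eq_right h, div_self hB.ne', Real.log_one, zero_div, h1, max_eq_right]
    exact div_nonpos_of_nonpos_of_nonneg (Real.log_nonpos (by positivity)
      ((div_le_one (by positivity)).2 h)) hD.le

open scoped Classical in
/-- Up to receptions, timeouts and idle channels balance: the slack grows by less than
`1 / (m - 2)` per round, and it drops at an idle channel when the node is deep. -/
theorem slack_step_le (B : Protocol) {m : ℕ} (hm : 3 ≤ m) {s : NodeState} (hs : s.Valid)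
    (hl : 0 < s.l) (hp : 0 < s.p ∧ s.p ≤ B.pHat) (o : Observation) :
    (s.step B o).slack B m ≤ s.slack B m + 1 / (m - 2) + (if o = .receive then 1 else 0) -
      if o = .idle ∧ (m : ℝ) ≤ s.depth B then 1 / 2 else 0 := by
  have hm' : (3 : ℝ) ≤ m := by exact_mod_cast hm
  have hT : (1 : ℝ) ≤ s.T := by exact_mod_cast hs.1
  have hk := depth_nonneg B hp
  have hc : ∀ x : ℝ, x ≤ s.c + 1 → x / ((m : ℝ) - 2) ≤ s.c / (m - 2) + 1 / (m - 2) := by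
    intro x hx
    rw [← add_div]
    exact div_le_div_of_nonneg_right hx (by linarith)
  by_cases ho : o = .idle
  · subst ho
    have h1 : ((s.step B .idle).c : ℝ) ≤ s.c + 1 := by
      have : (s.step B .idle).c ≤ s.c + 1 := by
        rw [step_idle hl]
        simp only []
        split_ifs <;> omega
      exact_mod_cast this
    have h2 : (s.T : ℝ) - 1 ≤ (s.step B .idle).T := by
      have : s.T ≤ (s.step B .idle).T + 1 := by
        rw [step_idle hl]
        simp only []
        omega
      have : (s.T : ℝ) ≤ (s.step B .idle).T + 1 := by exact_mod_cast this
      linarith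
    have h3 := hc _ h1
    have h4 : min (s.T : ℝ) m ≤ min ((s.step B .idle).T : ℝ) m + 1 := by
      rw [← min_add_add_right]
      exact min_le_min (by linarith) (by linarith)
    have h5 : (0 : ℝ) ≤ min ((s.step B .idle).T : ℝ) m := le_min (by positivity) (by positivity)
    have h6 : min (s.T : ℝ) m ≤ m := min_le_right _ _
    rw [slack, slack, depth_step_idle hl B hp.1]
    rw [if_neg (by simp)]
    have h7 := le_max_left (s.depth B - min (s.T : ℝ) m / 2) 0
    have h8 := le_max_right (s.depth B - min (s.T : ℝ) m / 2) 0
    by_cases hk' : (m : ℝ) ≤ s.depth B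
    · rw [if_pos ⟨rfl, hk'⟩, max_eq_left (by linarith : 0 ≤ s.depth B - 1)]
      have : max (s.depth B - 1 - min ((s.step B .idle).T : ℝ) m / 2) 0 ≤
          max (s.depth B - min (s.T : ℝ) m / 2) 0 - 1 / 2 := by
        refine max_le ?_ ?_ <;> linarith
      linarith
    · rw [if_neg fun h => hk' h.2]
      have : max (max (s.depth B - 1) 0 - min ((s.step B .idle).T : ℝ) m / 2) 0 ≤
          max (s.depth B - min (s.T : ℝ) m / 2) 0 := by
        refine max_le ?_ h8
        rw [sub_le_iff_le_add]
        refine max_le ?_ ?_ <;> linarith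
      linarith
  · have hno : (if o = .idle ∧ (m : ℝ) ≤ s.depth B then (1 / 2 : ℝ) else 0) = 0 :=
      if_neg fun h => ho h.1
    rw [hno]
    set r : ℝ := if o = .receive then 1 else 0 with hr
    have hr0 : 0 ≤ r := by rw [hr]; split_ifs <;> norm_num
    -- the reaction to the channel raises the depth by `r` and leaves the counters alone
    have hreact : (s.react B o).depth B = s.depth B + r ∧ (s.react B o).T = s.T ∧
        (s.react B o).c = s.c ∧ 0 < (s.react B o).p := by
      cases o with
      | idle => exact absurd rfl ho
      | receive =>
        have hi : 0 < (1 + B.γ)⁻¹ := inv_pos.2 (by linarith [B.γ_pos])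
        refine ⟨?_, rfl, rfl, mul_pos hi hp.1⟩
        rw [hr, if_pos rfl]
        exact depth_of_p_eq B hp.1 rfl
      | transmit => exact ⟨by simp [hr, react, depth], rfl, rfl, hp.1⟩
      | busy => exact ⟨by simp [hr, react, depth], rfl, rfl, hp.1⟩
    obtain ⟨hd, hT', hc', hp'⟩ := hreact
    have h7 := le_max_left (s.depth B - min (s.T : ℝ) m / 2) 0
    have h8 := le_max_right (s.depth B - min (s.T : ℝ) m / 2) 0
    have key : max (s.depth B + r - min (s.T : ℝ) m / 2) 0 ≤
        max (s.depth B - min (s.T : ℝ) m / 2) 0 + r := by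
      refine max_le ?_ ?_ <;> linarith
    rw [step_of_pos hl]
    rcases tick_cases B (s.react B o) with ⟨-, h⟩ | ⟨-, -, h⟩ | ⟨h1, -, h⟩
    · have h9 : ((s.react B o).tick B).slack B m =
          max (s.depth B + r - min (s.T : ℝ) m / 2) 0 + ((s.c + 1 : ℕ) : ℝ) / (m - 2) := by
        rw [h, ← hd, ← hT', ← hc']
        rfl
      rw [h9, slack]
      have := hc ((s.c + 1 : ℕ) : ℝ) (by push_cast; exact le_rfl)
      linarith
    · have h9 : ((s.react B o).tick B).slack B m =
          max (s.depth B + r - min (s.T : ℝ) m / 2) 0 + ((1 : ℕ) : ℝ) / (m - 2) := by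
        rw [h, ← hd, ← hT']
        rfl
      rw [h9, slack]
      have := hc ((1 : ℕ) : ℝ) (by push_cast; linarith [(Nat.cast_nonneg s.c : (0 : ℝ) ≤ s.c)])
      linarith
    · have h9 : ((s.react B o).tick B).slack B m =
          max (s.depth B + r + 1 - min ((s.T + 2 : ℕ) : ℝ) m / 2) 0 + ((1 : ℕ) : ℝ) / (m - 2) := by
        rw [← hd, ← hT', ← depth_of_p_eq B (s := s.react B o)
          (s' := (s.react B o).tick B) hp' (by rw [h])]
        rw [h]
        rfl
      rw [h9, slack]
      rw [hT', hc'] at h1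
      by_cases hbig : m ≤ s.T + 1
      · -- a timeout with a large window is paid for by the counter that is reset
        have h10 : (1 : ℝ) ≤ s.c / (m - 2) := by
          rw [le_div_iff₀ (by linarith)]
          have : (m : ℝ) ≤ s.c + 2 := by exact_mod_cast (by omega : m ≤ s.c + 2)
          linarith
        have h11 : min (s.T : ℝ) m ≤ min ((s.T + 2 : ℕ) : ℝ) m := by
          refine min_le_min ?_ le_rfl
          push_cast
          linarith
        have h12 : max (s.depth B + r + 1 - min ((s.T + 2 : ℕ) : ℝ) m / 2) 0 ≤
            max (s.depth B - min (s.T : ℝ) m / 2) 0 + r + 1 := by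
          refine max_le ?_ ?_ <;> linarith
        push_cast at h12 ⊢
        linarith
      · have h10 : min (s.T : ℝ) m = s.T := min_eq_left (by exact_mod_cast (by omega : s.T ≤ m))
        have h11 : min ((s.T + 2 : ℕ) : ℝ) m = s.T + 2 := by
          rw [min_eq_left (by exact_mod_cast (by omega : s.T + 2 ≤ m))]
          push_cast
          ring
        have := hc ((1 : ℕ) : ℝ) (by push_cast; linarith [(Nat.cast_nonneg s.c : (0 : ℝ) ≤ s.c)])
        have h12 : s.depth B + r + 1 - (s.T + 2 : ℝ) / 2 = s.depth B + r - s.T / 2 := by ring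
        rw [h11, h10, h12]
        rw [h10] at key
        linarith

theorem slack_nonneg (B : Protocol) {m : ℕ} (hm : 3 ≤ m) (s : NodeState) : 0 ≤ s.slack B m := by
  have hm' : (3 : ℝ) ≤ m := by exact_mod_cast hm
  exact add_nonneg (le_max_right _ _) (div_nonneg (Nat.cast_nonneg _) (by linarith))

theorem slack_init (B : Protocol) {m : ℕ} (l : ℕ) : (init B l).slack B m = 0 := by
  have h : (0 : ℝ) ≤ min 1 (m : ℝ) := le_min zero_le_one (Nat.cast_nonneg _)
  simp only [slack, depth, init, div_self B.pHat_pos.ne', Real.log_one, zero_div]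
  rw [max_eq_right]
  · simp
  · push_cast
    linarith

end NodeState

/-! ### The channel in a network of diameter at most `R₀` -/

/-- A network all of whose nodes are within transmission range of each other, together with a
protocol, initial leader counters and a jammer. -/
structure Scenario (V : Type*) where
  R : Radio
  B : Protocol
  pos : V → Plane
  l₀ : V → ℕ
  J : Jammer V
  pos_injective : Function.Injective pos
  dist_le_range : ∀ u v, dist (pos u) (pos v) ≤ R.range

namespace Scenario

section Channel

variable {V : Type*} (X : Scenario V)

/-- The signal of every node is received with power at least `β θ` everywhere in the network. -/
theorem le_power {u v : V} (h : u ≠ v) :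
    X.R.β * X.R.θ ≤ X.R.power (X.pos u) (X.pos v) := by
  have hP := X.R.P_pos
  have hα : 0 < X.R.α := by linarith [X.R.two_lt_α]
  have hβ : 0 < X.R.β := by linarith [X.R.one_lt_β]
  have hθ := X.R.θ_pos
  have hd : 0 < dist (X.pos u) (X.pos v) := dist_pos.2 fun h' => h (X.pos_injective h')
  have h1 : dist (X.pos u) (X.pos v) ^ X.R.α ≤ X.R.P / (X.R.β * X.R.θ) := by
    have := Real.rpow_le_rpow hd.le (X.dist_le_range u v) hα.le
    rwa [Radio.range, ← Real.rpow_mul (by positivity), one_div, inv_mul_cancel₀ hα.ne',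
      Real.rpow_one] at this
  have h2 : 0 < dist (X.pos u) (X.pos v) ^ X.R.α := Real.rpow_pos_of_pos hd _
  rw [Radio.power, Real.rpow_neg hd.le, ← div_eq_mul_inv, le_div_iff₀ h2]
  rw [le_div_iff₀ (by positivity)] at h1
  linarith

theorem power_nonneg (u v : V) : 0 ≤ X.R.power (X.pos u) (X.pos v) :=
  mul_nonneg X.R.P_pos.le (Real.rpow_nonneg dist_nonneg _)

theorem θ_lt_power {u v : V} (h : u ≠ v) : X.R.θ < X.R.power (X.pos u) (X.pos v) := by
  have := X.le_power h
  nlinarith [X.R.one_lt_β, X.R.θ_pos]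

/-- An idle channel means global silence, since any transmitter exceeds `θ` at every listener. -/
theorem empty_of_rss_lt [DecidableEq V] {noise : V → ℝ≥0} {W : Finset V} {v : V} (hv : v ∉ W)
    (h : X.R.rss X.pos noise W v < X.R.θ) : W = ∅ ∧ (noise v : ℝ) < X.R.θ := by
  have hW : W = ∅ := by
    by_contra hne
    obtain ⟨w, hw⟩ := Finset.nonempty_iff_ne_empty.2 hne
    have h1 := X.θ_lt_power (u := w) (v := v) (by rintro rfl; exact hv hw)
    have h2 := Finset.single_le_sum (f := fun w => X.R.power (X.pos w) (X.pos v))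
      (fun w _ => X.power_nonneg w v) hw
    have h3 : (0 : ℝ) ≤ noise v := (noise v).2
    unfold Radio.rss at h
    linarith
  subst hW
  exact ⟨rfl, by simpa [Radio.rss] using h⟩

/-- If `u` transmits alone, then `v` receives the message if the noise at `v` is tolerable. -/
theorem receives_singleton [DecidableEq V] {noise : V → ℝ≥0} {u v : V} (h : u ≠ v)
    (hn : X.R.β * noise v ≤ X.R.power (X.pos u) (X.pos v)) :
    X.R.Receives X.pos noise {u} u v := by
  refine ⟨Finset.mem_singleton_self u, by simpa using h.symm, ?_, ?_⟩
  · have := X.θ_lt_power h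
    have h3 : (0 : ℝ) ≤ noise v := (noise v).2
    simp only [Radio.rss, Finset.sum_singleton]
    linarith
  · simpa [Radio.interferenceNoise] using hn

/-- Capturing the message of `u` among other transmitters is harder than receiving it alone. -/
theorem receives_singleton_of_receives [DecidableEq V] {noise : V → ℝ≥0} {W : Finset V} {u v : V}
    (h : X.R.Receives X.pos noise W u v) : X.R.Receives X.pos noise {u} u v := by
  obtain ⟨h1, h2, -, h4⟩ := h
  refine X.receives_singleton (by rintro rfl; exact h2 h1) (le_trans ?_ h4)
  refine mul_le_mul_of_nonneg_left ?_ (by linarith [X.R.one_lt_β])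
  exact le_add_of_nonneg_left (Finset.sum_nonneg fun w _ => X.power_nonneg w v)

variable (noise : V → ℝ≥0)

theorem observe_idle_iff (W : Finset V) (v : V) :
    observe X.R X.pos noise W v = .idle ↔ W = ∅ ∧ (noise v : ℝ) < X.R.θ := by
  classical
  constructor
  · intro h
    unfold observe at h
    split_ifs at h with h1 h2 h3
    exact X.empty_of_rss_lt h1 h2
  · rintro ⟨rfl, h⟩
    simp [observe, Radio.rss, h]

theorem observe_singleton {u v : V} (h : u ≠ v) (hn : (noise v : ℝ) < X.R.θ) :
    observe X.R X.pos noise {u} v = .receive := by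
  classical
  have hr : X.R.Receives X.pos noise {u} u v := by
    refine X.receives_singleton h (le_trans ?_ (X.le_power h))
    exact mul_le_mul_of_nonneg_left hn.le (by linarith [X.R.one_lt_β])
  unfold observe
  rw [if_neg (by simpa using h.symm), if_neg, if_pos]
  · exact ⟨u, by convert hr⟩
  · have := hr.2.2.1
    convert not_lt.2 this.le

theorem exists_receives_of_observe [DecidableEq V] {W : Finset V} {v : V}
    (h : observe X.R X.pos noise W v = .receive) :
    ∃ u, u ≠ v ∧ u ∈ W ∧ X.R.Receives X.pos noise {u} u v := by
  classical
  unfold observe at h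
  split_ifs at h with h1 h2 h3
  obtain ⟨u, hu⟩ := h3
  exact ⟨u, by rintro rfl; exact h1 hu.1, hu.1, X.receives_singleton_of_receives
    (by convert hu)⟩

theorem successful_singleton [DecidableEq V] {u : V} (hex : ∃ v, u ≠ v)
    (hn : ∀ v, (noise v : ℝ) < X.R.θ) :
    X.R.Successful X.pos noise {u} := by
  obtain ⟨v, hv⟩ := hex
  refine ⟨u, v, rfl, ?_⟩
  exact X.receives_singleton hv (le_trans (mul_le_mul_of_nonneg_left (hn v).le
    (by linarith [X.R.one_lt_β])) (X.le_power hv))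

end Channel

/-! ### States and transmission probabilities along an execution -/

section State

variable {V : Type*} (X : Scenario V)

/-- The state of `v` after the history `h`. -/
noncomputable def state (h : List (Finset V)) (v : V) : NodeState :=
  stateAfter X.R X.B X.pos X.l₀ X.J h v

/-- What `v` observes if the nodes in `W` transmit after the history `h`. -/
noncomputable def obs (h : List (Finset V)) (W : Finset V) (v : V) : Observation :=
  observe X.R X.pos (X.J h) W v

/-- The probability with which `v` transmits after the history `h`. -/
noncomputable def send (h : List (Finset V)) (v : V) : ℝ := (X.state h v).transmitProb

/-- The round after the history `h` is not jammed. -/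
def Clear (h : List (Finset V)) : Prop := ¬ X.J.Jams X.R h

open scoped Classical in
/-- The indicator of a successful transmission. -/
noncomputable def success (h : List (Finset V)) (W : Finset V) : ℝ :=
  if X.R.Successful X.pos (X.J h) W then 1 else 0

theorem state_cons (W : Finset V) (h : List (Finset V)) (v : V) :
    X.state (W :: h) v = (X.state h v).step X.B (X.obs h W v) := rfl

theorem valid_state (h : List (Finset V)) (v : V) : (X.state h v).Valid := by
  induction h with
  | nil => exact NodeState.valid_init _ _
  | cons W h ih => exact ih.step _ _

theorem p_mem (h : List (Finset V)) (v : V) :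
    0 < (X.state h v).p ∧ (X.state h v).p ≤ X.B.pHat := stateAfter_p_mem ..

theorem send_mem (h : List (Finset V)) (v : V) : 0 ≤ X.send h v ∧ X.send h v ≤ X.B.pHat :=
  sendProb_mem ..

theorem send_mem_unit (h : List (Finset V)) (v : V) : 0 ≤ X.send h v ∧ X.send h v ≤ 1 :=
  sendProb_mem_unit ..

theorem send_of_pos {h : List (Finset V)} {v : V} (hl : 0 < (X.state h v).l) :
    X.send h v = (X.state h v).p := if_pos hl

theorem clear_iff (h : List (Finset V)) : X.Clear h ↔ ∀ v, (X.J h v : ℝ) < X.R.θ := by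
  simp [Clear, Jammer.Jams]

theorem successes_cons (W : Finset V) (h : List (Finset V)) :
    (successes X.R X.pos X.J (W :: h) : ℝ) = successes X.R X.pos X.J h + X.success h W := by
  rw [successes, success]
  push_cast
  rfl

theorem success_nonneg (h : List (Finset V)) (W : Finset V) : 0 ≤ X.success h W := by
  unfold success
  split_ifs <;> norm_num

theorem success_le_one (h : List (Finset V)) (W : Finset V) : X.success h W ≤ 1 := by
  unfold success
  split_ifs <;> norm_num

theorem obs_idle_iff (h : List (Finset V)) (W : Finset V) (v : V) :
    X.obs h W v = .idle ↔ W = ∅ ∧ (X.J h v : ℝ) < X.R.θ := X.observe_idle_iff _ W v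

variable [Fintype V] [DecidableEq V]

/-- Whatever the jammer does, a reception at `v` has probability at most that of a successful
transmission, divided by the probability of silence: if `v` receives the message of `u`, it would
also receive it if `u` were the only transmitter. -/
theorem mean_receive_le (h : List (Finset V)) (v : V) [∀ W, Decidable (X.obs h W v = .receive)] :
    silence (X.send h) * mean (X.send h) (fun W => if X.obs h W v = .receive then 1 else 0) ≤
      mean (X.send h) (X.success h) := by
  classical
  have hq := X.send_mem_unit h
  set g : V → ℝ := fun u =>
    if u ≠ v ∧ X.R.Receives X.pos (X.J h) {u} u v then 1 else 0 with hg
  have hg0 : ∀ u, 0 ≤ g u := fun u => by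
    rw [hg]
    simp only []
    split_ifs <;> norm_num
  have h1 : mean (X.send h) (fun W => if X.obs h W v = .receive then 1 else 0) ≤
      ∑ u, X.send h u * g u := by
    have h2 : ∀ W : Finset V, (if X.obs h W v = .receive then (1 : ℝ) else 0) ≤
        ∑ u, g u * if u ∈ W then 1 else 0 := by
      intro W
      have h3 : ∀ u, 0 ≤ g u * if u ∈ W then (1 : ℝ) else 0 := fun u =>
        mul_nonneg (hg0 u) (by split_ifs <;> norm_num)
      split_ifs with ho
      · obtain ⟨u, hu, huW, hr⟩ := X.exists_receives_of_observe _ ho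
        refine le_trans ?_ (Finset.single_le_sum (fun u _ => h3 u) (Finset.mem_univ u))
        simp [hg, hu, huW, hr]
      · exact Finset.sum_nonneg fun u _ => h3 u
    refine (mean_mono hq h2).trans_eq ?_
    calc mean (X.send h) (fun W => ∑ u, g u * if u ∈ W then 1 else 0)
        = ∑ u, g u * mean (X.send h) (fun W => if u ∈ W then 1 else 0) := by
          simp only [mean, Finset.mul_sum]
          rw [Finset.sum_comm]
          exact Finset.sum_congr rfl fun u _ => Finset.sum_congr rfl fun W _ => by ring
      _ = _ := Finset.sum_congr rfl fun u _ => by rw [mean_ite_mem, mul_comm]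
  refine (mul_le_mul_of_nonneg_left h1 (silence_nonneg hq)).trans ?_
  refine le_mean_of_singleton hq (X.success_nonneg h) hg0 fun u => ?_
  rw [hg]
  simp only []
  split_ifs with hu
  · rw [success, if_pos]
    exact ⟨u, v, rfl, by convert hu.2⟩
  · exact X.success_nonneg h _

/-- In a clear round, `v` transmits alone with probability at least `send h v * silence`, and then
any other node receives its message. -/
theorem le_mean_success [Nontrivial V] {h : List (Finset V)} (hc : X.Clear h) (v : V) :
    X.send h v * silence (X.send h) ≤ mean (X.send h) (X.success h) := by
  classical
  have hq := X.send_mem_unit h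
  have h1 := le_mean_of_singleton hq (X.success_nonneg h) (g := fun u => if u = v then 1 else 0)
    (fun u => by split_ifs <;> norm_num) fun u => by
      obtain ⟨w, hw⟩ := exists_ne u
      have hs : X.success h {u} = 1 :=
        if_pos (by convert X.successful_singleton _ ⟨w, hw.symm⟩ ((X.clear_iff h).1 hc))
      rw [hs]
      split_ifs <;> norm_num
  simpa [mul_comm] using h1

theorem mean_idle {h : List (Finset V)} (hc : X.Clear h) (v : V)
    [∀ W, Decidable (X.obs h W v = .idle)] :
    mean (X.send h) (fun W => if X.obs h W v = .idle then 1 else 0) = silence (X.send h) := by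
  rw [← one_mul (silence _), ← mean_ite_empty]
  congr 1
  funext W
  simp [X.obs_idle_iff, (X.clear_iff h).1 hc v]

/-- With probability one some node remains a potential leader, since transmitters keep their
leader counters. -/
theorem exists_leader (h0 : ∃ v, 0 < X.l₀ v) {n : ℕ} {h : List (Finset V)}
    (hh : h ∈ (execution X.R X.B X.pos X.l₀ X.J n).support) : ∃ v, 0 < (X.state h v).l := by
  classical
  induction n generalizing h with
  | zero =>
    have : h = [] := by simpa [execution] using hh
    subst this
    exact h0
  | succ n ih =>
    obtain ⟨h, h1, W, rfl, hW⟩ := mem_support_execution_succ _ _ _ _ _ hh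
    obtain ⟨v, hv⟩ := ih h1
    -- a node that does not receive keeps its leader counter
    have key : ∀ u, X.obs h W u ≠ .receive → (X.state (W :: h) u).l = (X.state h u).l := by
      intro u hu
      rw [X.state_cons]
      by_cases hl : 0 < (X.state h u).l
      · rw [NodeState.step_of_pos hl]
        rcases NodeState.tick_cases X.B ((X.state h u).react X.B (X.obs h W u)) with
            ⟨-, h⟩ | ⟨-, -, h⟩ | ⟨-, -, h⟩ <;> rw [h] <;> revert hu <;>
          cases X.obs _ W u <;> simp [NodeState.react]
      · rw [NodeState.step_of_not_pos hl]
    by_cases hne : W = ∅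
    · subst hne
      refine ⟨v, ?_⟩
      rw [key v]
      · exact hv
      · intro ho
        obtain ⟨u, -, hu, -⟩ := X.exists_receives_of_observe _ ho
        simp at hu
    · obtain ⟨u, hu⟩ := Finset.nonempty_iff_ne_empty.2 hne
      refine ⟨u, ?_⟩
      rw [key u]
      · by_contra hl
        apply hW
        rw [setWeight, Finset.prod_eq_zero hu, zero_mul]
        exact if_neg hl
      · rw [obs, observe, if_pos hu]
        simp

end State

end Scenario

namespace Scenario

/-! ### Load, clear rounds and high rounds -/

section Load

/-- Logarithm of the load above which a round counts as high.  The factor `exp 1` separates this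
threshold from the load `1400`, above which receptions outweigh idle channels. -/
noncomputable def loadThreshold : ℝ := Real.log 1400 + 1

/-- A lower bound for the probability of silence in a round that is not high. -/
noncomputable def quiet (r : ℝ) : ℝ := Real.exp (-Real.exp loadThreshold / (1 - r))

theorem quiet_pos (r : ℝ) : 0 < quiet r := Real.exp_pos _

theorem quiet_le_one {r : ℝ} (hr : r < 1) : quiet r ≤ 1 := by
  refine Real.exp_le_one_iff.2 (div_nonpos_of_nonpos_of_nonneg ?_ (by linarith))
  linarith [Real.exp_pos loadThreshold]

variable {V : Type*} (X : Scenario V)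

theorem smoothed_state_nonneg (h : List (Finset V)) (v : V) :
    0 ≤ (X.state h v).smoothed X.B := NodeState.smoothed_nonneg _ (X.p_mem h v).1

variable [Fintype V]

/-- The sum of the smoothed transmission probabilities of all potential leaders. -/
noncomputable def load (h : List (Finset V)) : ℝ := ∑ v, (X.state h v).smoothed X.B

/-- The logarithm of the load relative to the threshold, in units of `γ`. -/
noncomputable def excess (h : List (Finset V)) : ℝ :=
  (Real.log (max 1 (X.load h)) - loadThreshold) / X.B.γ

/-- The round after the history `h` is high: the load exceeds the threshold. -/
def High (h : List (Finset V)) : Prop := 0 ≤ X.excess h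

open scoped Classical in
/-- The number of high rounds. -/
noncomputable def highCount : List (Finset V) → ℝ
  | [] => 0
  | _ :: h => highCount h + if X.High h then 1 else 0

theorem load_nonneg (h : List (Finset V)) : 0 ≤ X.load h :=
  Finset.sum_nonneg fun v _ => X.smoothed_state_nonneg h v

theorem sum_send_le_load (h : List (Finset V)) : ∑ v, X.send h v ≤ X.load h :=
  Finset.sum_le_sum fun v _ => NodeState.le_smoothed _ (X.p_mem h v).1

theorem load_le_two_mul (hγ : X.B.γ ≤ 1 / 4) (h : List (Finset V)) :
    X.load h ≤ 2 * ∑ v, X.send h v := by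
  rw [load, Finset.mul_sum]
  exact Finset.sum_le_sum fun v _ => NodeState.smoothed_le _ hγ (X.valid_state h v) (X.p_mem h v).1

theorem quiet_le_silence {h : List (Finset V)} (hh : ¬ X.High h) :
    quiet X.B.pHat ≤ silence (X.send h) := by
  have hp := X.B.pHat_lt_one
  refine le_trans ?_ (exp_neg_le_silence hp (X.send_mem h))
  have h1 : Real.log (max 1 (X.load h)) < loadThreshold := by
    by_contra hc
    exact hh (div_nonneg (by linarith) X.B.γ_pos.le)
  have h2 : max 1 (X.load h) < Real.exp loadThreshold :=
    (Real.log_lt_iff_lt_exp (by positivity)).1 h1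
  have h3 := (X.sum_send_le_load h).trans (le_max_right 1 _)
  refine Real.exp_le_exp.2 (div_le_div_of_nonneg_right ?_ (by linarith))
  linarith

end Load

section Clear

variable {V : Type*} (X : Scenario V)

open scoped Classical in
/-- The indicator of a clear round. -/
noncomputable def clear (h : List (Finset V)) : ℝ := if X.Clear h then 1 else 0

/-- The number of rounds that are not jammed. -/
noncomputable def clearCount : List (Finset V) → ℝ
  | [] => 0
  | _ :: h => clearCount h + X.clear h

theorem clear_nonneg (h : List (Finset V)) : 0 ≤ X.clear h := by
  unfold clear
  split_ifs <;> norm_num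

theorem clear_le_one (h : List (Finset V)) : X.clear h ≤ 1 := by
  unfold clear
  split_ifs <;> norm_num

/-- Up to one window of length `T`, a fraction `ε` of the latest rounds is clear. -/
theorem sub_le_sum_clear {ε : ℝ} (hε : 0 ≤ ε) {T : ℕ} (hT : 1 ≤ T) (hJ : X.J.IsBounded X.R ε T)
    (k : ℕ) (h : List (Finset V)) (hk : k ≤ h.length) :
    ε * k - ε * T ≤ ∑ i ∈ Finset.range k, X.clear (h.drop (i + 1)) := by
  classical
  induction k using Nat.strong_induction_on generalizing h with
  | _ k ih =>
    by_cases hkT : k < T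
    · have h1 : (k : ℝ) ≤ T := by exact_mod_cast hkT.le
      have h2 := Finset.sum_nonneg (s := Finset.range k)
        fun i _ => X.clear_nonneg (h.drop (i + 1))
      nlinarith
    · obtain ⟨j, rfl⟩ : ∃ j, k = T + j := ⟨k - T, by omega⟩
      have h1 := ih j (by omega) (h.drop T) (by rw [List.length_drop]; omega)
      have h2 := hJ (h.drop 1) (by rw [List.length_drop]; omega)
      have h3 : ∑ i ∈ Finset.range T, X.clear (h.drop (i + 1)) =
          T - (((Finset.range T).filter fun i => X.J.Jams X.R ((h.drop 1).drop i)).card : ℝ) := by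
        rw [← Finset.sum_boole, eq_sub_iff_add_eq, ← Finset.sum_add_distrib]
        rw [Finset.sum_congr rfl (g := fun _ => (1 : ℝ))]
        · simp
        · intro i _
          rw [List.drop_drop, add_comm 1 i, clear, Clear]
          split_ifs <;> norm_num
      rw [Finset.sum_range_add, h3]
      simp only [List.drop_drop] at h1 h2 ⊢
      push_cast
      simp only [add_assoc] at h1 h2 ⊢
      have h2' : (((Finset.range T).filter fun i => X.J.Jams X.R (h.drop (1 + i))).card : ℝ) ≤
        (1 - ε) * T := by convert h2
      linarith

theorem clearCount_eq (k : ℕ) (h : List (Finset V)) (hk : h.length = k) :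
    X.clearCount h = ∑ i ∈ Finset.range k, X.clear (h.drop (i + 1)) := by
  induction h generalizing k with
  | nil =>
    subst hk
    simp [clearCount]
  | cons W h ih =>
    subst hk
    rw [clearCount, ih _ rfl, List.length_cons, Finset.sum_range_succ']
    simp

/-- The amount by which clear rounds have recently fallen behind their guaranteed fraction `ε`. -/
noncomputable def backlog (ε : ℝ) : List (Finset V) → ℝ
  | [] => 0
  | _ :: h => max 0 (backlog ε h + ε - X.clear h)

theorem backlog_nonneg (ε : ℝ) (h : List (Finset V)) : 0 ≤ X.backlog ε h := by
  cases h with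
  | nil => exact le_rfl
  | cons W h => exact le_max_left _ _

theorem backlog_le {ε : ℝ} (hε : 0 ≤ ε) {T : ℕ} (hT : 1 ≤ T) (hJ : X.J.IsBounded X.R ε T)
    (h : List (Finset V)) : X.backlog ε h ≤ ε * T := by
  -- the backlog is the largest deficit over a final segment of the history
  have key : ∃ k ≤ h.length, X.backlog ε h =
      ∑ i ∈ Finset.range k, (ε - X.clear (h.drop (i + 1))) := by
    induction h with
    | nil => exact ⟨0, le_rfl, by simp [backlog]⟩
    | cons W h ih =>
      obtain ⟨k, hk, h1⟩ := ih
      rcases le_total 0 (X.backlog ε h + ε - X.clear h) with h2 | h2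
      · refine ⟨k + 1, by simpa using hk, ?_⟩
        rw [backlog, max_eq_right h2, Finset.sum_range_succ', h1]
        simp only [List.drop_succ_cons, zero_add, List.drop_zero]
        ring
      · exact ⟨0, Nat.zero_le _, by simp [backlog, max_eq_left h2]⟩
  obtain ⟨k, hk, h1⟩ := key
  have h2 := X.sub_le_sum_clear hε hT hJ k h hk
  rw [h1, Finset.sum_sub_distrib]
  simp only [Finset.sum_const, Finset.card_range, nsmul_eq_mul]
  linarith

end Clear

/-! ### A surviving node forces successes -/

/-- Bound for the exponential of a small multiple of an increment `u - d`, split into an upward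
and a downward part. -/
theorem exp_mul_sub_le {u d t : ℝ} (hu : 0 ≤ u) (hd : 0 ≤ d) (ht : 0 ≤ t)
    (h : t * (u + d) ≤ 1 / 2) : Real.exp (t * (u - d)) ≤ 1 + t * (3 / 2 * u - 1 / 2 * d) := by
  have h1 : |t * (u - d)| ≤ t * (u + d) := by
    rw [abs_mul, abs_of_nonneg ht]
    exact mul_le_mul_of_nonneg_left (abs_le.2 ⟨by linarith, by linarith⟩) ht
  have h2 := Real.abs_exp_sub_one_sub_id_le (x := t * (u - d)) (by linarith)
  have h3 : (t * (u - d)) ^ 2 ≤ t * (u + d) * (1 / 2) := by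
    rw [← sq_abs, sq]
    exact mul_le_mul h1 (h1.trans h) (abs_nonneg _) (le_trans (abs_nonneg _) h1)
  have h4 := (abs_le.1 h2).2
  nlinarith

section Survivor

variable {V : Type*} [Fintype V] [DecidableEq V] [Nontrivial V] (X : Scenario V)

open scoped Classical in
/-- Mean of one round's contribution to the slack of `v`, with successes weighted by
`4 / quiet`: it is nonpositive unless the round is high, and negative if moreover it is clear.
In a clear round either `v` is deep and the channel is idle with probability at least `quiet`, or
`p_v ≥ p̂ / 2` and `v` itself transmits alone with probability at least `quiet * p̂ / 2`. -/
theorem mean_drift_le {m : ℕ} (hm : X.B.γ * m ≤ 1 / 2) (h : List (Finset V)) {v : V}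
    (hl : 0 < (X.state h v).l) :
    3 / 2 * mean (X.send h) (fun W => if X.obs h W v = .receive then 1 else 0) -
      1 / 2 * (mean (X.send h) (fun W => if X.obs h W v = .idle ∧
        (m : ℝ) ≤ (X.state h v).depth X.B then 1 / 2 else 0) +
        4 / quiet X.B.pHat * mean (X.send h) (X.success h)) ≤
    3 / 2 * (if X.High h then 1 else 0) -
      quiet X.B.pHat * X.B.pHat / 4 * (X.clear h - if X.High h then 1 else 0) := by
  have hq := X.send_mem_unit h
  have hr1 := X.mean_receive_le h v
  have hr2 : mean (X.send h) (fun W => if X.obs h W v = .receive then 1 else 0) ≤ 1 := by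
    refine (mean_mono hq (g := fun _ => 1) fun W => ?_).trans_eq (mean_const _ _)
    split_ifs <;> norm_num
  have hr3 : 0 ≤ mean (X.send h) (fun W => if X.obs h W v = .receive then 1 else 0) :=
    mean_nonneg hq fun W => by split_ifs <;> norm_num
  have hs : 0 ≤ mean (X.send h) (X.success h) := mean_nonneg hq (X.success_nonneg h)
  have hi : 0 ≤ mean (X.send h) (fun W => if X.obs h W v = .idle ∧
        (m : ℝ) ≤ (X.state h v).depth X.B then 1 / 2 else 0) :=
    mean_nonneg hq fun W => by split_ifs <;> norm_num
  have hQ := quiet_pos X.B.pHat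
  have hQ1 := quiet_le_one X.B.pHat_lt_one
  have hp0 := X.B.pHat_pos
  have hp1 := X.B.pHat_lt_one
  have hc1 := X.clear_le_one h
  have hc0 := X.clear_nonneg h
  set r := mean (X.send h) (fun W => if X.obs h W v = .receive then 1 else 0)
  set s := mean (X.send h) (X.success h)
  set Q := quiet X.B.pHat
  by_cases hH : X.High h
  · rw [if_pos hH]
    have : 0 ≤ 4 / Q * s := by positivity
    have : 0 ≤ Q * X.B.pHat := by positivity
    nlinarith
  · rw [if_neg hH]
    have hsil := X.quiet_le_silence hH
    have h1 : r ≤ s / Q := by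
      rw [le_div_iff₀ hQ]
      nlinarith
    have h2 : 4 / Q * s = 4 * (s / Q) := by ring
    have h3 : 0 ≤ s / Q := by positivity
    rw [h2]
    by_cases hc : X.Clear h
    · have hcl : X.clear h = 1 := if_pos hc
      rw [hcl]
      by_cases hd : (m : ℝ) ≤ (X.state h v).depth X.B
      · have h4 : mean (X.send h) (fun W => if X.obs h W v = .idle ∧
            (m : ℝ) ≤ (X.state h v).depth X.B then 1 / 2 else 0) =
            1 / 2 * silence (X.send h) := by
          rw [← X.mean_idle hc v, ← mean_const_mul]
          congr 1
          funext W
          simp [hd]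
        rw [h4]
        nlinarith
      · have h4 := X.le_mean_success hc v
        rw [X.send_of_pos hl] at h4
        have hp := X.p_mem h v
        have hγ := X.B.γ_pos
        have h5 : X.B.pHat / 2 ≤ (X.state h v).p := by
          have hD : 0 < Real.log (1 + X.B.γ) := Real.log_pos (by linarith)
          have h6 : Real.log (X.B.pHat / (X.state h v).p) < m * Real.log (1 + X.B.γ) := by
            rw [← div_lt_iff₀ hD]
            exact not_le.1 hd
          have h7 : Real.log (1 + X.B.γ) ≤ X.B.γ := by
            have := Real.log_le_sub_one_of_pos (x := 1 + X.B.γ) (by linarith)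
            linarith
          have h8 : (m : ℝ) * Real.log (1 + X.B.γ) ≤ Real.log 2 := by
            have := mul_le_mul_of_nonneg_left h7 (Nat.cast_nonneg m)
            have := Real.log_two_gt_d9
            linarith
          have h9 := (Real.log_lt_log_iff (div_pos hp0 hp.1) (by norm_num)).1 (h6.trans_le h8)
          rw [div_lt_iff₀ hp.1] at h9
          linarith
        have h6 : X.B.pHat / 2 ≤ s / Q := by
          rw [le_div_iff₀ hQ]
          refine le_trans ?_ h4
          exact mul_le_mul h5 hsil hQ.le hp.1.le
        nlinarith
    · have hcl : X.clear h = 0 := if_neg hc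
      rw [hcl]
      linarith

open scoped Classical in
/-- The exponential supermartingale that controls a node `v` which is still a potential leader; it
vanishes once `v` has become a follower. The exponent is the slack of `v` minus the weighted number
of successes, with corrections for the drift in clear rounds, for high rounds, and for the growth
`1 / (m - 2)` of the slack per round. -/
noncomputable def survivorMart (m : ℕ) (v : V) (h : List (Finset V)) : ℝ :=
  if 0 < (X.state h v).l then
    Real.exp (quiet X.B.pHat / 16 * ((X.state h v).slack X.B m -
      4 / quiet X.B.pHat * successes X.R X.pos X.J h +
      quiet X.B.pHat * X.B.pHat / 4 * (X.clearCount h - X.highCount h) -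
      3 / 2 * X.highCount h - h.length / (m - 2)))
  else 0

theorem mean_survivorMart_le {m : ℕ} (hm3 : 3 ≤ m) (hm : X.B.γ * m ≤ 1 / 2) (v : V)
    (h : List (Finset V)) :
    mean (X.send h) (fun W => X.survivorMart m v (W :: h)) ≤ X.survivorMart m v h := by
  classical
  have hq := X.send_mem_unit h
  by_cases hl : 0 < (X.state h v).l
  · have hQ := quiet_pos X.B.pHat
    have hQ1 := quiet_le_one X.B.pHat_lt_one
    set Q := quiet X.B.pHat with hQdef
    set rcv : Finset V → ℝ := fun W => if X.obs h W v = .receive then 1 else 0 with hrcv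
    set idl : Finset V → ℝ := fun W => if X.obs h W v = .idle ∧
      (m : ℝ) ≤ (X.state h v).depth X.B then 1 / 2 else 0 with hidl
    set hi : ℝ := if X.High h then 1 else 0 with hhi
    set D : ℝ := 3 / 2 * hi - Q * X.B.pHat / 4 * (X.clear h - hi) with hD
    have hrcv0 : ∀ W, 0 ≤ rcv W ∧ rcv W ≤ 1 := fun W => by
      simp only [hrcv]
      split_ifs <;> norm_num
    have hidl0 : ∀ W, 0 ≤ idl W ∧ idl W ≤ 1 / 2 := fun W => by
      simp only [hidl]
      split_ifs <;> norm_num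
    have hstep : ∀ W, X.survivorMart m v (W :: h) ≤
        X.survivorMart m v h * Real.exp (-(Q / 16 * D)) *
        (1 + Q / 16 * (3 / 2 * rcv W - 1 / 2 * (idl W + 4 / Q * X.success h W))) := by
      intro W
      have hs0 := X.success_nonneg h W
      have hs1 := X.success_le_one h W
      have h4 : Q * (4 / Q * X.success h W) = 4 * X.success h W := by
        field_simp
      have hpos : 0 ≤ 4 / Q * X.success h W := by positivity
      have h5 := exp_mul_sub_le (hrcv0 W).1 (add_nonneg (hidl0 W).1 hpos)
        (by positivity : 0 ≤ Q / 16) (by nlinarith [hrcv0 W, hidl0 W])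
      refine le_trans ?_ (mul_le_mul_of_nonneg_left h5 ?_)
      · rw [survivorMart, survivorMart, if_pos hl]
        split_ifs
        · rw [← Real.exp_add, ← Real.exp_add]
          refine Real.exp_le_exp.2 ?_
          have h6 := NodeState.slack_step_le X.B hm3 (X.valid_state h v) hl (X.p_mem h v)
            (X.obs h W v)
          rw [X.successes_cons, X.state_cons, clearCount, highCount, List.length_cons]
          rw [← hQdef]
          have h7 : ((h.length + 1 : ℕ) : ℝ) / ((m : ℝ) - 2) =
              h.length / ((m : ℝ) - 2) + 1 / (m - 2) := by
            push_cast
            rw [add_div]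
          have hrw : rcv W = if X.obs h W v = .receive then 1 else 0 := rfl
          have hiw : idl W = if X.obs h W v = .idle ∧
            (m : ℝ) ≤ (X.state h v).depth X.B then 1 / 2 else 0 := rfl
          rw [← hrw, ← hiw] at h6
          rw [h7, hD, ← mul_neg, ← mul_add, ← mul_add]
          refine mul_le_mul_of_nonneg_left ?_ (by positivity)
          linarith
        · positivity
      · refine mul_nonneg ?_ (Real.exp_pos _).le
        rw [survivorMart, if_pos hl]
        exact (Real.exp_pos _).le
    refine (mean_mono hq hstep).trans ?_
    rw [mean_const_mul]
    have h1 := X.mean_drift_le hm h hl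
    have h2 : mean (X.send h) (fun W =>
        1 + Q / 16 * (3 / 2 * rcv W - 1 / 2 * (idl W + 4 / Q * X.success h W))) ≤
        1 + Q / 16 * D := by
      rw [mean_add, mean_const, mean_const_mul, mean_sub, mean_const_mul, mean_const_mul, mean_add,
        mean_const_mul]
      have := mul_le_mul_of_nonneg_left h1 (by positivity : 0 ≤ Q / 16)
      exact add_le_add_right this 1
    have h3 : 0 ≤ X.survivorMart m v h * Real.exp (-(Q / 16 * D)) := by
      refine mul_nonneg ?_ (Real.exp_pos _).le
      rw [survivorMart, if_pos hl]
      exact (Real.exp_pos _).le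
    have h4 : 1 + Q / 16 * D ≤ Real.exp (Q / 16 * D) := by
      linarith [Real.add_one_le_exp (Q / 16 * D)]
    calc _ ≤ X.survivorMart m v h * Real.exp (-(Q / 16 * D)) * Real.exp (Q / 16 * D) :=
          mul_le_mul_of_nonneg_left (h2.trans h4) h3
      _ = _ := by rw [mul_assoc, ← Real.exp_add, neg_add_cancel, Real.exp_zero, mul_one]
  · have h1 : X.survivorMart m v h = 0 := if_neg hl
    have h2 : ∀ W, X.survivorMart m v (W :: h) = 0 := fun W => by
      refine if_neg ?_
      rw [X.state_cons]
      exact fun h => hl (h.trans_le (NodeState.step_l_le _ _ _))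
    simp only [h1, h2, mean_const, le_refl]

end Survivor

end Scenario

/-! ### The scale on which the load is measured -/

/-- The function that equals `exp x` for `x ≤ 0` and continues linearly for `x ≥ 0`. -/
noncomputable def bend (x : ℝ) : ℝ := if x ≤ 0 then Real.exp x else 1 + x

theorem bend_of_nonpos {x : ℝ} (h : x ≤ 0) : bend x = Real.exp x := if_pos h

theorem bend_of_nonneg {x : ℝ} (h : 0 ≤ x) : bend x = 1 + x := by
  unfold bend
  split_ifs with h'
  · rw [le_antisymm h' h, Real.exp_zero, add_zero]
  · rfl

theorem bend_pos (x : ℝ) : 0 < bend x := by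
  rcases le_total x 0 with h | h
  · rw [bend_of_nonpos h]
    exact Real.exp_pos _
  · rw [bend_of_nonneg h]
    linarith

theorem bend_le_exp (x : ℝ) : bend x ≤ Real.exp x := by
  rcases le_total x 0 with h | h
  · rw [bend_of_nonpos h]
  · rw [bend_of_nonneg h]
    linarith [Real.add_one_le_exp x]

theorem bend_mono {x y : ℝ} (h : x ≤ y) : bend x ≤ bend y := by
  rcases le_total y 0 with hy | hy
  · rw [bend_of_nonpos hy, bend_of_nonpos (h.trans hy)]
    exact Real.exp_le_exp.2 h
  · rw [bend_of_nonneg hy]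
    rcases le_total x 0 with hx | hx
    · rw [bend_of_nonpos hx]
      linarith [Real.exp_le_one_iff.2 hx]
    · rw [bend_of_nonneg hx]
      linarith

theorem bend_le_one {x : ℝ} (h : x ≤ 0) : bend x ≤ 1 := by
  rw [bend_of_nonpos h]
  exact Real.exp_le_one_iff.2 h

theorem one_le_bend {x : ℝ} (h : 0 ≤ x) : 1 ≤ bend x := by
  rw [bend_of_nonneg h]
  linarith

theorem bend_add_le (x : ℝ) {s : ℝ} (h0 : 0 ≤ s) (h1 : s ≤ 1) :
    bend (x + 2 * s) ≤ bend x + 7 * s * min (bend x) 1 := by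
  have he : Real.exp (2 * s) ≤ 1 + 7 * s := by
    have h2 := convexOn_exp.2 (Set.mem_univ 0) (Set.mem_univ 2) (by linarith : 0 ≤ 1 - s) h0
      (by ring)
    simp only [smul_eq_mul, mul_zero, zero_add, Real.exp_zero, mul_one] at h2
    have h3 : Real.exp 2 ≤ 8 := by
      have : Real.exp 2 = Real.exp 1 * Real.exp 1 := by rw [← Real.exp_add]; norm_num
      rw [this]
      nlinarith [Real.exp_one_lt_d9, Real.exp_pos 1]
    rw [mul_comm s 2] at h2
    nlinarith
  rcases le_total x 0 with h | h
  · rw [min_eq_left (bend_le_one h)]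
    refine (bend_le_exp _).trans ?_
    rw [bend_of_nonpos h, Real.exp_add]
    nlinarith [Real.exp_pos x]
  · rw [min_eq_right (one_le_bend h), bend_of_nonneg h, bend_of_nonneg (by linarith)]
    linarith

theorem bend_sub_le (x : ℝ) {t : ℝ} (h0 : 0 ≤ t) (h1 : t ≤ 1 / 2) :
    bend (x - t) ≤ bend x - t / 2 * min (bend x) 1 := by
  have he : Real.exp (-t) ≤ 1 - t / 2 := by
    have h2 := Real.abs_exp_sub_one_sub_id_le (x := -t) (by rw [abs_neg, abs_of_nonneg h0]; linarith)
    have := (abs_le.1 h2).2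
    nlinarith
  rcases le_total x 0 with h | h
  · rw [min_eq_left (bend_le_one h), bend_of_nonpos h, bend_of_nonpos (by linarith), sub_eq_add_neg,
      Real.exp_add]
    nlinarith [Real.exp_pos x]
  · rw [min_eq_right (one_le_bend h), bend_of_nonneg h]
    rcases le_total 0 (x - t) with h2 | h2
    · rw [bend_of_nonneg h2]
      linarith
    · rw [bend_of_nonpos h2]
      have h3 : Real.exp (x - t) ≤ 1 := Real.exp_le_one_iff.2 h2
      have h4 : Real.exp (x - t) ≤ Real.exp (-t) * Real.exp x := by
        rw [← Real.exp_add]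
        exact (congrArg Real.exp (by ring)).le
      have h5 : Real.exp (-t) * Real.exp x ≤ x + Real.exp (-t) := by
        have h6 : 1 - x ≤ Real.exp (-x) := by linarith [Real.add_one_le_exp (-x)]
        have h7 : Real.exp (-t) ≤ Real.exp (-x) := Real.exp_le_exp.2 (by linarith)
        have h8 : Real.exp (-x) * Real.exp x = 1 := by
          rw [← Real.exp_add, neg_add_cancel, Real.exp_zero]
        have h9 : 0 ≤ Real.exp x - 1 := by linarith [Real.add_one_le_exp x]
        nlinarith [mul_le_mul_of_nonneg_right h7 h9]
      linarith

/-- Second-order expansion of `exp (r (w' ^ 2 - w ^ 2))` for an increment that is small compared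
with both `w` and `1 / (r w)`. -/
theorem exp_sq_sub_le {w w' U D S r : ℝ} (hw' : 0 ≤ w') (h : w' ≤ w + U - D) (hU : 0 ≤ U)
    (hD : 0 ≤ D) (hS : U + D ≤ S) (hw : 8 * S ≤ w) (hr : 0 ≤ r) (hrw : 16 * (r * w * S) ≤ 1) :
    Real.exp (r * (w' ^ 2 - w ^ 2)) ≤ 1 + 2 * r * w * (3 / 2 * U - 1 / 2 * D) := by
  have hw0 : 0 ≤ w := by linarith
  set t := 2 * r * w with ht
  have ht0 : 0 ≤ t := by positivity
  have h1 : w' ^ 2 ≤ (w + U - D) ^ 2 := by gcongr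
  have h2 : r * (w' ^ 2 - w ^ 2) ≤ t * (U - D + (U + D) / 16) := by
    have h3 : (U - D) ^ 2 ≤ (U + D) * (w / 8) := by
      have : (U - D) ^ 2 ≤ (U + D) * (U + D) := by nlinarith
      nlinarith
    have h4 : w' ^ 2 - w ^ 2 ≤ 2 * w * (U - D + (U + D) / 16) := by nlinarith
    calc r * (w' ^ 2 - w ^ 2) ≤ r * (2 * w * (U - D + (U + D) / 16)) :=
          mul_le_mul_of_nonneg_left h4 hr
      _ = _ := by rw [ht]; ring
  set y := t * (U - D + (U + D) / 16) with hy
  have htS : t * (U + D) ≤ 1 / 8 := by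
    have : t * (U + D) ≤ t * S := mul_le_mul_of_nonneg_left hS ht0
    nlinarith
  have hy1 : |y| ≤ t * (U + D) * (17 / 16) := by
    rw [hy, abs_mul, abs_of_nonneg ht0, mul_assoc t]
    refine mul_le_mul_of_nonneg_left (abs_le.2 ⟨?_, ?_⟩) ht0 <;> linarith
  have hy2 : |y| ≤ 17 / 128 := by linarith
  have h5 := (abs_le.1 (Real.abs_exp_sub_one_sub_id_le (x := y) (by linarith))).2
  have h6 : y ^ 2 ≤ t * (U + D) * (17 / 16) * (17 / 128) := by
    rw [← sq_abs, sq]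
    exact mul_le_mul hy1 hy2 (abs_nonneg _) (le_trans (abs_nonneg _) hy1)
  have h7 : 0 ≤ t * (U + D) := mul_nonneg ht0 (by linarith)
  have h8 := Real.exp_le_exp.2 h2
  have h9 : y = t * U - t * D + t * (U + D) / 16 := by rw [hy]; ring
  nlinarith

namespace Scenario

section Load

variable {V : Type*} (X : Scenario V)

open scoped Classical in
/-- The smoothed probability of `v` if the noise at `v` leaves the channel usable, and zero
otherwise. -/
noncomputable def openLoad (h : List (Finset V)) (v : V) : ℝ :=
  if (X.J h v : ℝ) < X.R.θ then (X.state h v).smoothed X.B else 0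

theorem openLoad_nonneg (h : List (Finset V)) (v : V) : 0 ≤ X.openLoad h v := by
  unfold openLoad
  split_ifs
  · exact X.smoothed_state_nonneg h v
  · exact le_rfl

variable [Fintype V]

/-- The largest interpolated window of a potential leader, but at least `m₀`. -/
noncomputable def maxWindow (m₀ : ℝ) (h : List (Finset V)) : ℝ :=
  Finset.univ.fold max m₀ fun v => (X.state h v).window

theorem le_maxWindow (m₀ : ℝ) (h : List (Finset V)) : m₀ ≤ X.maxWindow m₀ h :=
  (Finset.fold_max_le _).1 le_rfl |>.1

theorem window_le_maxWindow (m₀ : ℝ) (h : List (Finset V)) (v : V) :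
    (X.state h v).window ≤ X.maxWindow m₀ h :=
  ((Finset.fold_max_le (f := fun v => (X.state h v).window) _).1 le_rfl).2 v (Finset.mem_univ v)

theorem maxWindow_cons_le {m₀ : ℝ} (hm : 30 ≤ m₀) (W : Finset V) (h : List (Finset V)) :
    X.maxWindow m₀ (W :: h) ≤ X.maxWindow m₀ h + 5 / X.maxWindow m₀ h := by
  have h0 := X.le_maxWindow m₀ h
  set M := X.maxWindow m₀ h
  have hM : 0 ≤ 5 / M := div_nonneg (by norm_num) (by linarith)
  refine (Finset.fold_max_le _).2 ⟨by linarith, fun v _ => ?_⟩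
  have hv := X.window_le_maxWindow m₀ h v
  change (X.state h v).window ≤ M at hv
  have hval := X.valid_state h v
  rw [X.state_cons]
  by_cases ho : X.obs h W v = .idle
  · rw [ho]
    refine (NodeState.window_step_idle X.B hval (by linarith : 20 ≤ m₀)).trans ?_
    refine max_le ?_ ?_ <;> linarith
  · by_cases hl : 0 < (X.state h v).l
    · have h1 := NodeState.window_step_of_ne_idle X.B hval ho
      have h2 := hval.window_le
      have hT : (1 : ℝ) ≤ (X.state h v).T := by exact_mod_cast hval.1
      by_cases h3 : (X.state h v).window ≤ M - 4
      · have : 4 / ((X.state h v).T : ℝ) ≤ 4 := div_le_self (by norm_num) hT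
        linarith
      · have : 4 / ((X.state h v).T : ℝ) ≤ 5 / M := by
          rw [div_le_div_iff₀ (by linarith) (by linarith)]
          linarith
        linarith
    · rw [NodeState.step_of_not_pos hl]
      linarith

theorem maxWindow_cons_empty_le {m₀ : ℝ} (hm : 30 ≤ m₀) {h : List (Finset V)} (hc : X.Clear h) :
    X.maxWindow m₀ (∅ :: h) ≤ max m₀ (X.maxWindow m₀ h - 1 / 2) := by
  refine (Finset.fold_max_le _).2 ⟨le_max_left _ _, fun v _ => ?_⟩
  have hv := X.window_le_maxWindow m₀ h v
  rw [X.state_cons, (X.obs_idle_iff h ∅ v).2 ⟨rfl, (X.clear_iff h).1 hc v⟩]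
  refine (NodeState.window_step_idle X.B (X.valid_state h v) (by linarith : 20 ≤ m₀)).trans ?_
  exact max_le_max le_rfl (by linarith)

/-- Increments of order `1 / maxWindow` make the largest window grow like the square root of the
number of rounds. -/
theorem maxWindow_sq_le {m₀ : ℝ} (hm : 30 ≤ m₀) (h : List (Finset V)) :
    X.maxWindow m₀ h ^ 2 ≤ m₀ ^ 2 + 11 * h.length := by
  induction h with
  | nil =>
    have : X.maxWindow m₀ [] = m₀ := by
      refine le_antisymm ((Finset.fold_max_le _).2 ⟨le_rfl, fun v _ => ?_⟩) (X.le_maxWindow _ _)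
      refine (X.valid_state [] v).window_le.trans ?_
      simp only [state, stateAfter, NodeState.init]
      push_cast
      linarith
    rw [this]
    simp
  | cons W h ih =>
    have h0 := X.le_maxWindow m₀ h
    have h1 := X.maxWindow_cons_le hm W h
    have h2 := X.le_maxWindow m₀ (W :: h)
    set M := X.maxWindow m₀ h
    have h3 : (M + 5 / M) ^ 2 ≤ M ^ 2 + 11 := by
      have hM : 0 < M := by linarith
      have h4 : M * (5 / M) = 5 := by field_simp
      have h5 : 5 / M ≤ 1 / 6 := by
        rw [div_le_div_iff₀ hM (by norm_num)]
        linarith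
      have h6 : 0 ≤ 5 / M := by positivity
      nlinarith
    have h7 : X.maxWindow m₀ (W :: h) ^ 2 ≤ (M + 5 / M) ^ 2 := by
      have : 0 ≤ X.maxWindow m₀ (W :: h) := by linarith
      gcongr
    push_cast [List.length_cons]
    linarith

theorem sum_openLoad_le (h : List (Finset V)) : ∑ v, X.openLoad h v ≤ X.load h :=
  Finset.sum_le_sum fun v _ => by
    unfold openLoad
    split_ifs
    · exact le_rfl
    · exact X.smoothed_state_nonneg h v

theorem load_cons_le (hγ : X.B.γ ≤ 1 / 4) (W : Finset V) (h : List (Finset V)) :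
    X.load (W :: h) ≤ (1 + 2 * X.B.γ) * X.load h := by
  rw [load, load, Finset.mul_sum]
  exact Finset.sum_le_sum fun v _ =>
    NodeState.smoothed_step_le X.B hγ (X.valid_state h v) (X.p_mem h v).1 _

/-- A silent round raises only the probabilities of the nodes at which the noise is below `θ`. -/
theorem load_cons_empty_le (hγ : X.B.γ ≤ 1 / 4) (h : List (Finset V)) :
    X.load (∅ :: h) ≤ X.load h + 2 * X.B.γ * ∑ v, X.openLoad h v := by
  rw [load, load, Finset.mul_sum, ← Finset.sum_add_distrib]
  refine Finset.sum_le_sum fun v _ => ?_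
  have hval := X.valid_state h v
  have hp := (X.p_mem h v).1
  rw [X.state_cons]
  unfold openLoad
  split_ifs with hv
  · have := NodeState.smoothed_step_le X.B hγ hval hp (X.obs h ∅ v)
    linarith
  · have hT : (1 : ℝ) ≤ (X.state h v).T := by exact_mod_cast hval.1
    refine (NodeState.smoothed_step_of_ne_idle X.B hγ hval hp (o := X.obs h ∅ v) ?_).trans ?_
    · rw [Ne, X.obs_idle_iff]
      tauto
    · have h1 : 0 ≤ X.B.γ / (16 * (X.state h v).T) :=
        div_nonneg X.B.γ_pos.le (by positivity)
      nlinarith [X.smoothed_state_nonneg h v]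

/-- If somebody transmits, no channel is idle and all timers run down. -/
theorem load_cons_le_of_nonempty (hγ : X.B.γ ≤ 1 / 4) (m₀ : ℝ) {W : Finset V}
    (hW : W ≠ ∅) (h : List (Finset V)) :
    X.load (W :: h) ≤ (1 - X.B.γ * (1 / (16 * X.maxWindow m₀ h))) * X.load h := by
  rw [load, load, Finset.mul_sum]
  refine Finset.sum_le_sum fun v _ => ?_
  have hval := X.valid_state h v
  have hp := (X.p_mem h v).1
  have hT : (1 : ℝ) ≤ (X.state h v).T := by exact_mod_cast hval.1
  rw [X.state_cons]
  by_cases hl : 0 < (X.state h v).l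
  · refine (NodeState.smoothed_step_of_ne_idle X.B hγ hval hp (o := X.obs h W v) ?_).trans ?_
    · rw [Ne, X.obs_idle_iff]
      tauto
    · refine mul_le_mul_of_nonneg_right ?_ (X.smoothed_state_nonneg h v)
      have h1 := (NodeState.T_le_window hl).trans (X.window_le_maxWindow m₀ h v)
      have h2 : 1 / (16 * X.maxWindow m₀ h) ≤ 1 / (16 * ((X.state h v).T : ℝ)) := by
        gcongr
      have h3 := mul_le_mul_of_nonneg_left h2 X.B.γ_pos.le
      rw [mul_one_div] at h3
      rw [mul_one_div] at h3
      rw [mul_one_div]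
      linarith
  · rw [NodeState.step_of_not_pos hl, NodeState.smoothed_of_l_eq_zero X.B hl, mul_zero]

/-- A lone transmitter is received wherever the noise is below `θ`. -/
theorem load_cons_singleton_le (hγ : X.B.γ ≤ 1 / 4) [DecidableEq V] (u : V)
    (h : List (Finset V)) :
    X.load ({u} :: h) ≤ X.load h - X.B.γ / 2 * (∑ v, X.openLoad h v - X.openLoad h u) := by
  rw [← Finset.sum_erase_eq_sub (Finset.mem_univ u), Finset.mul_sum, load, load,
    ← Finset.add_sum_erase _ _ (Finset.mem_univ u),
    ← Finset.add_sum_erase _ (fun v => (X.state h v).smoothed X.B) (Finset.mem_univ u),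
    add_sub_assoc, ← Finset.sum_sub_distrib]
  have hne : ∀ v, (X.state ({u} :: h) v).smoothed X.B ≤ (X.state h v).smoothed X.B := by
    intro v
    have hval := X.valid_state h v
    have hT : (1 : ℝ) ≤ (X.state h v).T := by exact_mod_cast hval.1
    rw [X.state_cons]
    refine (NodeState.smoothed_step_of_ne_idle X.B hγ hval (X.p_mem h v).1 ?_).trans ?_
    · rw [Ne, X.obs_idle_iff]
      simp
    · refine mul_le_of_le_one_left (X.smoothed_state_nonneg h v) ?_
      have : 0 ≤ X.B.γ / (16 * (X.state h v).T) :=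
        div_nonneg X.B.γ_pos.le (by positivity)
      linarith
  refine add_le_add (hne u) (Finset.sum_le_sum fun v hv => ?_)
  unfold openLoad
  split_ifs with hn
  · have ho : X.obs h {u} v = .receive :=
      X.observe_singleton _ (Finset.ne_of_mem_erase hv).symm hn
    rw [X.state_cons, ho]
    have := NodeState.smoothed_step_receive X.B hγ (X.valid_state h v) (X.p_mem h v).1
    linarith
  · rw [mul_zero, sub_zero]
    exact hne v

end Load

end Scenario

namespace Scenario

/-! ### The potential that bounds the number of high rounds -/

section Excess

variable {V : Type*} [Fintype V] (X : Scenario V)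

theorem excess_cons_le_add {W : Finset V} {h : List (Finset V)} {s : ℝ} (hs : 0 ≤ s)
    (hl : X.load (W :: h) ≤ (1 + 2 * X.B.γ * s) * X.load h) :
    X.excess (W :: h) ≤ X.excess h + 2 * s := by
  have hγ := X.B.γ_pos
  have h0 : 0 ≤ 2 * X.B.γ * s := by positivity
  have h1 : max 1 (X.load (W :: h)) ≤ (1 + 2 * X.B.γ * s) * max 1 (X.load h) := by
    have h2 := le_max_left 1 (X.load h)
    refine max_le ?_ (hl.trans (mul_le_mul_of_nonneg_left (le_max_right _ _) (by linarith)))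
    nlinarith
  have h2 : Real.log (max 1 (X.load (W :: h))) ≤ 2 * X.B.γ * s + Real.log (max 1 (X.load h)) := by
    refine (Real.log_le_log (by positivity) h1).trans ?_
    rw [Real.log_mul (by positivity) (by positivity)]
    have := Real.log_le_sub_one_of_pos (x := 1 + 2 * X.B.γ * s) (by linarith)
    linarith
  rw [excess, excess, div_add' _ _ _ hγ.ne']
  refine div_le_div_of_nonneg_right ?_ hγ.le
  linarith

theorem excess_cons_le_sub (hγ : X.B.γ ≤ 1 / 4) {W : Finset V} {h : List (Finset V)} {t : ℝ}
    (ht : 0 ≤ t) (ht1 : t ≤ 1) (h2 : 2 ≤ X.load h)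
    (hl : X.load (W :: h) ≤ (1 - X.B.γ * t) * X.load h) :
    X.excess (W :: h) ≤ X.excess h - t := by
  have hγ0 := X.B.γ_pos
  have h0 : X.B.γ * t ≤ 1 / 4 := by nlinarith
  have h1 : max 1 (X.load (W :: h)) ≤ (1 - X.B.γ * t) * X.load h := max_le (by nlinarith) hl
  have h3 : Real.log (max 1 (X.load (W :: h))) ≤ -(X.B.γ * t) + Real.log (X.load h) := by
    refine (Real.log_le_log (by positivity) h1).trans ?_
    rw [Real.log_mul (by linarith) (by positivity)]
    have := Real.log_le_sub_one_of_pos (x := 1 - X.B.γ * t) (by linarith)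
    linarith
  rw [excess, excess, max_eq_right (by linarith : 1 ≤ X.load h), div_sub' hγ0.ne']
  refine div_le_div_of_nonneg_right ?_ hγ0.le
  linarith

theorem lt_load_of_lt_excess {h : List (Finset V)} (hx : -(1 / X.B.γ) < X.excess h) :
    1400 < X.load h := by
  have hγ0 := X.B.γ_pos
  have h1 : -1 < Real.log (max 1 (X.load h)) - loadThreshold := by
    rwa [excess, ← neg_div, div_lt_div_iff_of_pos_right hγ0] at hx
  have h2 : Real.log 1400 < Real.log (max 1 (X.load h)) := by
    unfold loadThreshold at h1
    linarith
  have h3 := (Real.log_lt_log_iff (by norm_num) (by positivity)).1 h2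
  rcases lt_max_iff.1 h3 with h4 | h4
  · norm_num at h4
  · exact h4

end Excess

/-- Change of the last two terms of `Scenario.pot` in a round that lowers `φ = bend (excess h)` to
`φ' ≤ φ - δ`. Here `G` is their scale, `ζ` the weight of the backlog, `τ` a bound for it, `z` and
`z'` are its values before and after the round, and `cl` is the indicator of a clear round. -/
theorem tail_sub_le {G ζ τ z z' ε cl φ φ' δ : ℝ} (hG : 1 ≤ G) (hζ : 0 ≤ ζ) (hζ1 : ζ ≤ 1 / 2)
    (hz : 0 ≤ z) (hε : 0 ≤ ε) (hc1 : cl ≤ 1)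
    (hz' : z' = max 0 (z + ε - cl)) (hδ : 0 ≤ δ) (hφ : φ' ≤ φ - δ) :
    G * φ' + ζ * (τ - z' * (1 - min φ' 1)) ≤ G * φ + ζ * (τ - z * (1 - min φ 1)) +
      ζ * cl * (1 - min φ 1) - G / 2 * δ := by
  have h1 : min φ' 1 ≤ min φ 1 := min_le_min (by linarith) le_rfl
  have h2 : min φ 1 - min φ' 1 ≤ φ - φ' := by
    rcases le_total φ' 1 with h | h
    · rw [min_eq_left h]
      linarith [min_le_left φ 1]
    · rw [min_eq_right h]
      linarith [min_le_right φ 1]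
  have h3 : min φ' 1 ≤ 1 := min_le_right _ _
  have h4 : z - cl ≤ z' := by
    rw [hz']
    exact le_max_of_le_right (by linarith)
  have h5 : ζ * ((z - cl) * (1 - min φ' 1)) ≤ ζ * (z' * (1 - min φ' 1)) :=
    mul_le_mul_of_nonneg_left (mul_le_mul_of_nonneg_right h4 (by linarith)) hζ
  have h6 : ζ * z * min φ' 1 ≤ ζ * z * min φ 1 :=
    mul_le_mul_of_nonneg_left h1 (mul_nonneg hζ hz)
  have h7 : ζ * cl * (min φ 1 - min φ' 1) ≤ 1 / 2 * (φ - φ') := by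
    have : ζ * cl ≤ 1 / 2 := by nlinarith
    exact mul_le_mul this h2 (by linarith) (by norm_num)
  have h8 : (G - 1 / 2) * (φ - φ') ≥ G / 2 * δ := by
    have : G / 2 * δ ≤ (G - 1 / 2) * δ := mul_le_mul_of_nonneg_right (by linarith) hδ
    have : (G - 1 / 2) * δ ≤ (G - 1 / 2) * (φ - φ') :=
      mul_le_mul_of_nonneg_left (by linarith) (by linarith)
    linarith
  nlinarith

/-- The analogue of `tail_sub_le` for a round that raises `φ` by at most `δ`. -/
theorem tail_add_le {G ζ τ z z' ε cl φ φ' δ : ℝ} (hG : 1 ≤ G) (hζ : 0 ≤ ζ) (hζ1 : ζ ≤ 1 / 2)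
    (hz : 0 ≤ z) (hzτ : z ≤ τ) (hζτ : ζ * τ ≤ 1) (hε : 0 ≤ ε) (hc0 : 0 ≤ cl) (hc1 : cl ≤ 1)
    (hz' : z' = max 0 (z + ε - cl)) (hδ : 0 ≤ δ) (hφ : φ' ≤ φ + δ) :
    G * φ' + ζ * (τ - z' * (1 - min φ' 1)) ≤ G * φ + ζ * (τ - z * (1 - min φ 1)) +
      ζ * cl * (1 - min φ 1) + 2 * G * δ := by
  rcases le_total φ' φ with h | h
  · have h1 := tail_sub_le (τ := τ) hG hζ hζ1 hz hε hc1 hz' le_rfl (h.trans_eq (sub_zero φ).symm)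
    have : 0 ≤ 2 * G * δ := by positivity
    linarith
  · have h1 : min φ 1 ≤ min φ' 1 := min_le_min h le_rfl
    have h2 : min φ' 1 - min φ 1 ≤ φ' - φ := by
      rcases le_total φ 1 with h | h
      · rw [min_eq_left h]
        linarith [min_le_left φ' 1]
      · rw [min_eq_right h]
        linarith [min_le_right φ' 1]
    have h3 : min φ' 1 ≤ 1 := min_le_right _ _
    have h4 : z - cl ≤ z' := by
      rw [hz']
      exact le_max_of_le_right (by linarith)
    have h5 : ζ * ((z - cl) * (1 - min φ' 1)) ≤ ζ * (z' * (1 - min φ' 1)) :=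
      mul_le_mul_of_nonneg_left (mul_le_mul_of_nonneg_right h4 (by linarith)) hζ
    have h6 : ζ * z * (min φ' 1 - min φ 1) ≤ 1 * (φ' - φ) := by
      have : ζ * z ≤ 1 := (mul_le_mul_of_nonneg_left hzτ hζ).trans hζτ
      exact mul_le_mul this h2 (by linarith) (by norm_num)
    have h7 : 0 ≤ ζ * cl * (min φ' 1 - min φ 1) :=
      mul_nonneg (mul_nonneg hζ hc0) (by linarith)
    have h8 : (G + 1) * (φ' - φ) ≤ 2 * G * δ :=
      mul_le_mul (by linarith) (by linarith) (by linarith) (by linarith)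
    nlinarith

/-- In a jammed round with small `φ` the backlog grows by `ε`, which lowers the potential. -/
theorem tail_jammed_le {G ζ τ z z' ε φ φ' δ : ℝ} (hG : 1 ≤ G) (hζ : 0 ≤ ζ)
    (hz : 0 ≤ z) (hzτ : z ≤ τ) (hζτ : ζ * τ ≤ 1) (hε : 0 ≤ ε)
    (hz' : z' = max 0 (z + ε - 0)) (hδ : 0 ≤ δ) (hφ : φ' ≤ φ + δ) (hφ' : φ' ≤ 1 / 2) :
    G * φ' + ζ * (τ - z' * (1 - min φ' 1)) ≤ G * φ + ζ * (τ - z * (1 - min φ 1)) +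
      2 * G * δ - ζ * ε / 2 := by
  have hz2 : z' = z + ε := by
    rw [hz', sub_zero, max_eq_right (by linarith)]
  have h1 : min φ' 1 - min φ 1 ≤ δ := by
    rw [min_eq_left (by linarith : φ' ≤ 1), sub_le_iff_le_add, add_comm, ← min_add_add_right]
    exact le_min (by linarith) (by linarith)
  have h2 : ζ * z * (min φ' 1 - min φ 1) ≤ 1 * δ := by
    have h3 : ζ * z ≤ 1 := (mul_le_mul_of_nonneg_left hzτ hζ).trans hζτ
    exact (mul_le_mul_of_nonneg_left h1 (mul_nonneg hζ hz)).trans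
      (mul_le_mul_of_nonneg_right h3 hδ)
  have h3 : ζ * ε * (1 / 2) ≤ ζ * ε * (1 - min φ' 1) := by
    refine mul_le_mul_of_nonneg_left ?_ (by positivity)
    linarith [min_le_left φ' 1]
  have h4 : G * φ' ≤ G * (φ + δ) := mul_le_mul_of_nonneg_left hφ (by linarith)
  have h5 : 1 * δ ≤ G * δ := mul_le_mul_of_nonneg_right hG hδ
  rw [hz2]
  nlinarith

/-- The weight of the backlog in the potential. It is chosen so that `penalty * ε` is `28 * G` times
`exp (-1 / γ)`, an upper bound for `bend (excess h)` when the load is low. -/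
noncomputable def penalty {V : Type*} (X : Scenario V) (ε G : ℝ) : ℝ :=
  28 * G / (ε * Real.exp (1 / X.B.γ))

/-- The conditions on the parameters under which the potential decreases on average: `γ` is so
small, in terms of `ε`, `G` and `T`, that `exp (1 / γ)` exceeds every other quantity. -/
structure Tuned {V : Type*} (X : Scenario V) (ε : ℝ) (T : ℕ) (G : ℝ) : Prop where
  γ_le : X.B.γ ≤ 1 / 4
  G_ge : 5120 ≤ G
  ε_pos : 0 < ε
  ε_le : ε ≤ 1
  backlog_le : ∀ h, X.backlog ε h ≤ ε * T
  penalty_mul_le : X.penalty ε G * (ε * T) ≤ 1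
  penalty_le_quiet : 9 * X.penalty ε G ≤ quiet X.B.pHat
  penalty_mul_window : 9 / 4 * X.penalty ε G * (5000 * G + 1) ≤ 1
  G_le : G ≤ 256 * Real.exp (1 / X.B.γ)

section Potential

variable {V : Type*} [Fintype V] (X : Scenario V)

/-- The potential: essentially the value that the largest window will have when the load has
fallen below the threshold, if no idle channel is sensed until then.  The last term compensates,
during stretches of jammed rounds, for the possibility that the load rises above the threshold. -/
noncomputable def pot (ε : ℝ) (T : ℕ) (G : ℝ) (h : List (Finset V)) : ℝ :=
  X.maxWindow (5000 * G) h + (G * bend (X.excess h) +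
    X.penalty ε G * (ε * T - X.backlog ε h * (1 - min (bend (X.excess h)) 1)))

variable {X} {ε : ℝ} {T : ℕ} {G : ℝ}

theorem Tuned.penalty_pos {V : Type*} {X : Scenario V} (hX : X.Tuned ε T G) :
    0 < X.penalty ε G := by
  have := hX.ε_pos
  have := hX.G_ge
  unfold penalty
  positivity

theorem Tuned.penalty_le_half {V : Type*} {X : Scenario V} (hX : X.Tuned ε T G) :
    X.penalty ε G ≤ 1 / 2 := by
  have := hX.penalty_le_quiet
  have := quiet_le_one X.B.pHat_lt_one
  linarith

theorem Tuned.maxWindow_le_pot (hX : X.Tuned ε T G) (h : List (Finset V)) :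
    X.maxWindow (5000 * G) h ≤ X.pot ε T G h := by
  have h1 := X.backlog_nonneg ε h
  have h2 := hX.backlog_le h
  have h3 := bend_pos (X.excess h)
  have h4 : 0 ≤ min (bend (X.excess h)) 1 := le_min h3.le zero_le_one
  have h5 : 0 ≤ G * bend (X.excess h) := mul_nonneg (by linarith [hX.G_ge]) h3.le
  have h6 : 0 ≤ X.penalty ε G * (ε * T - X.backlog ε h * (1 - min (bend (X.excess h)) 1)) :=
    mul_nonneg hX.penalty_pos.le (by nlinarith)
  unfold pot
  linarith

theorem Tuned.pot_le (hX : X.Tuned ε T G) (h : List (Finset V)) :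
    X.pot ε T G h ≤ X.maxWindow (5000 * G) h + G * bend (X.excess h) + 1 := by
  have h1 := X.backlog_nonneg ε h
  have h3 : min (bend (X.excess h)) 1 ≤ 1 := min_le_right _ _
  have h4 : 0 ≤ X.backlog ε h * (1 - min (bend (X.excess h)) 1) :=
    mul_nonneg h1 (by linarith)
  have h6 : X.penalty ε G * (ε * T - X.backlog ε h * (1 - min (bend (X.excess h)) 1)) ≤
      X.penalty ε G * (ε * T) :=
    mul_le_mul_of_nonneg_left (by linarith) hX.penalty_pos.le
  have h7 := hX.penalty_mul_le
  unfold pot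
  linarith

open scoped Classical in
/-- The indicator of a clear round with a window large enough to shrink at an idle channel. -/
noncomputable def shrink (X : Scenario V) (G : ℝ) (h : List (Finset V)) : ℝ :=
  if X.Clear h ∧ 5000 * G + 1 / 2 ≤ X.maxWindow (5000 * G) h then 1 else 0

theorem shrink_mem (h : List (Finset V)) : 0 ≤ X.shrink G h ∧ X.shrink G h ≤ 1 := by
  unfold shrink
  split_ifs <;> norm_num

theorem Tuned.maxWindow_cons_le_sub [DecidableEq V] (hX : X.Tuned ε T G) (W : Finset V)
    (h : List (Finset V)) : X.maxWindow (5000 * G) (W :: h) ≤ X.maxWindow (5000 * G) h +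
      5 / X.maxWindow (5000 * G) h - if W = ∅ then 1 / 2 * X.shrink G h else 0 := by
  have hG := hX.G_ge
  have h0 := X.le_maxWindow (5000 * G) h
  have h1 : 0 ≤ 5 / X.maxWindow (5000 * G) h := div_nonneg (by norm_num) (by linarith)
  by_cases hW : W = ∅
  · subst hW
    rw [if_pos rfl]
    unfold shrink
    split_ifs with hc
    · refine (X.maxWindow_cons_empty_le (by linarith) hc.1).trans ?_
      refine max_le ?_ ?_ <;> linarith [hc.2]
    · have := X.maxWindow_cons_le (m₀ := 5000 * G) (by linarith) ∅ h
      linarith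
  · rw [if_neg hW, sub_zero]
    exact X.maxWindow_cons_le (by linarith) W h

/-- If the round is clear and not high, then the possible shrinking of the window outweighs the
growth of the backlog term. -/
theorem Tuned.clear_cost_le (hX : X.Tuned ε T G) {h : List (Finset V)} (hh : ¬ X.High h) :
    9 / 4 * X.penalty ε G * X.clear h ≤ 1 / 4 * (X.shrink G h * silence (X.send h)) +
      1 / X.maxWindow (5000 * G) h := by
  have hG := hX.G_ge
  have h0 := X.le_maxWindow (5000 * G) h
  have h1 : 0 < 1 / X.maxWindow (5000 * G) h := one_div_pos.2 (by linarith)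
  have h2 := X.quiet_le_silence hh
  have h3 := hX.penalty_le_quiet
  by_cases hc : X.Clear h
  · have hcl : X.clear h = 1 := if_pos hc
    rw [hcl]
    by_cases hb : 5000 * G + 1 / 2 ≤ X.maxWindow (5000 * G) h
    · have hs : X.shrink G h = 1 := if_pos ⟨hc, hb⟩
      rw [hs]
      linarith
    · have h4 : 9 / 4 * X.penalty ε G ≤ 1 / X.maxWindow (5000 * G) h := by
        rw [le_div_iff₀ (by linarith)]
        refine le_trans ?_ hX.penalty_mul_window
        have := hX.penalty_pos
        exact mul_le_mul_of_nonneg_left (by linarith) (by linarith)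
      have h5 : 0 ≤ X.shrink G h * silence (X.send h) :=
        mul_nonneg (shrink_mem h).1 (silence_nonneg (X.send_mem_unit h))
      linarith
  · have hcl : X.clear h = 0 := if_neg hc
    have h5 : 0 ≤ X.shrink G h * silence (X.send h) :=
      mul_nonneg (shrink_mem h).1 (silence_nonneg (X.send_mem_unit h))
    rw [hcl]
    linarith

/-- A bound `U W - D W` for the increment of the potential when the nodes in `W` transmit, with
the size and the mean that the exponential supermartingale requires. -/
structure IncrementBound [DecidableEq V] (X : Scenario V) (ε : ℝ) (T : ℕ) (G : ℝ)
    (h : List (Finset V)) (U D : Finset V → ℝ) : Prop where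
  up_nonneg : ∀ W, 0 ≤ U W
  down_nonneg : ∀ W, 0 ≤ D W
  add_le : ∀ W, U W + D W ≤ 20 * G
  pot_cons_le : ∀ W, X.pot ε T G (W :: h) ≤ X.pot ε T G h + U W - D W
  mean_le : mean (X.send h) (fun W => 3 / 2 * U W - 1 / 2 * D W) ≤
    (9 - G / 512 * min (bend (X.excess h)) 1) / X.maxWindow (5000 * G) h

variable [DecidableEq V]

/-- When the load is low, `bend (excess h)` is at most `exp (-1 / γ)`; its growth is paid for by the
backlog in jammed rounds, and by the shrinking window in clear ones. -/
theorem Tuned.incrementBound_of_low (hX : X.Tuned ε T G) {h : List (Finset V)}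
    (hx : X.excess h ≤ -(1 / X.B.γ)) :
    X.IncrementBound ε T G h
      (fun _ => 5 / X.maxWindow (5000 * G) h + 3 / 2 * X.penalty ε G * X.clear h)
      (fun W => if W = ∅ then 1 / 2 * X.shrink G h else 0) := by
  have hG := hX.G_ge
  have hγ := X.B.γ_pos
  have h0 := X.le_maxWindow (5000 * G) h
  have hM5 : 0 ≤ 5 / X.maxWindow (5000 * G) h := div_nonneg (by norm_num) (by linarith)
  have hM5' : 5 / X.maxWindow (5000 * G) h ≤ 1 := by
    rw [div_le_one (by linarith)]
    linarith
  have hζ := hX.penalty_pos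
  have hζ1 := hX.penalty_le_half
  have hc0 := X.clear_nonneg h
  have hc1 := X.clear_le_one h
  have hs := shrink_mem (X := X) (G := G) h
  have hx0 : X.excess h < 0 := by
    have : 0 < 1 / X.B.γ := by positivity
    linarith
  have hH : ¬ X.High h := not_le.2 hx0
  set κ := Real.exp (-(1 / X.B.γ)) with hκ
  have hκ0 : 0 < κ := Real.exp_pos _
  have hκQ : κ * Real.exp (1 / X.B.γ) = 1 := by
    rw [hκ, ← Real.exp_add, neg_add_cancel, Real.exp_zero]
  have hGκ : G * κ ≤ 256 := by
    have := mul_le_mul_of_nonneg_right hX.G_le hκ0.le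
    nlinarith
  have hκ1 : κ ≤ 1 / 20 := by nlinarith
  have hζκ : X.penalty ε G * ε = 28 * G * κ := by
    have := hX.ε_pos
    rw [penalty, hκ, Real.exp_neg]
    field_simp
  have hb : bend (X.excess h) ≤ κ := (bend_le_exp _).trans (Real.exp_le_exp.2 hx)
  have hb0 := bend_pos (X.excess h)
  refine ⟨fun W => by positivity, fun W => ?_, fun W => ?_, fun W => ?_, ?_⟩
  · split_ifs
    · linarith
    · exact le_rfl
  · have : 3 / 2 * X.penalty ε G * X.clear h ≤ 1 := by nlinarith
    split_ifs <;> linarith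
  · have hM := hX.maxWindow_cons_le_sub W h
    have hb' : bend (X.excess (W :: h)) ≤ bend (X.excess h) + 7 * κ := by
      have h1 := X.excess_cons_le_add (W := W) (h := h) zero_le_one
        (by rw [mul_one]; exact X.load_cons_le hX.γ_le W h)
      refine (bend_mono h1).trans ((bend_add_le _ zero_le_one le_rfl).trans ?_)
      have := min_le_left (bend (X.excess h)) 1
      linarith
    have key : G * bend (X.excess (W :: h)) + X.penalty ε G *
        (ε * T - X.backlog ε (W :: h) * (1 - min (bend (X.excess (W :: h))) 1)) ≤
        G * bend (X.excess h) + X.penalty ε G *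
        (ε * T - X.backlog ε h * (1 - min (bend (X.excess h)) 1)) +
        3 / 2 * X.penalty ε G * X.clear h := by
      by_cases hc : X.Clear h
      · have hcl : X.clear h = 1 := if_pos hc
        have := tail_add_le (τ := ε * T) (by linarith : 1 ≤ G) hζ.le hζ1 (X.backlog_nonneg ε h)
          (hX.backlog_le h) hX.penalty_mul_le hX.ε_pos.le hc0 hc1 (by rfl :
          X.backlog ε (W :: h) = _) (by positivity) hb'
        rw [hcl] at this ⊢
        have h2 : 0 ≤ min (bend (X.excess h)) 1 := le_min hb0.le zero_le_one
        have h3 := hX.ε_le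
        nlinarith
      · have hcl : X.clear h = 0 := if_neg hc
        have := tail_jammed_le (τ := ε * T) (by linarith : 1 ≤ G) hζ.le (X.backlog_nonneg ε h)
          (hX.backlog_le h) hX.penalty_mul_le hX.ε_pos.le
          (by rw [backlog, hcl] : X.backlog ε (W :: h) = _) (by positivity) hb' (by linarith)
        rw [hcl]
        nlinarith
    unfold pot
    linarith
  · rw [mean_sub, mean_const_mul, mean_const_mul, mean_const, mean_ite_empty]
    have h1 := hX.clear_cost_le hH
    have h2 : G / 512 * min (bend (X.excess h)) 1 ≤ 1 / 2 := by
      have := min_le_left (bend (X.excess h)) 1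
      nlinarith
    have h3 : (17 / 2) / X.maxWindow (5000 * G) h ≤
        (9 - G / 512 * min (bend (X.excess h)) 1) / X.maxWindow (5000 * G) h :=
      div_le_div_of_nonneg_right (by linarith) (by linarith)
    refine le_trans ?_ h3
    have h4 : (17 / 2) / X.maxWindow (5000 * G) h = 3 / 2 * (5 / X.maxWindow (5000 * G) h) +
        1 / X.maxWindow (5000 * G) h := by ring
    linarith

end Potential

end Scenario

namespace Scenario

section Drift

variable {V : Type*} [Fintype V] {X : Scenario V} {ε : ℝ} {T : ℕ} {G : ℝ}

/-- The fraction of the load that receives the message if exactly one node transmits. -/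
noncomputable def reached (X : Scenario V) (h : List (Finset V)) (W : Finset V) : ℝ :=
  if W.card = 1 then (∑ v, X.openLoad h v - ∑ u ∈ W, X.openLoad h u) / X.load h else 0

theorem reached_mem (h : List (Finset V)) (W : Finset V) :
    0 ≤ X.reached h W ∧ X.reached h W ≤ 1 := by
  unfold reached
  split_ifs
  · have h1 : ∑ u ∈ W, X.openLoad h u ≤ ∑ v, X.openLoad h v :=
      Finset.sum_le_sum_of_subset_of_nonneg (Finset.subset_univ W)
        fun v _ _ => X.openLoad_nonneg h v
    have h2 := Finset.sum_nonneg (s := W) fun v _ => X.openLoad_nonneg h v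
    have h3 := X.sum_openLoad_le h
    exact ⟨div_nonneg (by linarith) (X.load_nonneg h),
      div_le_one_of_le₀ (by linarith) (X.load_nonneg h)⟩
  · norm_num

/-- A deterministic bound for the potential: the window grows like the square root of the number of
rounds, and the load is at most `2 N`. -/
theorem Tuned.pot_le_sqrt (hX : X.Tuned ε T G) [Nonempty V] (h : List (Finset V)) :
    X.pot ε T G h ≤ Real.sqrt ((5000 * G) ^ 2 + 11 * h.length) +
      G * (1 + Real.log (2 * Fintype.card V) / X.B.γ) + 1 := by
  have hG := hX.G_ge
  have hγ := X.B.γ_pos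
  have hN : (1 : ℝ) ≤ Fintype.card V := by exact_mod_cast Fintype.card_pos
  have h1 : X.maxWindow (5000 * G) h ≤ Real.sqrt ((5000 * G) ^ 2 + 11 * h.length) :=
    Real.le_sqrt_of_sq_le (X.maxWindow_sq_le (by linarith) h)
  have hlog : 0 ≤ Real.log (2 * Fintype.card V) := Real.log_nonneg (by linarith)
  have h2 : X.excess h ≤ Real.log (2 * Fintype.card V) / X.B.γ := by
    refine div_le_div_of_nonneg_right ?_ hγ.le
    have h3 : X.load h ≤ 2 * Fintype.card V := by
      refine (X.load_le_two_mul hX.γ_le h).trans ?_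
      have : ∑ v, X.send h v ≤ ∑ _v : V, (1 : ℝ) :=
        Finset.sum_le_sum fun v _ => (X.send_mem_unit h v).2
      simp at this
      linarith
    have h4 : Real.log (max 1 (X.load h)) ≤ Real.log (2 * Fintype.card V) :=
      Real.log_le_log (by positivity) (max_le (by linarith) h3)
    have h5 : 0 ≤ loadThreshold := by
      have : 0 ≤ Real.log 1400 := Real.log_nonneg (by norm_num)
      unfold loadThreshold
      linarith
    linarith
  have h3 : bend (X.excess h) ≤ 1 + Real.log (2 * Fintype.card V) / X.B.γ := by
    refine (bend_mono h2).trans_eq (bend_of_nonneg (by positivity))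
  have h4 := hX.pot_le h
  have h5 := mul_le_mul_of_nonneg_left h3 (by linarith : 0 ≤ G)
  linarith

variable [DecidableEq V]

/-- On average over the transmitter, receptions reach the usable part of the load about as many
times as the load says, in units of the probability of silence. -/
theorem le_mean_reached (h : List (Finset V)) (hl : 0 < X.load h) :
    silence (X.send h) * ((∑ v, X.openLoad h v) / X.load h * (∑ v, X.send h v - 1)) ≤
      mean (X.send h) (X.reached h) := by
  have hq := X.send_mem_unit h
  have h1 := le_mean_of_singleton hq (fun W => (reached_mem h W).1)
    (g := fun u => X.reached h {u}) (fun u => (reached_mem h {u}).1) fun u => le_rfl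
  refine le_trans (mul_le_mul_of_nonneg_left ?_ (silence_nonneg hq)) h1
  have h2 : ∑ u, X.send h u * X.openLoad h u ≤ ∑ u, X.openLoad h u :=
    Finset.sum_le_sum fun u _ => mul_le_of_le_one_left (X.openLoad_nonneg h u) (hq u).2
  have h3 : ∑ u, X.send h u * X.reached h {u} =
      ((∑ v, X.openLoad h v) * ∑ u, X.send h u - ∑ u, X.send h u * X.openLoad h u) /
        X.load h := by
    rw [Finset.mul_sum, ← Finset.sum_sub_distrib, Finset.sum_div]
    refine Finset.sum_congr rfl fun u _ => ?_
    rw [reached, if_pos (Finset.card_singleton u), Finset.sum_singleton]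
    ring
  rw [h3, div_mul_eq_mul_div]
  refine div_le_div_of_nonneg_right ?_ hl.le
  linarith

/-- The guaranteed decrease of `bend (excess h)` when the nodes in `W` transmit. -/
noncomputable def dip (X : Scenario V) (G : ℝ) (h : List (Finset V)) (W : Finset V) : ℝ :=
  if W = ∅ then 0
  else min (bend (X.excess h)) 1 * (1 / (64 * X.maxWindow (5000 * G) h) + X.reached h W / 8)

theorem Tuned.bend_cons_le (hX : X.Tuned ε T G) {h : List (Finset V)} (hl : 1400 < X.load h)
    {W : Finset V} (hW : W ≠ ∅) :
    bend (X.excess (W :: h)) ≤ bend (X.excess h) - X.dip G h W := by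
  have hG := hX.G_ge
  have h0 := X.le_maxWindow (5000 * G) h
  have hr := reached_mem (X := X) h W
  set M := X.maxWindow (5000 * G) h with hM
  have hM1 : 1 / (16 * M) ≤ 1 / 16 := by
    rw [div_le_div_iff₀ (by linarith) (by norm_num)]
    linarith
  have hM0 : 0 < 1 / (16 * M) := one_div_pos.2 (by linarith)
  have h1 : X.excess (W :: h) ≤ X.excess h - 1 / (16 * M) :=
    X.excess_cons_le_sub hX.γ_le hM0.le (by linarith) (by linarith)
      (X.load_cons_le_of_nonempty hX.γ_le (5000 * G) hW h)
  have h2 : X.excess (W :: h) ≤ X.excess h - X.reached h W / 2 := by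
    by_cases hc : W.card = 1
    · obtain ⟨u, rfl⟩ := Finset.card_eq_one.1 hc
      refine X.excess_cons_le_sub hX.γ_le (by linarith) (by linarith) (by linarith) ?_
      refine (X.load_cons_singleton_le hX.γ_le u h).trans_eq ?_
      rw [reached, if_pos hc, Finset.sum_singleton]
      have : X.load h ≠ 0 := by linarith
      field_simp
    · have : X.reached h W = 0 := if_neg hc
      rw [this]
      linarith
  have h3 : X.excess (W :: h) ≤ X.excess h - (1 / (16 * M) + X.reached h W / 2) / 2 := by linarith
  refine (bend_mono h3).trans ((bend_sub_le _ (by linarith) (by linarith)).trans_eq ?_)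
  rw [dip, if_neg hW, ← hM]
  ring

/-- When the load exceeds `1400`, the dips caused by receptions outweigh the growth caused by idle
channels, and timeouts, which occur whenever somebody transmits, outweigh the growth `5 / M` of the
window if the round is high. -/
theorem Tuned.incrementBound_of_loaded (hX : X.Tuned ε T G) {h : List (Finset V)}
    (hx : -(1 / X.B.γ) < X.excess h) : ∃ U D, X.IncrementBound ε T G h U D := by
  classical
  have hG := hX.G_ge
  have hγ := X.B.γ_pos
  have hq := X.send_mem_unit h
  have hl := X.lt_load_of_lt_excess hx
  have hp : 700 ≤ ∑ v, X.send h v := by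
    have := X.load_le_two_mul hX.γ_le h
    linarith
  have h0 := X.le_maxWindow (5000 * G) h
  set M := X.maxWindow (5000 * G) h with hM
  have hM5 : 0 ≤ 5 / M := div_nonneg (by norm_num) (by linarith)
  have hM5' : 5 / M ≤ 1 := by
    rw [div_le_one (by linarith)]
    linarith
  have hM64 : 0 ≤ 1 / (64 * M) := one_div_nonneg.2 (by linarith)
  have hM64' : 1 / (64 * M) ≤ 1 := by
    rw [div_le_one (by linarith)]
    linarith
  have hζ := hX.penalty_pos
  have hζ1 := hX.penalty_le_half
  have hc0 := X.clear_nonneg h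
  have hc1 := X.clear_le_one h
  have hs := shrink_mem (X := X) (G := G) h
  set ψ := min (bend (X.excess h)) 1 with hψ
  have hψ0 : 0 < ψ := lt_min (bend_pos _) one_pos
  have hψ1 : ψ ≤ 1 := min_le_right _ _
  set s := (∑ v, X.openLoad h v) / X.load h with hsdef
  have hs0 : 0 ≤ s := div_nonneg (Finset.sum_nonneg fun v _ => X.openLoad_nonneg h v) (by linarith)
  have hs1 : s ≤ 1 := div_le_one_of_le₀ (X.sum_openLoad_le h) (by linarith)
  have hsψ : s * ψ ≤ 1 := by nlinarith
  set low : ℝ := if X.High h then 0 else 1 with hlow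
  have hlow0 : 0 ≤ low ∧ low ≤ 1 := by
    rw [hlow]
    split_ifs <;> norm_num
  have hψlow : 1 - ψ ≤ low := by
    rw [hlow]
    split_ifs with hH
    · rw [hψ, min_eq_right (one_le_bend hH), sub_self]
    · linarith
  have hdip : ∀ W, 0 ≤ X.dip G h W ∧ X.dip G h W ≤ 9 / 8 := by
    intro W
    have hr := reached_mem (X := X) h W
    unfold dip
    rw [← hM, ← hψ]
    split_ifs
    · norm_num
    · have : 0 ≤ 1 / (64 * M) + X.reached h W / 8 := by linarith
      exact ⟨mul_nonneg hψ0.le this, (mul_le_of_le_one_left this hψ1).trans (by linarith)⟩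
  have hζlow : X.penalty ε G * X.clear h * low ≤ 1 / 2 := by
    have : X.clear h * low ≤ 1 := mul_le_one₀ hc1 hlow0.1 hlow0.2
    nlinarith
  have hζlow0 : 0 ≤ X.penalty ε G * X.clear h * low := by
    have := hlow0.1
    positivity
  have hup : 0 ≤ 14 * G * (s * ψ) := by positivity
  refine ⟨fun W => 5 / M + X.penalty ε G * X.clear h * low +
      if W = ∅ then 14 * G * (s * ψ) else 0,
    fun W => (if W = ∅ then 1 / 2 * X.shrink G h else 0) + G / 2 * X.dip G h W,
    fun W => ?_, fun W => ?_, fun W => ?_, fun W => ?_, ?_⟩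
  · split_ifs <;> linarith
  · have := mul_nonneg (by linarith : 0 ≤ G / 2) (hdip W).1
    split_ifs <;> linarith
  · have h1 : G / 2 * X.dip G h W ≤ G / 2 * (9 / 8) :=
      mul_le_mul_of_nonneg_left (hdip W).2 (by linarith)
    have h2 : 14 * G * (s * ψ) ≤ 14 * G := mul_le_of_le_one_right (by linarith) hsψ
    split_ifs <;> linarith
  · have hMc := hX.maxWindow_cons_le_sub W h
    rw [← hM] at hMc
    have hlow' : X.penalty ε G * X.clear h * (1 - ψ) ≤ X.penalty ε G * X.clear h * low :=
      mul_le_mul_of_nonneg_left hψlow (by positivity)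
    have key : G * bend (X.excess (W :: h)) + X.penalty ε G *
        (ε * T - X.backlog ε (W :: h) * (1 - min (bend (X.excess (W :: h))) 1)) ≤
        G * bend (X.excess h) + X.penalty ε G * (ε * T - X.backlog ε h * (1 - ψ)) +
        X.penalty ε G * X.clear h * low + (if W = ∅ then 14 * G * (s * ψ) else 0) -
        G / 2 * X.dip G h W := by
      by_cases hW : W = ∅
      · subst hW
        have hd : X.dip G h ∅ = 0 := if_pos rfl
        rw [if_pos rfl, hd]
        have h1 : X.excess (∅ :: h) ≤ X.excess h + 2 * s := by
          refine X.excess_cons_le_add hs0 ((X.load_cons_empty_le hX.γ_le h).trans_eq ?_)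
          have : X.load h ≠ 0 := by linarith
          rw [hsdef]
          field_simp
        have h2 := (bend_mono h1).trans (bend_add_le _ hs0 hs1)
        have := tail_add_le (τ := ε * T) (by linarith : 1 ≤ G) hζ.le hζ1 (X.backlog_nonneg ε h)
          (hX.backlog_le h) hX.penalty_mul_le hX.ε_pos.le hc0 hc1 (by rfl :
          X.backlog ε (∅ :: h) = _) (by positivity) h2
        rw [← hψ] at this
        linarith
      · rw [if_neg hW]
        have := tail_sub_le (τ := ε * T) (by linarith : 1 ≤ G) hζ.le hζ1 (X.backlog_nonneg ε h)
          hX.ε_pos.le hc1 (by rfl : X.backlog ε (W :: h) = _) (hdip W).1 (hX.bend_cons_le hl hW)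
        rw [← hψ] at this
        linarith
    unfold pot
    rw [← hM, ← hψ]
    linarith
  · rw [← hM, ← hψ, mean_sub, mean_const_mul, mean_const_mul, mean_add, mean_const,
      mean_ite_empty, mean_add, mean_ite_empty, mean_const_mul]
    have hsil := silence_nonneg hq
    have hsil2 := silence_le_half hq (by linarith)
    -- the mean dip: timeouts whenever somebody transmits, and receptions
    have h1 : ψ * (1 / (128 * M)) + ψ / 8 * mean (X.send h) (X.reached h) ≤
        mean (X.send h) (X.dip G h) := by
      have h2 : ∀ W, ψ * (1 / (64 * M)) - (if W = ∅ then ψ * (1 / (64 * M)) else 0) +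
          ψ / 8 * X.reached h W ≤ X.dip G h W := by
        intro W
        unfold dip
        rw [← hM, ← hψ]
        split_ifs with hW
        · subst hW
          have : X.reached h ∅ = 0 := if_neg (by simp)
          rw [this]
          linarith
        · linarith
      have h3 := mean_mono hq h2
      rw [mean_add, mean_sub, mean_const, mean_ite_empty, mean_const_mul] at h3
      refine le_trans ?_ h3
      have h4 : 0 ≤ ψ * (1 / (64 * M)) := mul_nonneg hψ0.le hM64
      have h5 : ψ * (1 / (128 * M)) = ψ * (1 / (64 * M)) * (1 / 2) := by
        field_simp
        norm_num
      rw [h5]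
      nlinarith
    have h2 := le_mean_reached h (by linarith : 0 < X.load h)
    have h3 : silence (X.send h) * (s * 699) ≤ mean (X.send h) (X.reached h) := by
      refine le_trans ?_ h2
      rw [← hsdef]
      gcongr
      linarith
    have h4 : X.penalty ε G * X.clear h * low * (9 / 4) ≤
        1 / 4 * (X.shrink G h * silence (X.send h)) + 1 / M := by
      by_cases hH : X.High h
      · have : low = 0 := if_pos hH
        rw [this, mul_zero, zero_mul]
        have := mul_nonneg hs.1 hsil
        have : 0 ≤ 1 / M := one_div_nonneg.2 (by linarith)
        linarith
      · have : low = 1 := if_neg hH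
        rw [this]
        have := hX.clear_cost_le hH
        linarith
    have h5 : (9 - G / 512 * ψ) / M = 9 / M - G * ψ * (1 / (512 * M)) := by
      have : M ≠ 0 := by linarith
      field_simp
    have h6 : 5 / M = 5 * (1 / M) := by ring
    have h7 : 9 / M = 9 * (1 / M) := by ring
    have h8 : G * ψ * (1 / (512 * M)) = G / 4 * (ψ * (1 / (128 * M))) := by
      have : M ≠ 0 := by linarith
      field_simp
      norm_num
    have h9 : 21 * G * (s * ψ) * silence (X.send h) ≤
        G / 4 * (ψ / 8 * mean (X.send h) (X.reached h)) := by
      have h10 : 21 * (s * silence (X.send h)) ≤ 1 / 32 * mean (X.send h) (X.reached h) := by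
        have : 0 ≤ s * silence (X.send h) := mul_nonneg hs0 hsil
        linarith
      have h11 := mul_le_mul_of_nonneg_left h10 (mul_nonneg (by linarith : 0 ≤ G) hψ0.le)
      calc 21 * G * (s * ψ) * silence (X.send h) = G * ψ * (21 * (s * silence (X.send h))) := by
            ring
        _ ≤ G * ψ * (1 / 32 * mean (X.send h) (X.reached h)) := h11
        _ = _ := by ring
    have h10 := mul_le_mul_of_nonneg_left h1 (by linarith : 0 ≤ G / 4)
    have h11 : 0 ≤ 1 / M := one_div_nonneg.2 (by linarith)
    rw [h5, h6, h7, h8]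
    linarith

theorem Tuned.exists_incrementBound (hX : X.Tuned ε T G) (h : List (Finset V)) :
    ∃ U D, X.IncrementBound ε T G h U D := by
  rcases le_or_gt (X.excess h) (-(1 / X.B.γ)) with hx | hx
  · exact ⟨_, _, hX.incrementBound_of_low hx⟩
  · exact hX.incrementBound_of_loaded hx

open scoped Classical in
/-- The squared potential grows by at most a constant per round on average, and decreases in high
rounds by an amount proportional to `G`. -/
theorem Tuned.mean_exp_pot_le (hX : X.Tuned ε T G) {r : ℝ} (hr : 0 ≤ r) (h : List (Finset V))
    (hrp : 16 * (r * X.pot ε T G h * (20 * G)) ≤ 1) :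
    mean (X.send h) (fun W => Real.exp (r * (X.pot ε T G (W :: h) ^ 2 - X.pot ε T G h ^ 2))) ≤
      1 + 2 * r * (10 - if X.High h then G / 512 else 0) := by
  have hG := hX.G_ge
  have hq := X.send_mem_unit h
  obtain ⟨U, D, hUD⟩ := hX.exists_incrementBound h
  have h0 := X.le_maxWindow (5000 * G) h
  have hMp := hX.maxWindow_le_pot h
  have hpM := hX.pot_le h
  set M := X.maxWindow (5000 * G) h
  set w := X.pot ε T G h
  have h1 : ∀ W, Real.exp (r * (X.pot ε T G (W :: h) ^ 2 - w ^ 2)) ≤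
      1 + 2 * r * w * (3 / 2 * U W - 1 / 2 * D W) := fun W =>
    exp_sq_sub_le (by
      have := X.le_maxWindow (5000 * G) (W :: h)
      have := hX.maxWindow_le_pot (W :: h)
      linarith) (hUD.pot_cons_le W) (hUD.up_nonneg W) (hUD.down_nonneg W) (hUD.add_le W)
      (by linarith) hr hrp
  refine (mean_mono hq h1).trans ?_
  rw [mean_add, mean_const, mean_const_mul]
  refine add_le_add_right ?_ 1
  have hM0 : 0 < M := by linarith
  refine (mul_le_mul_of_nonneg_left hUD.mean_le (mul_nonneg (by linarith) (by linarith))).trans ?_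
  rw [mul_assoc]
  refine mul_le_mul_of_nonneg_left ?_ (by linarith)
  rw [← mul_div_assoc, div_le_iff₀ hM0]
  have hb := bend_pos (X.excess h)
  split_ifs with hH
  · rw [min_eq_right (one_le_bend hH), mul_one]
    have : (w - M) * (9 - G / 512) ≤ 0 :=
      mul_nonpos_of_nonneg_of_nonpos (by linarith) (by linarith)
    nlinarith
  · rw [min_eq_left (bend_le_one (not_le.1 hH).le)]
    set y := G * bend (X.excess h) with hy
    have hy0 : 0 ≤ y := by positivity
    have hy2 : G / 512 * bend (X.excess h) = y / 512 := by rw [hy]; ring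
    rw [hy2]
    rcases le_total (9 - y / 512) 0 with h2 | h2
    · have : w * (9 - y / 512) ≤ 0 := mul_nonpos_of_nonneg_of_nonpos (by linarith) h2
      linarith
    · have : w * (9 - y / 512) ≤ (M + y + 1) * (9 - y / 512) :=
        mul_le_mul_of_nonneg_right hpM h2
      nlinarith

/-- The exponential supermartingale that controls the number of high rounds. -/
noncomputable def highMart (X : Scenario V) (ε : ℝ) (T : ℕ) (G r : ℝ) (h : List (Finset V)) : ℝ :=
  Real.exp (r * (X.pot ε T G h ^ 2 + G / 256 * X.highCount h - 20 * h.length))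

theorem Tuned.mean_highMart_le (hX : X.Tuned ε T G) {r : ℝ} (hr : 0 ≤ r) (h : List (Finset V))
    (hrp : 16 * (r * X.pot ε T G h * (20 * G)) ≤ 1) :
    mean (X.send h) (fun W => X.highMart ε T G r (W :: h)) ≤ X.highMart ε T G r h := by
  classical
  have h1 := hX.mean_exp_pot_le hr h hrp
  have h2 : ∀ W, X.highMart ε T G r (W :: h) = X.highMart ε T G r h *
      Real.exp (-(2 * r * (10 - if X.High h then G / 512 else 0))) *
      Real.exp (r * (X.pot ε T G (W :: h) ^ 2 - X.pot ε T G h ^ 2)) := by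
    intro W
    rw [highMart, highMart, ← Real.exp_add, ← Real.exp_add, highCount, List.length_cons]
    congr 1
    push_cast
    split_ifs <;> ring
  simp only [h2]
  rw [mean_const_mul]
  set x := 2 * r * (10 - if X.High h then G / 512 else 0)
  have h3 : 1 + x ≤ Real.exp x := by linarith [Real.add_one_le_exp x]
  have h4 : 0 ≤ X.highMart ε T G r h * Real.exp (-x) :=
    mul_nonneg (Real.exp_pos _).le (Real.exp_pos _).le
  refine (mul_le_mul_of_nonneg_left (h1.trans h3) h4).trans_eq ?_
  rw [mul_assoc, ← Real.exp_add, neg_add_cancel, Real.exp_zero, mul_one]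

end Drift

end Scenario

namespace Scenario

/-! ### Tail bounds and the choice of parameters -/

section Tail

variable {V : Type*} [Fintype V] [DecidableEq V] {X : Scenario V} {ε : ℝ} {T : ℕ} {G : ℝ}

/-- High rounds are rare: Markov's inequality for `highMart`, with `r` of order `1 / (G √F)`. -/
theorem Tuned.measure_highCount_le (hX : X.Tuned ε T G) [Nonempty V] {F : ℕ} {η : ℝ}
    (hη : 22 ≤ G / 256 * η)
    (hF : 5000 * G + 1 + G * (1 + Real.log (2 * Fintype.card V) / X.B.γ) ≤ Real.sqrt F) :
    (execution X.R X.B X.pos X.l₀ X.J F).toOuterMeasure {h | η * F ≤ X.highCount h} ≤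
      ENNReal.ofReal (Real.exp (-(Real.sqrt F / (2560 * G)))) := by
  have hG := hX.G_ge
  have hN : (1 : ℝ) ≤ Fintype.card V := by exact_mod_cast Fintype.card_pos
  have hlog : 0 ≤ Real.log (2 * Fintype.card V) / X.B.γ :=
    div_nonneg (Real.log_nonneg (by linarith)) X.B.γ_pos.le
  have hG0 : 0 ≤ G * (1 + Real.log (2 * Fintype.card V) / X.B.γ) :=
    mul_nonneg (by linarith) (by linarith)
  have hsF : 0 < Real.sqrt F := by linarith
  have hF2 : Real.sqrt F ^ 2 = F := Real.sq_sqrt (Nat.cast_nonneg F)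
  set r := 1 / (2560 * G * Real.sqrt F) with hr
  have hr0 : 0 < r := by positivity
  have hpot : ∀ h : List (Finset V), h.length < F → X.pot ε T G h ≤ 8 * Real.sqrt F := by
    intro h hh
    have h1 := hX.pot_le_sqrt h
    have h2 : (h.length : ℝ) ≤ F := by exact_mod_cast hh.le
    have h3 : Real.sqrt ((5000 * G) ^ 2 + 11 * h.length) ≤ 4 * Real.sqrt F := by
      refine Real.sqrt_le_iff.2 ⟨by positivity, ?_⟩
      have : (5000 * G) ^ 2 ≤ Real.sqrt F ^ 2 := by
        have : 5000 * G ≤ Real.sqrt F := by linarith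
        gcongr
      nlinarith
    linarith
  have hpot0 : X.pot ε T G [] ^ 2 ≤ F := by
    have h1 := hX.pot_le_sqrt []
    have h2 : Real.sqrt ((5000 * G) ^ 2 + 11 * (([] : List (Finset V)).length : ℝ)) = 5000 * G := by
      simp only [List.length_nil, Nat.cast_zero, mul_zero, add_zero]
      exact Real.sqrt_sq (by linarith)
    rw [h2] at h1
    have h3 : 0 ≤ X.pot ε T G [] := by
      have := hX.maxWindow_le_pot []
      have := X.le_maxWindow (5000 * G) []
      linarith
    rw [← hF2]
    gcongr
    linarith
  have hmain := toOuterMeasure_execution_le X.R X.B X.pos X.l₀ X.J (F := F)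
    (f := X.highMart ε T G r) (fun h => (Real.exp_pos _).le)
    (fun h hh => hX.mean_highMart_le hr0.le h (by
      calc 16 * (r * X.pot ε T G h * (20 * G))
          ≤ 16 * (r * (8 * Real.sqrt F) * (20 * G)) := by
            have := hpot h hh
            gcongr
        _ = 1 := by
          rw [hr]
          field_simp
          norm_num))
    (a := Real.exp (r * (2 * F))) (Real.exp_pos _) (s := {h | η * F ≤ X.highCount h})
    (fun h hh hsup => by
      have hlen := length_of_mem_support _ _ _ _ _ hsup
      refine Real.exp_le_exp.2 (mul_le_mul_of_nonneg_left ?_ hr0.le)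
      have h1 : η * F ≤ X.highCount h := hh
      have h2 : G / 256 * (η * F) ≤ G / 256 * X.highCount h :=
        mul_le_mul_of_nonneg_left h1 (by linarith)
      have h3 : 22 * (F : ℝ) ≤ G / 256 * η * F := mul_le_mul_of_nonneg_right hη (Nat.cast_nonneg F)
      have h4 := sq_nonneg (X.pot ε T G h)
      rw [hlen]
      nlinarith)
  refine hmain.trans (ENNReal.ofReal_le_ofReal ?_)
  rw [highMart, ← Real.exp_sub]
  refine Real.exp_le_exp.2 ?_
  have h1 : Real.sqrt F / (2560 * G) = r * F := by
    rw [hr, div_mul_eq_mul_div, one_mul, div_eq_div_iff (by positivity) (by positivity)]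
    linear_combination 2560 * G * hF2
  have h2 : X.pot ε T G [] ^ 2 + G / 256 * X.highCount [] -
      20 * (([] : List (Finset V)).length : ℝ) ≤ F := by
    simp only [highCount, List.length_nil]
    push_cast
    linarith
  rw [h1]
  have := mul_le_mul_of_nonneg_left h2 hr0.le
  linarith

/-- A node survives a run with few successes and few high rounds only with tiny probability. -/
theorem measure_survivor_le [Nontrivial V] {m : ℕ} (hm3 : 3 ≤ m) (hm : X.B.γ * m ≤ 1 / 2)
    (hmε : 1 / ((m : ℝ) - 2) ≤ quiet X.B.pHat * X.B.pHat / 4 * ε / 16) {F : ℕ} (v : V) :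
    (execution X.R X.B X.pos X.l₀ X.J F).toOuterMeasure
      {h | 0 < (X.state h v).l ∧ ε / 2 * F ≤ X.clearCount h ∧
        X.highCount h ≤ quiet X.B.pHat * X.B.pHat / 4 * ε / 100 * F ∧
        4 / quiet X.B.pHat * successes X.R X.pos X.J h ≤
          quiet X.B.pHat * X.B.pHat / 4 * ε / 8 * F} ≤
      ENNReal.ofReal (Real.exp (-(quiet X.B.pHat / 16 *
        (quiet X.B.pHat * X.B.pHat / 4 * ε / 4 * F)))) := by
  have hQ := quiet_pos X.B.pHat
  have hQ1 := quiet_le_one X.B.pHat_lt_one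
  have hp0 := X.B.pHat_pos
  have hp1 := X.B.pHat_lt_one
  set k := quiet X.B.pHat * X.B.pHat / 4 with hk
  have hk0 : 0 < k := by positivity
  have hk1 : k ≤ 1 := by
    have : quiet X.B.pHat * X.B.pHat ≤ 1 := mul_le_one₀ hQ1 hp0.le hp1.le
    linarith
  have hmain := toOuterMeasure_execution_le X.R X.B X.pos X.l₀ X.J (F := F)
    (f := X.survivorMart m v)
    (fun h => by
      unfold survivorMart
      split_ifs
      · exact (Real.exp_pos _).le
      · exact le_rfl)
    (fun h _ => X.mean_survivorMart_le hm3 hm v h)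
    (a := Real.exp (quiet X.B.pHat / 16 * (k * ε / 4 * F))) (Real.exp_pos _)
    (s := {h | 0 < (X.state h v).l ∧ ε / 2 * F ≤ X.clearCount h ∧
        X.highCount h ≤ k * ε / 100 * F ∧
        4 / quiet X.B.pHat * successes X.R X.pos X.J h ≤ k * ε / 8 * F})
    (fun h hh hsup => by
      have hlen := length_of_mem_support _ _ _ _ _ hsup
      obtain ⟨hl, hcl, hhi, hsuc⟩ := hh
      rw [survivorMart, if_pos hl]
      refine Real.exp_le_exp.2 (mul_le_mul_of_nonneg_left ?_ (by positivity))
      rw [hlen, ← hk]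
      have h1 := NodeState.slack_nonneg X.B hm3 (X.state h v)
      have h2 : (F : ℝ) / (m - 2) ≤ k * ε / 16 * F := by
        rw [div_eq_mul_one_div, mul_comm]
        exact mul_le_mul_of_nonneg_right hmε (Nat.cast_nonneg F)
      have h3 : k * (ε / 2 * F) ≤ k * X.clearCount h := mul_le_mul_of_nonneg_left hcl hk0.le
      have h4 : (k + 3 / 2) * X.highCount h ≤ 5 / 2 * (k * ε / 100 * F) := by
        have h5 : 0 ≤ X.highCount h := by
          clear * -
          induction h with
          | nil => exact le_rfl
          | cons W h ih =>
            rw [highCount]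
            split_ifs <;> linarith
        exact mul_le_mul (by linarith) hhi h5 (by norm_num)
      have hmε0 : 0 < 1 / ((m : ℝ) - 2) := by
        have : (3 : ℝ) ≤ m := by exact_mod_cast hm3
        exact one_div_pos.2 (by linarith)
      have h6 : 0 ≤ k * ε * F := mul_nonneg (by linarith) (Nat.cast_nonneg F)
      nlinarith)
  refine hmain.trans (ENNReal.ofReal_le_ofReal ?_)
  rw [Real.exp_neg, ← one_div]
  refine div_le_div_of_nonneg_right ?_ (Real.exp_pos _).le
  rw [survivorMart]
  split_ifs
  · have h1 : X.state [] v = NodeState.init X.B (X.l₀ v) := rfl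
    rw [h1, NodeState.slack_init]
    simp [clearCount, highCount, successes]
  · exact zero_le_one

end Tail

/-- Once `log N` exceeds a bound that depends on `ε` and `G`, the condition
`γ (log T + log log N) ≤ 1 / 2` makes `exp (1 / γ)` large enough for the potential to work. -/
theorem tuned_of_large {V : Type*} {X : Scenario V} {ε G ℓ : ℝ} {T : ℕ} (hε : 0 < ε)
    (hε1 : ε ≤ 1) (hT : 1 ≤ T) (hJ : X.J.IsBounded X.R ε T) (hG : 5120 ≤ G)
    (hℓ : 28 * G ≤ ℓ) (hℓ1 : 252 * G / (ε * quiet X.B.pHat) ≤ ℓ)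
    (hℓ2 : 63 * G * (5000 * G + 1) / ε ≤ ℓ) (hγ : X.B.γ ≤ 1 / 4)
    (hγT : X.B.γ * (Real.log T + Real.log ℓ) ≤ 1 / 2) : X.Tuned ε T G := by
  have hγ0 := X.B.γ_pos
  have hQ := quiet_pos X.B.pHat
  have hℓ0 : 0 < ℓ := by linarith
  have hT1 : (1 : ℝ) ≤ T := by exact_mod_cast hT
  set E := Real.exp (1 / X.B.γ) with hE
  -- `(T ℓ) ^ 2 ≤ exp (1 / γ)`
  have hTE : (T * ℓ) ^ 2 ≤ E := by
    rw [← Real.log_le_iff_le_exp (by positivity), Real.log_pow, Real.log_mul (by positivity)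
      (by positivity), le_div_iff₀ hγ0]
    push_cast
    linarith
  have hE0 : 0 < E := Real.exp_pos _
  have hζ : X.penalty ε G = 28 * G / (ε * E) := rfl
  have h1 : ℓ ≤ T * ℓ := le_mul_of_one_le_left hℓ0.le hT1
  have h2 : ℓ * ℓ ≤ E := by nlinarith
  have h3 : T * ℓ ≤ E := by nlinarith
  have h4 : ℓ ≤ E := by linarith
  refine ⟨hγ, hG, hε, hε1, X.backlog_le hε.le hT hJ, ?_, ?_, ?_, ?_⟩
  · rw [hζ, div_mul_eq_mul_div, div_le_one (by positivity)]
    have : 28 * G * T ≤ E := by nlinarith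
    nlinarith
  · rw [hζ, ← mul_div_assoc, div_le_iff₀ (by positivity)]
    rw [div_le_iff₀ (by positivity)] at hℓ1
    have := mul_le_mul_of_nonneg_right h4 (by positivity : 0 ≤ ε * quiet X.B.pHat)
    linarith
  · rw [hζ, ← mul_div_assoc, div_mul_eq_mul_div, div_le_one (by positivity)]
    rw [div_le_iff₀ hε] at hℓ2
    have := mul_le_mul_of_nonneg_right h4 hε.le
    nlinarith
  · linarith

/-- What the lower bound for the number `F` of rounds is used for; here `ℓ` stands for `log N`. -/
theorem rounds_bounds {ε γ ℓ F : ℝ} {T : ℕ} (hε : 0 < ε) (hε1 : ε ≤ 1) (hγ : 0 < γ)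
    (hγ1 : γ ≤ 1) (hℓ : 2 ≤ ℓ) (hF : T * ℓ / ε + ℓ ^ 4 / (γ * ε) ^ 2 ≤ F) :
    (T : ℝ) ≤ F / 2 ∧ ℓ ^ 2 / γ ≤ Real.sqrt F ∧ ℓ ^ 2 ≤ F ∧ ℓ ^ 2 ≤ Real.sqrt F := by
  have hT0 : (0 : ℝ) ≤ T := Nat.cast_nonneg T
  have hF1 : T * ℓ / ε ≤ F := by
    have : 0 ≤ ℓ ^ 4 / (γ * ε) ^ 2 := by positivity
    linarith
  have hF2 : (ℓ ^ 2 / γ) ^ 2 ≤ F := by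
    have h1 : (ℓ ^ 2 / γ) ^ 2 ≤ ℓ ^ 4 / (γ * ε) ^ 2 := by
      rw [div_pow, ← pow_mul]
      refine div_le_div_of_nonneg_left (by positivity) (by positivity) ?_
      exact pow_le_pow_left₀ (by positivity) (mul_le_of_le_one_right hγ.le hε1) 2
    have : 0 ≤ T * ℓ / ε := by positivity
    linarith
  have hsF : ℓ ^ 2 / γ ≤ Real.sqrt F := Real.le_sqrt_of_sq_le hF2
  have hsF1 : ℓ ^ 2 ≤ ℓ ^ 2 / γ := le_div_self (by positivity) hγ hγ1
  have h4 : 1 ≤ ℓ ^ 2 := one_le_pow₀ (by linarith)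
  refine ⟨?_, hsF, ?_, hsF1.trans hsF⟩
  · have h1 : T * ℓ ≤ T * ℓ / ε := le_div_self (by positivity) hε hε1
    have h2 : T * 2 ≤ T * ℓ := mul_le_mul_of_nonneg_left hℓ hT0
    linarith
  · have h1 : ℓ ^ 2 ≤ (ℓ ^ 2) ^ 2 := le_self_pow₀ h4 two_ne_zero
    have h2 : (ℓ ^ 2) ^ 2 ≤ (ℓ ^ 2 / γ) ^ 2 := pow_le_pow_left₀ (by positivity) hsF1 2
    linarith

/-- A run with few successes has many high rounds, or some node survives it although there are
few high rounds; the jammer leaves the round clear often enough. -/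
theorem few_successes_inter_support_subset {N : ℕ} (X : Scenario (Fin N)) {ε a b : ℝ} {T F : ℕ}
    (h0 : ∃ v, 0 < X.l₀ v) (hε : 0 ≤ ε) (hT : 1 ≤ T) (hJ : X.J.IsBounded X.R ε T)
    (hTF : (T : ℝ) ≤ F / 2) :
    {h | b ≤ 4 / quiet X.B.pHat * successes X.R X.pos X.J h}ᶜ ∩
        (execution X.R X.B X.pos X.l₀ X.J F).support ⊆
      {h | a ≤ X.highCount h} ∪ ⋃ v, {h | 0 < (X.state h v).l ∧ ε / 2 * F ≤ X.clearCount h ∧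
        X.highCount h ≤ a ∧ 4 / quiet X.B.pHat * successes X.R X.pos X.J h ≤ b} := by
  rintro h ⟨hh, hsup⟩
  have hh' : 4 / quiet X.B.pHat * successes X.R X.pos X.J h < b := not_le.1 fun hb => hh hb
  rcases le_or_gt a (X.highCount h) with hhi | hhi
  · exact Or.inl hhi
  · obtain ⟨v, hv⟩ := X.exists_leader h0 hsup
    have hlen := length_of_mem_support _ _ _ _ _ hsup
    refine Or.inr (Set.mem_iUnion.2 ⟨v, hv, ?_, hhi.le, hh'.le⟩)
    rw [X.clearCount_eq F h hlen]
    have h1 := X.sub_le_sum_clear hε hT hJ F h hlen.ge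
    have h2 := mul_le_mul_of_nonneg_left hTF hε
    linarith

/-- A union bound over the possible survivors: `2 N ^ (-(c + 1)) ≤ N ^ (-c)`. -/
theorem exp_add_mul_exp_le {N c : ℝ} (hN : 2 ≤ N) :
    Real.exp (-((c + 1) * Real.log N)) + N * Real.exp (-((c + 2) * Real.log N)) ≤
      1 / N ^ c := by
  have hN0 : 0 < N := by linarith
  have h2 : N * Real.exp (-((c + 2) * Real.log N)) = Real.exp (-((c + 1) * Real.log N)) := by
    calc N * Real.exp (-((c + 2) * Real.log N))
        = Real.exp (Real.log N) * Real.exp (-((c + 2) * Real.log N)) := by rw [Real.exp_log hN0]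
      _ = Real.exp (-((c + 1) * Real.log N)) := by
        rw [← Real.exp_add]
        congr 1
        ring
  have h3 : 1 / N ^ c = N * Real.exp (-((c + 1) * Real.log N)) := by
    calc 1 / N ^ c = Real.exp (Real.log N + -((c + 1) * Real.log N)) := by
          rw [Real.rpow_def_of_pos hN0, one_div, ← Real.exp_neg]
          congr 1
          ring
      _ = N * Real.exp (-((c + 1) * Real.log N)) := by rw [Real.exp_add, Real.exp_log hN0]
  rw [h2, h3, ← two_mul]
  exact mul_le_mul_of_nonneg_right hN (Real.exp_pos _).le

/-- With `log N` large, a run of `F` rounds has more than the required number of successes, except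
with probability `N ^ (-c)`. -/
theorem le_measure_successes {N : ℕ} (X : Scenario (Fin N)) {ε c G : ℝ} {T F m : ℕ}
    (hc : 1 ≤ c) (h0 : ∃ v, 0 < X.l₀ v) (hX : X.Tuned ε T G) (hT : 1 ≤ T)
    (hJ : X.J.IsBounded X.R ε T)
    (hη : 22 ≤ G / 256 * (quiet X.B.pHat * X.B.pHat / 4 * ε / 100))
    (hm3 : 3 ≤ m) (hm : X.B.γ * m ≤ 1 / 2)
    (hmε : 1 / ((m : ℝ) - 2) ≤ quiet X.B.pHat * X.B.pHat / 4 * ε / 16)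
    (hℓ : 5004 * G * (c + 1) ≤ Real.log N)
    (hℓ1 : 64 * (c + 2) / (quiet X.B.pHat * (quiet X.B.pHat * X.B.pHat / 4) * ε) ≤ Real.log N)
    (hF : T * Real.log N / ε + Real.log N ^ 4 / (X.B.γ * ε) ^ 2 ≤ F) :
    ENNReal.ofReal (1 - 1 / (N : ℝ) ^ c) ≤
      (execution X.R X.B X.pos X.l₀ X.J F).toOuterMeasure
        {h | quiet X.B.pHat * X.B.pHat / 4 * ε / 8 * F ≤
          4 / quiet X.B.pHat * successes X.R X.pos X.J h} := by
  have hG := hX.G_ge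
  have hε := hX.ε_pos
  have hγ := X.B.γ_pos
  have hγ1 : X.B.γ ≤ 1 := hX.γ_le.trans (by norm_num)
  have hQ := quiet_pos X.B.pHat
  have hp0 := X.B.pHat_pos
  set μ := (execution X.R X.B X.pos X.l₀ X.J F).toOuterMeasure with hμ
  set Q := quiet X.B.pHat with hQdef
  set k := Q * X.B.pHat / 4 with hk
  have hk0 : 0 < k := by positivity
  set ℓ := Real.log N with hℓdef
  have hℓ10 : 5004 * G * 2 ≤ ℓ :=
    (mul_le_mul_of_nonneg_left (by linarith) (by linarith)).trans hℓ
  have hN0 : 0 < (N : ℝ) := by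
    rcases Nat.eq_zero_or_pos N with h | h
    · rw [hℓdef, h, Nat.cast_zero, Real.log_zero] at hℓ10
      linarith
    · exact_mod_cast h
  have hN2 : (2 : ℝ) ≤ N := by
    have h1 := Real.add_one_le_exp ℓ
    rw [hℓdef, Real.exp_log hN0] at h1
    linarith
  have : Nontrivial (Fin N) := Fin.nontrivial_iff_two_le.2 (by exact_mod_cast hN2)
  obtain ⟨hTF, hsF, hF2, hsF2⟩ := rounds_bounds hε hX.ε_le hγ hγ1 (by linarith) hF
  have hsqrt : 5000 * G + 1 + G * (1 + Real.log (2 * Fintype.card (Fin N)) / X.B.γ) ≤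
      Real.sqrt F := by
    refine le_trans ?_ hsF
    rw [Fintype.card_fin, Real.log_mul (by norm_num) hN0.ne', ← hℓdef]
    have h1 : Real.log 2 ≤ 1 := by
      have := Real.log_two_lt_d9
      linarith
    rw [le_div_iff₀ hγ]
    have h2 : (5000 * G + 1 + G * (1 + (Real.log 2 + ℓ) / X.B.γ)) * X.B.γ =
        (5001 * G + 1) * X.B.γ + G * (Real.log 2 + ℓ) := by
      field_simp
      ring
    have h3 : (5001 * G + 1) * X.B.γ ≤ 5001 * G + 1 :=
      mul_le_of_le_one_right (by linarith) hγ1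
    have h4 : G * (Real.log 2 + ℓ) ≤ G * (1 + ℓ) :=
      mul_le_mul_of_nonneg_left (by linarith) (by linarith)
    have h5 : 5004 * G * 2 * ℓ ≤ ℓ * ℓ := mul_le_mul_of_nonneg_right hℓ10 (by linarith)
    have h6 : G * 1 ≤ G * ℓ := mul_le_mul_of_nonneg_left (by linarith) (by linarith)
    rw [h2, sq]
    linarith
  have hexp1 : Real.exp (-(Real.sqrt F / (2560 * G))) ≤ Real.exp (-((c + 1) * ℓ)) := by
    refine Real.exp_le_exp.2 (neg_le_neg ?_)
    rw [le_div_iff₀ (by positivity)]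
    refine le_trans ?_ hsF2
    have h1 : 5004 * G * (c + 1) * ℓ ≤ ℓ * ℓ := mul_le_mul_of_nonneg_right hℓ (by linarith)
    have h2 : 0 ≤ G * (c + 1) * ℓ := by
      have : 0 ≤ ℓ := by linarith
      positivity
    linarith
  have hhigh : μ {h | k * ε / 100 * F ≤ X.highCount h} ≤
      ENNReal.ofReal (Real.exp (-((c + 1) * ℓ))) :=
    (hX.measure_highCount_le hη hsqrt).trans (ENNReal.ofReal_le_ofReal hexp1)
  have hexp2 : Real.exp (-(Q / 16 * (k * ε / 4 * F))) ≤ Real.exp (-((c + 2) * ℓ)) := by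
    refine Real.exp_le_exp.2 (neg_le_neg ?_)
    rw [div_le_iff₀ (by positivity)] at hℓ1
    have h1 : Q * k * ε * ℓ ^ 2 ≤ Q * k * ε * F :=
      mul_le_mul_of_nonneg_left hF2 (by positivity)
    have h2 : 64 * (c + 2) * ℓ ≤ ℓ * (Q * k * ε) * ℓ :=
      mul_le_mul_of_nonneg_right hℓ1 (by linarith)
    linarith
  have hsurv : ∀ v : Fin N, μ {h | 0 < (X.state h v).l ∧ ε / 2 * F ≤ X.clearCount h ∧
      X.highCount h ≤ k * ε / 100 * F ∧ 4 / Q * successes X.R X.pos X.J h ≤ k * ε / 8 * F} ≤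
      ENNReal.ofReal (Real.exp (-((c + 2) * ℓ))) := fun v =>
    (measure_survivor_le hm3 hm hmε v).trans (ENNReal.ofReal_le_ofReal hexp2)
  have hbad : μ {h | k * ε / 8 * F ≤ 4 / Q * successes X.R X.pos X.J h}ᶜ ≤
      ENNReal.ofReal (1 / (N : ℝ) ^ c) := by
    refine (PMF.toOuterMeasure_mono _
      (X.few_successes_inter_support_subset (a := k * ε / 100 * F) h0 hε.le hT hJ hTF)).trans
      ((MeasureTheory.measure_union_le _ _).trans ?_)
    refine (add_le_add hhigh ((MeasureTheory.measure_iUnion_fintype_le _ _).trans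
      (Finset.sum_le_sum fun v _ => hsurv v))).trans ?_
    rw [Finset.sum_const, Finset.card_univ, Fintype.card_fin, nsmul_eq_mul,
      ← ENNReal.ofReal_natCast N, ← ENNReal.ofReal_mul (Nat.cast_nonneg N),
      ← ENNReal.ofReal_add (Real.exp_pos _).le (by positivity)]
    exact ENNReal.ofReal_le_ofReal (exp_add_mul_exp_le hN2)
  rw [ENNReal.ofReal_sub _ (by positivity), ENNReal.ofReal_one, tsub_le_iff_right]
  have htotal : μ Set.univ = 1 := by
    rw [hμ, PMF.toOuterMeasure_apply_eq_one_iff]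
    exact Set.subset_univ _
  rw [← htotal, ← Set.union_compl_self
    {h | k * ε / 8 * F ≤ 4 / Q * successes X.R X.pos X.J h}]
  exact (MeasureTheory.measure_union_le _ _).trans (add_le_add_right hbad _)

/-- The same bound with the numerical conditions made explicit: `Q` stands for `quiet p̂`, and
`G` and `m` are chosen from `p̂` and `ε` alone. -/
theorem le_measure_successes_of_large {N : ℕ} (X : Scenario (Fin N)) {ε c G Q k : ℝ} {T F m : ℕ}
    (hQ : quiet X.B.pHat = Q) (hk : Q * X.B.pHat / 4 = k) (hc : 1 ≤ c) (hε : 0 < ε)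
    (hε1 : ε ≤ 1) (h0 : ∃ v, 0 < X.l₀ v) (hT : 1 ≤ T) (hJ : X.J.IsBounded X.R ε T)
    (hG : 5632 = G * (k * ε / 100)) (hm : 16 / (k * ε) + 3 ≤ m)
    (hℓ : Real.exp m + 5004 * G * (c + 1) + 252 * G / (ε * Q) + 63 * G * (5000 * G + 1) / ε +
      64 * (c + 2) / (Q * k * ε) ≤ Real.log N)
    (hγ : X.B.γ ≤ 1 / 2 / (Real.log T + Real.log (Real.log N)))
    (hF : T * Real.log N / ε + Real.log N ^ 4 / (X.B.γ * ε) ^ 2 ≤ F) :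
    ENNReal.ofReal (1 - 1 / (N : ℝ) ^ c) ≤
      (execution X.R X.B X.pos X.l₀ X.J F).toOuterMeasure
        {h | k * ε / 8 * F ≤ 4 / Q * successes X.R X.pos X.J h} := by
  subst hQ
  subst hk
  have hQ0 := quiet_pos X.B.pHat
  have hQ1 := quiet_le_one X.B.pHat_lt_one
  have hp0 := X.B.pHat_pos
  have hp1 := X.B.pHat_lt_one
  set Q := quiet X.B.pHat with hQdef
  set k := Q * X.B.pHat / 4 with hk
  have hk0 : 0 < k := by positivity
  have hkε1 : k * ε ≤ 1 := by
    have h1 : Q * X.B.pHat ≤ 1 := mul_le_one₀ hQ1 hp0.le hp1.le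
    exact mul_le_one₀ (by linarith) hε.le hε1
  have hkε : 0 < k * ε := mul_pos hk0 hε
  have hG1 : 5120 ≤ G := by
    by_contra! h
    have h1 : G * (k * ε / 100) ≤ 5120 * (k * ε / 100) :=
      mul_le_mul_of_nonneg_right h.le (by linarith)
    linarith
  have hkε' : 0 < 16 / (k * ε) := by positivity
  have hm3 : (3 : ℝ) ≤ m := by linarith
  set ℓ := Real.log N with hℓdef
  have hp1 := Real.exp_pos m
  have hp2 : 0 < 5004 * G * (c + 1) := by positivity
  have hp3 : 0 < 252 * G / (ε * Q) := by positivity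
  have hp4 : 0 < 63 * G * (5000 * G + 1) / ε := by positivity
  have hp5 : 0 < 64 * (c + 2) / (Q * k * ε) := by positivity
  have hℓm : Real.exp m ≤ ℓ := by linarith
  have hmℓ : (m : ℝ) ≤ Real.log ℓ := (Real.le_log_iff_exp_le (hp1.trans_le hℓm)).2 hℓm
  have hT0 : 0 ≤ Real.log T := Real.log_natCast_nonneg T
  have hγ0 := X.B.γ_pos
  have hγT : X.B.γ * (Real.log T + Real.log ℓ) ≤ 1 / 2 := (le_div_iff₀ (by linarith)).1 hγ
  have hγm : X.B.γ * m ≤ 1 / 2 :=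
    (mul_le_mul_of_nonneg_left (by linarith) hγ0.le).trans hγT
  have hγ3 : X.B.γ * 3 ≤ X.B.γ * m := mul_le_mul_of_nonneg_left hm3 hγ0.le
  have hG2 : 5004 * G * 2 ≤ 5004 * G * (c + 1) :=
    mul_le_mul_of_nonneg_left (by linarith) (by linarith)
  have hX : X.Tuned ε T G := tuned_of_large (ℓ := ℓ) hε hε1 hT hJ hG1 (by linarith)
    (by linarith) (by linarith) (by linarith) hγT
  have hη : 22 ≤ G / 256 * (k * ε / 100) := by linarith
  refine X.le_measure_successes hc h0 hX hT hJ hη (by exact_mod_cast hm3) hγm ?_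
    (by linarith) (by linarith) hF
  change 1 / ((m : ℝ) - 2) ≤ k * ε / 16
  rw [div_le_div_iff₀ (by linarith) (by norm_num)]
  have h1 : 16 / (k * ε) ≤ m - 2 := by linarith
  rw [div_le_iff₀ hkε] at h1
  linarith

/-- Discarding the factors of the required success rate that are at most `1`. -/
theorem rate_le {ρ b q : ℝ} (hρ : 0 < ρ) (hb : 0 ≤ b) (hq : q < 1) :
    (1 - b) * ρ * Real.exp (-ρ / (1 - q)) ≤ ρ := by
  have h3 : Real.exp (-ρ / (1 - q)) ≤ 1 :=
    Real.exp_le_one_iff.2 (div_nonpos_of_nonpos_of_nonneg (by linarith) (by linarith))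
  have h4 : (1 - b) * ρ ≤ ρ := mul_le_of_le_one_left hρ.le (by linarith)
  calc (1 - b) * ρ * Real.exp (-ρ / (1 - q)) ≤ ρ * Real.exp (-ρ / (1 - q)) :=
        mul_le_mul_of_nonneg_right h4 (Real.exp_pos _).le
    _ ≤ ρ := mul_le_of_le_one_right hρ.le h3

end Scenario

end Blown

theorem mainTheorem3 (pHat β' : ℝ) (hpHat : 0 < pHat ∧ pHat < 1) (hβ' : 0 < β') :
    ∃ ρ : ℝ → ℝ, (∀ ε, 0 < ρ ε) ∧
    ∀ c : ℝ, 1 ≤ c →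
    ∃ K > (0 : ℝ), ∃ C > (0 : ℝ),
    ∀ ε : ℝ, 0 < ε → ε ≤ 1 →
    ∃ N₀ : ℕ, ∀ N : ℕ, N₀ ≤ N →
    ∀ (R : Blown.Radio) (B : Blown.Protocol) (pos : Fin N → Blown.Plane) (l₀ : Fin N → ℕ)
      (T F : ℕ) (J : Blown.Jammer (Fin N)),
      B.pHat = pHat →
      Function.Injective pos →
      (∀ u v, dist (pos u) (pos v) ≤ R.range) →
      (∃ v, 0 < l₀ v) →
      1 ≤ T →
      B.γ ≤ C / (Real.log T + Real.log (Real.log N)) →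
      J.IsBounded R ε T →
      K * (T * Real.log N / ε + Real.log N ^ 4 / (B.γ * ε) ^ 2) ≤ F →
      ENNReal.ofReal (1 - 1 / (N : ℝ) ^ c) ≤
        (Blown.execution R B pos l₀ J F).toOuterMeasure
          {h | (1 - ε * β') * ρ ε * Real.exp (-ρ ε / (1 - pHat)) * F ≤
            (Blown.successes R pos J h : ℝ)} := by
  have hQ := Blown.Scenario.quiet_pos pHat
  set Q := Blown.Scenario.quiet pHat with hQdef
  set k := Q * pHat / 4 with hk
  have hk0 : 0 < k := div_pos (mul_pos hQ hpHat.1) (by norm_num)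
  have hQ4 : 0 < Q / 4 := by linarith
  refine ⟨fun ε => if 0 < ε then k * ε / 8 * (Q / 4) else 1, fun ε => ?_, fun c hc =>
    ⟨1, one_pos, 1 / 2, by norm_num, fun ε hε hε1 => ?_⟩⟩
  · dsimp only
    split_ifs with hε
    · exact mul_pos (by linarith [mul_pos hk0 hε]) hQ4
    · exact one_pos
  simp only [if_pos hε]
  have hkε : 0 < k * ε := mul_pos hk0 hε
  have hρ : 0 < k * ε / 8 * (Q / 4) := mul_pos (by linarith) hQ4
  -- `m` caps the windows in the slack: its drift `1 / (m - 2)` has to be small compared with `k ε`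
  obtain ⟨m, hm⟩ := exists_nat_ge (16 / (k * ε) + 3)
  -- `G` is so large that the potential pays for a fraction `k ε / 100` of high rounds:
  -- `22 = G / 256 * (k ε / 100)`
  obtain ⟨G, hG⟩ : ∃ G : ℝ, 5632 = G * (k * ε / 100) :=
    ⟨5632 / (k * ε / 100), (div_mul_cancel₀ _ (by linarith)).symm⟩
  -- the lower bound required of `log N`
  obtain ⟨L, hL⟩ : ∃ L, L = Real.exp m + 5004 * G * (c + 1) + 252 * G / (ε * Q) +
    63 * G * (5000 * G + 1) / ε + 64 * (c + 2) / (Q * k * ε) := ⟨_, rfl⟩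
  refine ⟨⌈Real.exp L⌉₊, fun N hN R B pos l₀ T F J hB hinj hdist hl hT hγ hJ hF => ?_⟩
  have hLN : L ≤ Real.log N := by
    have h1 : Real.exp L ≤ N := (Nat.le_ceil _).trans (by exact_mod_cast hN)
    exact (Real.le_log_iff_exp_le ((Real.exp_pos _).trans_le h1)).2 h1
  rw [hL] at hLN
  rw [one_mul] at hF
  have hmain := Blown.Scenario.le_measure_successes_of_large
    (⟨R, B, pos, l₀, J, hinj, hdist⟩ : Blown.Scenario (Fin N)) (Q := Q) (k := k)
    (by rw [hB]) (by rw [hB]) hc hε hε1 hl hT hJ hG hm hLN hγ hF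
  refine hmain.trans ((Blown.execution R B pos l₀ J F).toOuterMeasure.mono fun h hh => ?_)
  have h1 := mul_le_mul_of_nonneg_left hh.out hQ4.le
  have h2 : Q / 4 * (4 / Q * (Blown.successes R pos J h : ℝ)) = Blown.successes R pos J h := by
    field_simp
  rw [h2] at h1
  refine le_trans (mul_le_mul_of_nonneg_right
    (Blown.Scenario.rate_le hρ (mul_pos hε hβ').le hpHat.2) (Nat.cast_nonneg F)) ?_
  linarith
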